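/- Let $p\in(0,1)$ and set $\phi_p(1)=\sqrt{\tfrac{1-p}{p}}$, $\phi_p(2)=-\sqrt{\tfrac{p}{1-p}}$. For $d>0$ and real $a,b,c$ with $$pa+(1-p)b=pb+(1-p)c=1,$$ let $\lambda=d(1-b)^2$. For $n\ge 1$ let $X=(X_1,\dots,X_n)$ be i.i.d. labels in $\{1,2\}$ with $\mathbb P(X_i=1)=p$, and let $G=(G_{i,j})_{1\le i<j\le n}$ be the stochastic block model graph: given $X$, the edge indicators $G_{i,j}$ are independent Bernoulli variables with mean $M_{X_i,X_j}$, where $M=\frac dn\begin{pmatrix}a&b\\ b&c\end{pmatrix}$ (its entries are in $[0,1]$ for $d$ and then $n$ large enough). For $\lambda>0$ let $\tilde X_i=\phi_p(X_i)$ and $$Y_{i,j}=\sqrt{\tfrac{\lambda}{n}}\,\tilde X_i\tilde X_j+Z_{i,j},\qquad 1\le i<j\le n,$$ with $Z_{i,j}$ i.i.d. $\mathcal N(0,1)$ independent of $\tilde X$. Let $I(\cdot,\cdot)$ denote mutual information (in nats), and define, for $q\ge0$, $$\mathcal F_g(\lambda,q)=-\frac{\lambda q^2}{4}+\mathbb E\log\Big[p\,e^{\sqrt{\frac{1-p}{p}}(\sqrt{\lambda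 q}Z_0+\lambda q\tilde X_0)-\frac{\lambda(1-p)}{2p}q}+(1-p)\,e^{-\sqrt{\frac{p}{1-p}}(\sqrt{\lambda q}Z_0+\lambda q\tilde X_0)-\frac{\lambda p}{2(1-p)}q}\Big],$$ where $Z_0\sim\mathcal N(0,1)$ and $\tilde X_0\sim p\,\delta_{\phi_p(1)}+(1-p)\,\delta_{\phi_p(2)}$ are independent, and $\Phi_g(\lambda)=\sup_{q\ge0}\mathcal F_g(\lambda,q)$. **Theorem.** There is a constant $C>0$, depending only on $p$, such that for every $\lambda>0$ the supremum $\Phi_g(\lambda)$ is finite and the following holds for all $d$ large enough (depending on $p$ and $\lambda$) and all $a,b,c$ as above with $d(1-b)^2=\lambda$: the mutual informations $I(X,G)$ and $I(\tilde X,Y)$ are finite for all $n$, and $$\limsup_{n\to\infty}\frac1n\Big|I(X,G)-I(\tilde X,Y)\Big|\le C\sqrt{\frac{\lambda}{d}},\qquad \limsup_{n\to\infty}\Big|\frac1n I(X,G)-\Big(\frac\lambda4-\Phi_g(\lambda)\Big)\Big|\le C\sqrt{\frac{\lambda}{d}}.$$ -/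

import Mathlib

open MeasureTheory ProbabilityTheory Filter
open scoped ENNReal unitInterval

namespace SBM

noncomputable section

/-- The mutual information `I(U, V)` (in nats) of a pair of random variables `(U, V)` with joint
law `ρ`: the Kullback-Leibler divergence of `ρ` from the product of its two marginals. -/
def mutualInfo {α β : Type*} [MeasurableSpace α] [MeasurableSpace β] (ρ : Measure (α × β)) :
    ℝ≥0∞ :=
  InformationTheory.klDiv ρ (ρ.fst.prod ρ.snd)

/-- The pairs `1 ≤ i < j ≤ n` (the vertices being indexed by `Fin n`). -/
abbrev Pairs (n : ℕ) : Type := {e : Fin n × Fin n // e.1 < e.2}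

/-- The law of one label. The labels `1, 2` are represented by `0, 1 : Fin 2`;
the first one has probability `p`. -/
def labelLaw (p : I) : Measure (Fin 2) := bernoulliMeasure 0 1 p

/-- The law of the vector `X = (X_1, …, X_n)` of i.i.d. labels. -/
def labelsLaw (p : I) (n : ℕ) : Measure (Fin n → Fin 2) := Measure.pi fun _ => labelLaw p

/-- Given the labels `x`, the edge indicators `G_{i,j}`, `i < j`, are independent, and `G_{i,j}`
is Bernoulli with mean `M_{x_i, x_j}`. -/
def edgeKernel (M : Matrix (Fin 2) (Fin 2) I) (n : ℕ) :
    Kernel (Fin n → Fin 2) (Pairs n → Bool) :=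
  Kernel.ofFunOfCountable fun x =>
    Measure.pi fun e : Pairs n => bernoulliMeasure true false (M (x e.1.1) (x e.1.2))

/-- The stochastic block model with parameters `(M, n, p)`: the joint law of the labels `X` and of
the random graph `G`, given by its edge indicators. -/
def sbmLaw (M : Matrix (Fin 2) (Fin 2) I) (n : ℕ) (p : I) :
    Measure ((Fin n → Fin 2) × (Pairs n → Bool)) :=
  (labelsLaw p n).compProd (edgeKernel M n)

/-- The connectivity matrix `(d / n) * !![a, b; b, c]`. Since `a, b, c, d` are fixed (and, when `d`
is large, `a, b, c` are close to `1`), its entries are in `[0, 1]` for all large `n`, and then the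
projection onto `[0, 1]` does nothing; it only gives a meaning to the first few terms. -/
def connectivity (a b c d : ℝ) (n : ℕ) : Matrix (Fin 2) (Fin 2) I :=
  (!![d / n * a, d / n * b; d / n * b, d / n * c]).map (Set.projIcc 0 1 zero_le_one)

/-- The relabelling `φ_p(1) = √((1 - p) / p)`, `φ_p(2) = -√(p / (1 - p))`. -/
def phi (p : I) : Fin 2 → ℝ := ![√((1 - p) / p), -√(p / (1 - p))]

/-- The law `p δ_{φ_p(1)} + (1 - p) δ_{φ_p(2)}` of `φ_p(X_1)`. -/
def tildePrior (p : I) : Measure ℝ := (labelLaw p).map (phi p)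

/-- The joint law of `(X̃, Y)`, where `X̃_1, …, X̃_n` are i.i.d. of law `tildePrior p`, and
`Y_{i,j} = √(lam / n) X̃_i X̃_j + Z_{i,j}` for `i < j`, the `Z_{i,j}` being i.i.d. standard Gaussian
and independent of `X̃`. -/
def channelLaw (p : I) (lam : ℝ) (n : ℕ) : Measure ((Fin n → ℝ) × (Pairs n → ℝ)) :=
  ((labelsLaw p n).prod (Measure.pi fun _ : Pairs n => gaussianReal 0 1)).map fun xz =>
    (fun i => phi p (xz.1 i),
      fun e => √(lam / n) * phi p (xz.1 e.1.1) * phi p (xz.1 e.1.2) + xz.2 e)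

/-- The random variable whose expectation appears in the potential, as a function of `X̃₀`
and `Z₀`. -/
def logPartition (p : I) (lam q X Z : ℝ) : ℝ :=
  Real.log
    (p * Real.exp (√((1 - p) / p) * (√(lam * q) * Z + lam * q * X)
        - lam * (1 - p) / (2 * p) * q)
      + (1 - p) * Real.exp (-√(p / (1 - p)) * (√(lam * q) * Z + lam * q * X)
        - lam * p / (2 * (1 - p)) * q))

/-- The replica-symmetric potential `ℱ_g(lam, q)`; here `X̃₀ = w.1` has law `tildePrior p`, and
`Z₀ = w.2` is standard Gaussian and independent of `X̃₀`. -/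
def rsPotential (p : I) (lam q : ℝ) : ℝ :=
  -(lam * q ^ 2 / 4)
    + ∫ w, logPartition p lam q w.1 w.2 ∂((tildePrior p).prod (gaussianReal 0 1))

/-- `Φ_g(lam) = sup_{q ≥ 0} ℱ_g(lam, q)`. -/
def PhiG (p : I) (lam : ℝ) : ℝ := ⨆ q : Set.Ici (0 : ℝ), rsPotential p lam q

end

end SBM

/-! The two linear constraints make the connectivity matrix a rank-one perturbation of a constant:
its entries are `d / n * (1 + ε * u)` with `ε = 1 - b`, `|ε| = √(lam / d)` and `u = φ(x_i) φ(x_j)`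
(`connectivity_eq`). Each edge indicator is thus a weak Bernoulli observation of the quantity that
`Y` observes through Gaussian noise, with the same signal-to-noise ratio, since `(d / n) * ε ^ 2 =
lam / n`.

Universality. Under any prior `q`, one Bernoulli observation carries the information `lam / (2 n) *
Var_q(u)` up to a relative error of order `|ε| + d / n` (`info_bernLik_bounds`), and one Gaussian
observation carries the same up to an absolute error of order `n ^ (-3/2)`
(`abs_info_gaussLik_sub_le`). The edges are exchanged one at a time. By the chain rule `info_mul`,
an exchange costs the relative error times a posterior variance of `u`. Bounding these variances by
a constant would cost an extra factor `lam`; they are charged to the entropy instead. Observing more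
only decreases the average posterior variance, so it is at most the variance given the Bernoulli
edges already in place, and that one is controlled by the information which the next Bernoulli edge
brings. These gains telescope to at most `n log 2` (`abs_info_sub_info_le`), which is why `C`
depends on `p` alone.

Gaussian limit. The information of the Gaussian channel is `lam * (n - 1) / 4` minus an average free
energy (`info_channel`), so the free energy per site has to converge to the supremum of the
potential. Both bounds interpolate, as Guerra does, between the rank-one channel and `n` independent
scalar channels of signal-to-noise ratio `lam * q`. Gaussian integration by parts turns the
derivative into squares `(overlap - n q) ^ 2`, a constant and a negligible diagonal term
(`interpRate_eq`).

For the lower bound, the Nishimori identity equates the square involving the planted configuration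
with the one between two replicas, and what remains has a sign (`interp_lower`). For the upper
bound, the planted configuration is kept fixed and the prior is restricted to a window of overlaps
of width `n η` near `± n q`: the planted square is then small and the replica square has the right
sign (`interp_upper`). Boundedly many windows cover all configurations. Gaussian concentration,
together with a variance bound over the planted labels, makes the passage from windows to the whole
cost only `O(√n)` for fixed `η` (`plantedEnergy_le`). Windows of negative overlap do no better than
positive ones (`sum_siteEnergy_neg_le`), so `q ≥ 0` suffices. -/

namespace SBM

/-! ### Product measures: resampling a coordinate, product densities -/

section ProductMeasures

variable {ι : Type*} [Fintype ι] {X : ι → Type*} [∀ i, MeasurableSpace (X i)]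

/-- Resampling coordinate `e` independently does not change a product law. This allows one
coordinate to be integrated first without splitting the index type. -/
theorem measurePreserving_update [DecidableEq ι] (μ : ∀ i, Measure (X i)) [∀ i, IsProbabilityMeasure (μ i)]
    (e : ι) :
    MeasurePreserving (fun p : (∀ i, X i) × X e => Function.update p.1 e p.2)
      ((Measure.pi μ).prod (μ e)) (Measure.pi μ) := by
  have hm : Measurable (fun p : (∀ i, X i) × X e => Function.update p.1 e p.2) := by
    refine measurable_pi_iff.mpr fun i => ?_
    by_cases h : i = e
    · subst h; simpa using measurable_snd
    · simp only [Function.update_of_ne h]; fun_prop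
  refine ⟨hm, (Measure.pi_eq fun s hs => ?_).symm⟩
  rw [Measure.map_apply hm (MeasurableSet.univ_pi hs)]
  have : (fun p : (∀ i, X i) × X e => Function.update p.1 e p.2) ⁻¹' Set.univ.pi s
      = (Set.univ.pi (Function.update s e Set.univ)) ×ˢ s e := by
    ext ⟨z, y⟩
    simp only [Set.mem_preimage, Set.mem_pi, Set.mem_univ, true_implies, Set.mem_prod]
    constructor
    · intro h
      refine ⟨fun i => ?_, by simpa using h e⟩
      by_cases hi : i = e
      · subst hi; simp
      · simpa [hi] using h i
    · rintro ⟨h1, h2⟩ i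
      by_cases hi : i = e
      · subst hi; simpa using h2
      · simpa [hi] using h1 i
  rw [this, Measure.prod_prod, Measure.pi_pi, ← Finset.prod_erase_mul _ _ (Finset.mem_univ e),
    ← Finset.prod_erase_mul Finset.univ (fun i => μ i (s i)) (Finset.mem_univ e)]
  simp only [Function.update_self, measure_univ, mul_one]
  congr 1
  refine Finset.prod_congr rfl fun i hi => ?_
  rw [Function.update_of_ne (Finset.ne_of_mem_erase hi)]

theorem integrable_update [DecidableEq ι] (μ : ∀ i, Measure (X i)) [∀ i, IsProbabilityMeasure (μ i)]
    (e : ι) {f : (∀ i, X i) → ℝ} (hf : Integrable f (Measure.pi μ)) :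
    Integrable (fun p : (∀ i, X i) × X e => f (Function.update p.1 e p.2))
      ((Measure.pi μ).prod (μ e)) :=
  (measurePreserving_update μ e).integrable_comp_of_integrable hf

theorem integral_eq_integral_update [DecidableEq ι] (μ : ∀ i, Measure (X i)) [∀ i, IsProbabilityMeasure (μ i)]
    (e : ι) {f : (∀ i, X i) → ℝ} (hf : Integrable f (Measure.pi μ)) :
    ∫ z, f z ∂(Measure.pi μ) = ∫ z, ∫ y, f (Function.update z e y) ∂(μ e) ∂(Measure.pi μ) := by
  have h := measurePreserving_update μ e
  conv_lhs => rw [← h.map_eq]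
  rw [integral_map h.measurable.aemeasurable (by rw [h.map_eq]; exact hf.1),
    integral_prod _ (integrable_update μ e hf)]

theorem lintegral_pi_prod (μ : ∀ i, Measure (X i)) [∀ i, IsProbabilityMeasure (μ i)]
    {f : ∀ i, X i → ℝ≥0∞} (hf : ∀ i, Measurable (f i)) :
    ∫⁻ x, ∏ i, f i (x i) ∂(Measure.pi μ) = ∏ i, ∫⁻ y, f i y ∂(μ i) := by
  rw [lintegral_prod_eq_prod_lintegral_of_indepFun Finset.univ
    (fun i (x : ∀ i, X i) => f i (x i))
    (iIndepFun_pi (X := fun i => f i) fun i => (hf i).aemeasurable)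
    (fun i => (hf i).comp (measurable_pi_apply i))]
  refine Finset.prod_congr rfl fun i _ => ?_
  rw [← (measurePreserving_eval μ i).lintegral_comp (hf i)]

theorem pi_withDensity (μ : ∀ i, Measure (X i)) [∀ i, IsProbabilityMeasure (μ i)]
    {f : ∀ i, X i → ℝ≥0∞} (hf : ∀ i, Measurable (f i))
    [∀ i, SigmaFinite ((μ i).withDensity (f i))] :
    Measure.pi (fun i => (μ i).withDensity (f i))
      = (Measure.pi μ).withDensity (fun x => ∏ i, f i (x i)) := by
  refine Measure.pi_eq fun s hs => ?_
  rw [withDensity_apply _ (MeasurableSet.univ_pi hs),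
    ← lintegral_indicator (MeasurableSet.univ_pi hs)]
  have : (Set.univ.pi s).indicator (fun x : ∀ i, X i => ∏ i, f i (x i))
      = fun x => ∏ i, (s i).indicator (f i) (x i) := by
    ext x
    by_cases hx : x ∈ Set.univ.pi s
    · rw [Set.indicator_of_mem hx]
      exact Finset.prod_congr rfl fun i _ => (Set.indicator_of_mem (hx i trivial) _).symm
    · rw [Set.indicator_of_notMem hx]
      simp only [Set.mem_pi, Set.mem_univ, true_implies, not_forall] at hx
      obtain ⟨i, hi⟩ := hx
      exact (Finset.prod_eq_zero (Finset.mem_univ i) (Set.indicator_of_notMem hi _)).symm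
  rw [this, lintegral_pi_prod μ fun i => (hf i).indicator (hs i)]
  exact Finset.prod_congr rfl fun i _ => by
    rw [lintegral_indicator (hs i), withDensity_apply _ (hs i)]

end ProductMeasures

/-! ### Gaussian measure: shifts, integration by parts, concentration -/

section Gaussian

/-- The standard Gaussian measure on `ι → ℝ`. -/
noncomputable abbrev stdGauss (ι : Type*) [Fintype ι] : Measure (ι → ℝ) :=
  Measure.pi fun _ => gaussianReal 0 1

/-- The Cameron–Martin formula in dimension one. Through it a Gaussian observation becomes a
likelihood with respect to pure noise. -/
theorem gaussianReal_eq_withDensity (a : ℝ) :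
    gaussianReal a 1
      = (gaussianReal 0 1).withDensity (fun y => ENNReal.ofReal (Real.exp (a * y - a ^ 2 / 2))) := by
  rw [gaussianReal_of_var_ne_zero _ one_ne_zero, gaussianReal_of_var_ne_zero _ one_ne_zero,
    ← withDensity_mul _ (by fun_prop) (by fun_prop)]
  congr 1
  ext y
  simp only [gaussianPDF, Pi.mul_apply]
  rw [← ENNReal.ofReal_mul (gaussianPDFReal_nonneg _ _ _)]
  congr 1
  simp only [gaussianPDFReal]
  rw [mul_assoc _ _ (Real.exp (a * y - a ^ 2 / 2)), ← Real.exp_add]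
  congr 2
  simp
  ring

theorem stdGauss_map_add {ι : Type*} [Fintype ι] (a : ι → ℝ) :
    (stdGauss ι).map (fun z e => z e + a e)
      = (stdGauss ι).withDensity
          (fun y => ENNReal.ofReal (Real.exp (∑ e, (a e * y e - a e ^ 2 / 2)))) := by
  classical
  have h1 : (stdGauss ι).map (fun z e => z e + a e)
      = Measure.pi fun e => gaussianReal (a e) 1 := by
    have : ∀ e, SigmaFinite ((gaussianReal 0 1).map fun y => y + a e) := fun e => by
      rw [gaussianReal_map_add_const]; infer_instance
    rw [stdGauss, Measure.pi_map_pi (f := fun e y => y + a e) fun e => by fun_prop]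
    congr 1
    ext1 e
    rw [gaussianReal_map_add_const, zero_add]
  have h2 : ∀ e, SigmaFinite ((gaussianReal 0 1).withDensity
      (fun y => ENNReal.ofReal (Real.exp (a e * y - a e ^ 2 / 2)))) := fun e => by
    rw [← gaussianReal_eq_withDensity]; infer_instance
  rw [h1]
  simp_rw [gaussianReal_eq_withDensity (a _)]
  rw [pi_withDensity _ fun e => by fun_prop]
  congr 1
  ext y
  rw [Real.exp_sum, ENNReal.ofReal_prod_of_nonneg fun _ _ => (Real.exp_pos _).le]

theorem integral_stdGauss_add {ι : Type*} [Fintype ι] (a : ι → ℝ) {f : (ι → ℝ) → ℝ}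
    (hf : Measurable f) :
    ∫ z, f (fun e => z e + a e) ∂(stdGauss ι)
      = ∫ z, Real.exp (∑ e, (a e * z e - a e ^ 2 / 2)) * f z ∂(stdGauss ι) := by
  have hm : Measurable fun (z : ι → ℝ) e => z e + a e := by fun_prop
  rw [← integral_map hm.aemeasurable hf.aestronglyMeasurable, stdGauss_map_add,
    integral_withDensity_eq_integral_toReal_smul (by fun_prop) (by simp)]
  simp [ENNReal.toReal_ofReal (Real.exp_pos _).le]

theorem integrable_stdGauss_add_iff {ι : Type*} [Fintype ι] (a : ι → ℝ) {f : (ι → ℝ) → ℝ}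
    (hf : Measurable f) :
    Integrable (fun z => f (fun e => z e + a e)) (stdGauss ι)
      ↔ Integrable (fun z => Real.exp (∑ e, (a e * z e - a e ^ 2 / 2)) * f z) (stdGauss ι) := by
  have hm : Measurable fun (z : ι → ℝ) e => z e + a e := by fun_prop
  have := integrable_map_measure (μ := stdGauss ι) (f := fun (z : ι → ℝ) e => z e + a e) (g := f)
    hf.aestronglyMeasurable hm.aemeasurable
  rw [stdGauss_map_add, integrable_withDensity_iff_integrable_smul' (by fun_prop) (by simp)] at this
  simp only [ENNReal.toReal_ofReal (Real.exp_pos _).le, smul_eq_mul] at this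
  exact this.symm

theorem memLp_two_gauss : MemLp (fun y : ℝ => y) 2 (gaussianReal 0 1) :=
  memLp_id_gaussianReal' 2 (by norm_num)

theorem integrable_id_gauss : Integrable (fun y : ℝ => y) (gaussianReal 0 1) :=
  memLp_two_gauss.integrable (by norm_num)

theorem integrable_abs_eval_stdGauss {ι : Type*} [Fintype ι] (e : ι) :
    Integrable (fun z : ι → ℝ => |z e|) (stdGauss ι) :=
  ((measurePreserving_eval (fun _ : ι => gaussianReal 0 1) e).integrable_comp_of_integrable
    integrable_id_gauss).abs

theorem memLp_eval_stdGauss {ι : Type*} [Fintype ι] (e : ι) :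
    MemLp (fun z : ι → ℝ => z e) 2 (stdGauss ι) :=
  memLp_two_gauss.comp_measurePreserving
    (measurePreserving_eval (fun _ : ι => gaussianReal 0 1) e)

theorem integral_sq_gauss : ∫ y, y ^ 2 ∂(gaussianReal 0 1) = 1 := by
  have h := variance_fun_id_gaussianReal (μ := 0) (v := 1)
  rw [variance_eq_integral (by fun_prop)] at h
  simpa using h

/-- Gaussian integration by parts in dimension one. -/
theorem integral_mul_gauss {g g' : ℝ → ℝ} {K : ℝ} (hg : ∀ y, HasDerivAt g (g' y) y)
    (hm : Measurable g') (hK : ∀ y, |g y| ≤ K) (hK' : ∀ y, |g' y| ≤ K) :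
    ∫ y, y * g y ∂(gaussianReal 0 1) = ∫ y, g' y ∂(gaussianReal 0 1) := by
  have hgm : Measurable g :=
    (continuous_iff_continuousAt.2 fun y => (hg y).continuousAt).measurable
  have hpdf : ∀ y, HasDerivAt (gaussianPDFReal 0 1) (-y * gaussianPDFReal 0 1 y) y := by
    intro y
    have h1 : HasDerivAt (fun y : ℝ => -(y - 0) ^ 2 / (2 * ((1 : NNReal) : ℝ))) (-y) y := by
      have := (((hasDerivAt_id y).sub_const 0).pow 2).neg.div_const (2 * ((1 : NNReal) : ℝ))
      refine this.congr_deriv ?_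
      simp only [NNReal.coe_one, id]
      ring
    have := (h1.exp.const_mul ((√(2 * Real.pi * ((1 : NNReal) : ℝ)))⁻¹))
    refine this.congr_deriv ?_
    simp only [gaussianPDFReal]
    ring
  have hi : Integrable (gaussianPDFReal 0 1) := integrable_gaussianPDFReal 0 1
  have hid : Integrable (fun y => y * gaussianPDFReal 0 1 y) := by
    have h := integrable_id_gauss
    rw [gaussianReal_of_var_ne_zero _ one_ne_zero,
      integrable_withDensity_iff_integrable_smul' (by fun_prop) (by simp [gaussianPDF])] at h
    refine h.congr (ae_of_all _ fun y => ?_)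
    simp [gaussianPDF, ENNReal.toReal_ofReal (gaussianPDFReal_nonneg _ _ _), mul_comm]
  have key := integral_mul_deriv_eq_deriv_mul_of_integrable (u := g) (u' := g')
    (v := gaussianPDFReal 0 1) (v' := fun y => -y * gaussianPDFReal 0 1 y)
    (fun y _ => hg y) (fun y _ => hpdf y)
    (by
      refine (hid.neg.bdd_mul hgm.aestronglyMeasurable (ae_of_all _ hK)).congr
        (ae_of_all _ fun y => ?_)
      simp)
    (hi.bdd_mul hm.aestronglyMeasurable (ae_of_all _ hK'))
    (hi.bdd_mul hgm.aestronglyMeasurable (ae_of_all _ hK))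
  rw [integral_gaussianReal_eq_integral_smul one_ne_zero,
    integral_gaussianReal_eq_integral_smul one_ne_zero]
  have h1 : ∫ y, gaussianPDFReal 0 1 y • (y * g y)
      = -∫ y, g y * (-y * gaussianPDFReal 0 1 y) := by
    rw [← integral_neg]
    exact integral_congr_ae (ae_of_all _ fun y => by simp; ring)
  rw [h1, key, neg_neg]
  exact integral_congr_ae (ae_of_all _ fun y => by simp; ring)

/-- Gaussian integration by parts in several variables. -/
theorem integral_mul_stdGauss {ι : Type*} [Fintype ι] [DecidableEq ι] (e : ι)
    {g g' : (ι → ℝ) → ℝ} {K : ℝ}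
    (hg : ∀ z y, HasDerivAt (fun y => g (Function.update z e y)) (g' (Function.update z e y)) y)
    (hgm : Measurable g) (hm : Measurable g') (hK : ∀ y, |g y| ≤ K) (hK' : ∀ y, |g' y| ≤ K) :
    ∫ z, z e * g z ∂(stdGauss ι) = ∫ z, g' z ∂(stdGauss ι) := by
  have h1 : Integrable (fun z => z e * g z) (stdGauss ι) := by
    have : Integrable (fun z : ι → ℝ => z e) (stdGauss ι) :=
      (memLp_eval_stdGauss e).integrable (by norm_num)
    exact (this.bdd_mul hgm.aestronglyMeasurable (ae_of_all _ hK)).congr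
      (ae_of_all _ fun z => mul_comm _ _)
  have h2 : Integrable g' (stdGauss ι) :=
    Integrable.of_bound hm.aestronglyMeasurable K (ae_of_all _ hK')
  rw [integral_eq_integral_update _ e h1, integral_eq_integral_update _ e h2]
  refine integral_congr_ae (ae_of_all _ fun z => ?_)
  simp only [Function.update_self]
  refine integral_mul_gauss (hg z) ?_ (fun y => hK _) (fun y => hK' _)
  exact hm.comp (measurable_update z)

/-- The variance is at most the mean square distance to the constant `f 0`, which the Lipschitz
bound compares with the second moment of the noise. -/
theorem integral_sq_le_of_lipschitz {f : ℝ → ℝ} {c : ℝ}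
    (hf : ∀ y y', |f y - f y'| ≤ c * |y - y'|) (hm : Measurable f) :
    ∫ y, f y ^ 2 ∂(gaussianReal 0 1) ≤ (∫ y, f y ∂(gaussianReal 0 1)) ^ 2 + c ^ 2 := by
  have hLp : MemLp f 2 (gaussianReal 0 1) := by
    have h0 : MemLp (fun y : ℝ => |y|) 2 (gaussianReal 0 1) := memLp_two_gauss.abs
    have h : MemLp (fun y : ℝ => |f 0| + c * |y|) 2 (gaussianReal 0 1) :=
      (memLp_const (|f 0|)).add (h0.const_mul c)
    refine h.mono' hm.aestronglyMeasurable (ae_of_all _ fun y => ?_)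
    have h1 := hf y 0
    rw [sub_zero] at h1
    calc ‖f y‖ = |f 0 + (f y - f 0)| := by rw [Real.norm_eq_abs]; ring_nf
      _ ≤ |f 0| + |f y - f 0| := abs_add_le _ _
      _ ≤ _ := by linarith
  have h1 := variance_eq_sub hLp
  have h2 : Var[f; gaussianReal 0 1] = Var[fun y => f y - f 0; gaussianReal 0 1] :=
    (variance_sub_const hm.aestronglyMeasurable _).symm
  have hLp' : MemLp (fun y => f y - f 0) 2 (gaussianReal 0 1) := hLp.sub (memLp_const _)
  have h3 : Var[fun y => f y - f 0; gaussianReal 0 1]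
      ≤ ∫ y, (f y - f 0) ^ 2 ∂(gaussianReal 0 1) :=
    variance_le_expectation_sq hLp'.1
  have h4 : ∫ y, (f y - f 0) ^ 2 ∂(gaussianReal 0 1) ≤ ∫ y, c ^ 2 * y ^ 2 ∂(gaussianReal 0 1) := by
    refine integral_mono hLp'.integrable_sq
      (memLp_two_gauss.integrable_sq.const_mul _) fun y => ?_
    have := hf y 0
    rw [sub_zero] at this
    calc (f y - f 0) ^ 2 = |f y - f 0| ^ 2 := (sq_abs _).symm
      _ ≤ (c * |y|) ^ 2 := by gcongr
      _ = c ^ 2 * y ^ 2 := by rw [mul_pow, sq_abs]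
  rw [integral_const_mul, integral_sq_gauss] at h4
  simp only [Pi.pow_apply] at h1
  linarith

theorem memLp_of_lipschitz {ι : Type*} [Fintype ι] {f : (ι → ℝ) → ℝ} {c : ι → ℝ}
    (hf : ∀ z z', |f z - f z'| ≤ ∑ e, c e * |z e - z' e|) (hm : Measurable f) :
    MemLp f 2 (stdGauss ι) := by
  have h0 : ∀ e, MemLp (fun z : ι → ℝ => |z e|) 2 (stdGauss ι) :=
    fun e => (memLp_eval_stdGauss e).abs
  have h : MemLp (fun z : ι → ℝ => |f 0| + ∑ e, c e * |z e|) 2 (stdGauss ι) :=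
    (memLp_const (|f 0|)).add (memLp_finsetSum _ fun e _ => (h0 e).const_mul (c e))
  refine h.mono' hm.aestronglyMeasurable (ae_of_all _ fun z => ?_)
  have h1 := hf z 0
  simp only [Pi.zero_apply, sub_zero] at h1
  calc ‖f z‖ = |f 0 + (f z - f 0)| := by rw [Real.norm_eq_abs]; ring_nf
    _ ≤ |f 0| + |f z - f 0| := abs_add_le _ _
    _ ≤ _ := by linarith

/-- Tensorization of the variance: averaging over the first coordinate costs `c 0 ^ 2` and preserves
the Lipschitz constants in the others. -/
theorem integral_sq_le_of_lipschitz_fin : ∀ {N : ℕ} {f : (Fin N → ℝ) → ℝ} {c : Fin N → ℝ},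
    (∀ z z', |f z - f z'| ≤ ∑ e, c e * |z e - z' e|) → Measurable f →
    ∫ z, f z ^ 2 ∂(stdGauss (Fin N)) ≤ (∫ z, f z ∂(stdGauss (Fin N))) ^ 2 + ∑ e, c e ^ 2 := by
  intro N
  induction N with
  | zero =>
    intro f c hf hm
    have : ∀ z, f z = f 0 := fun z => congrArg f (Subsingleton.elim _ _)
    simp [this]
  | succ N ih =>
    intro f c hf hm
    set F : ℝ × (Fin N → ℝ) → ℝ := fun p => f (Fin.cons p.1 p.2) with hF
    have hcons : Measurable fun p : ℝ × (Fin N → ℝ) => (Fin.cons p.1 p.2 : Fin (N + 1) → ℝ) := by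
      refine measurable_pi_iff.2 fun i => ?_
      refine Fin.cases ?_ (fun j => ?_) i
      · simpa using measurable_fst
      · simp only [Fin.cons_succ]; fun_prop
    have hFm : Measurable F := hm.comp hcons
    have mp := (measurePreserving_piFinSuccAbove (fun _ : Fin (N + 1) => gaussianReal 0 1) 0).symm
    have hsymm : ∀ p, (MeasurableEquiv.piFinSuccAbove (fun _ : Fin (N + 1) => ℝ) 0).symm p
        = (Fin.cons p.1 p.2 : Fin (N + 1) → ℝ) := fun p => by
      simp [MeasurableEquiv.piFinSuccAbove_symm_apply, Fin.insertNthEquiv]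
    have hLp := memLp_of_lipschitz hf hm
    have hLpF : MemLp F 2 ((gaussianReal 0 1).prod (stdGauss (Fin N))) := by
      have := hLp.comp_measurePreserving mp
      refine this.ae_eq (ae_of_all _ fun p => ?_)
      simp only [Function.comp, hsymm, hF]
    have e1 : ∫ z, f z ∂(stdGauss (Fin (N + 1)))
        = ∫ w, ∫ y, F (y, w) ∂(gaussianReal 0 1) ∂(stdGauss (Fin N)) := by
      rw [← integral_prod_symm _ (hLpF.integrable (by norm_num)), ← mp.integral_comp']
      simp only [hsymm, hF]
    have e2 : ∫ z, f z ^ 2 ∂(stdGauss (Fin (N + 1)))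
        = ∫ w, ∫ y, F (y, w) ^ 2 ∂(gaussianReal 0 1) ∂(stdGauss (Fin N)) := by
      rw [← integral_prod_symm _ hLpF.integrable_sq, ← mp.integral_comp']
      simp only [hsymm, hF]
    set h : (Fin N → ℝ) → ℝ := fun w => ∫ y, F (y, w) ∂(gaussianReal 0 1) with hh
    have hint : ∀ w, Integrable (fun y => F (y, w)) (gaussianReal 0 1) := by
      intro w
      have h' : Integrable (fun y : ℝ => |F (0, w)| + c 0 * |y|) (gaussianReal 0 1) :=
        (integrable_const _).add (integrable_id_gauss.abs.const_mul _)
      refine h'.mono' (hFm.comp (by fun_prop)).aestronglyMeasurable (ae_of_all _ fun y => ?_)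
      have h1 := hf (Fin.cons y w) (Fin.cons 0 w)
      simp only [Fin.sum_univ_succ, Fin.cons_zero, Fin.cons_succ, sub_self, abs_zero, mul_zero,
        Finset.sum_const_zero, add_zero, sub_zero] at h1
      calc ‖F (y, w)‖ = |F (0, w) + (F (y, w) - F (0, w))| := by
            rw [Real.norm_eq_abs]; ring_nf
        _ ≤ |F (0, w)| + |F (y, w) - F (0, w)| := abs_add_le _ _
        _ ≤ _ := by simp only [hF] at h1 ⊢; linarith
    have hhm : Measurable h := by
      have : StronglyMeasurable fun w => ∫ y, F (y, w) ∂(gaussianReal 0 1) :=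
        hFm.stronglyMeasurable.integral_prod_left'
      exact this.measurable
    have hhl : ∀ w w', |h w - h w'| ≤ ∑ e, c (Fin.succ e) * |w e - w' e| := by
      intro w w'
      rw [hh]
      simp only
      rw [← integral_sub (hint w) (hint w')]
      have := norm_integral_le_of_norm_le_const (μ := gaussianReal 0 1)
        (f := fun y => F (y, w) - F (y, w')) (C := ∑ e, c (Fin.succ e) * |w e - w' e|)
        (ae_of_all _ fun y => by
          have h1 := hf (Fin.cons y w) (Fin.cons y w')
          simpa [Fin.sum_univ_succ, hF] using h1)
      simpa using this
    have hin : ∀ w, ∫ y, F (y, w) ^ 2 ∂(gaussianReal 0 1) ≤ h w ^ 2 + c 0 ^ 2 := by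
      intro w
      refine integral_sq_le_of_lipschitz (f := fun y => F (y, w)) (fun y y' => ?_)
        (hFm.comp (by fun_prop))
      have h1 := hf (Fin.cons y w) (Fin.cons y' w)
      simpa [Fin.sum_univ_succ, hF] using h1
    have hhLp := memLp_of_lipschitz hhl hhm
    rw [e1, e2, Fin.sum_univ_succ]
    calc ∫ w, ∫ y, F (y, w) ^ 2 ∂(gaussianReal 0 1) ∂(stdGauss (Fin N))
        ≤ ∫ w, (h w ^ 2 + c 0 ^ 2) ∂(stdGauss (Fin N)) := by
          refine integral_mono hLpF.integrable_sq.integral_prod_right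
            (hhLp.integrable_sq.add (integrable_const _)) hin
      _ = ∫ w, h w ^ 2 ∂(stdGauss (Fin N)) + c 0 ^ 2 := by
          rw [integral_add hhLp.integrable_sq (integrable_const _)]; simp
      _ ≤ _ := by linarith [ih hhl hhm]

theorem integral_abs_sub_le_of_lipschitz {ι : Type*} [Fintype ι] {f : (ι → ℝ) → ℝ} {c : ι → ℝ}
    (hf : ∀ z z', |f z - f z'| ≤ ∑ e, c e * |z e - z' e|) (hm : Measurable f) :
    ∫ z, |f z - ∫ z', f z' ∂(stdGauss ι)| ∂(stdGauss ι) ≤ √(∑ e, c e ^ 2) := by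
  have hLp := memLp_of_lipschitz hf hm
  have key : ∫ z, f z ^ 2 ∂(stdGauss ι) ≤ (∫ z, f z ∂(stdGauss ι)) ^ 2 + ∑ e, c e ^ 2 := by
    let E := (Fintype.equivFin ι).symm
    have mp := measurePreserving_piCongrLeft (fun _ : ι => gaussianReal 0 1) E
    have hE : ∀ w : Fin (Fintype.card ι) → ℝ,
        (MeasurableEquiv.piCongrLeft (fun _ => ℝ) E) w = fun e => w (E.symm e) := by
      intro w; ext e
      conv_lhs => rw [← E.apply_symm_apply e]
      rw [MeasurableEquiv.coe_piCongrLeft, Equiv.piCongrLeft_apply_apply]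
    have := integral_sq_le_of_lipschitz_fin (N := Fintype.card ι)
      (f := fun w => f fun e => w (E.symm e)) (c := fun i => c (E i)) (fun w w' => by
        refine (hf _ _).trans (le_of_eq ?_)
        rw [← E.sum_comp]; simp) (hm.comp (by fun_prop))
    rw [stdGauss, ← mp.integral_comp', ← mp.integral_comp']
    simp only [hE]
    rw [E.sum_comp (fun e => c e ^ 2)] at this
    exact this
  set m := ∫ z', f z' ∂(stdGauss ι)
  have hLp' : MemLp (fun z => f z - m) 2 (stdGauss ι) := hLp.sub (memLp_const _)
  have h1 : ∫ z, (f z - m) ^ 2 ∂(stdGauss ι) ≤ ∑ e, c e ^ 2 := by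
    have hv := variance_eq_sub hLp
    rw [variance_eq_integral hm.aemeasurable] at hv
    simp only [Pi.pow_apply] at hv
    change ∫ z, (f z - m) ^ 2 ∂(stdGauss ι) = _ at hv
    rw [hv]; linarith
  refine Real.le_sqrt_of_sq_le (le_trans ?_ h1)
  -- Cauchy–Schwarz, in the form that the variance of `|f - m|` is nonnegative.
  have hv := variance_nonneg (fun z => |f z - m|) (stdGauss ι)
  rw [variance_eq_sub (X := fun z => |f z - m|) hLp'.abs] at hv
  simp only [Pi.pow_apply, sq_abs] at hv
  linarith

end Gaussian
end SBM

namespace SBM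

noncomputable section

/-! ### Bayesian posteriors: entropy and variance -/

section Posterior

variable {S Ω : Type*} [Fintype S] [MeasurableSpace Ω]

/-- A family of probability densities with respect to `m`. -/
structure IsLikelihood (L : S → Ω → ℝ) (m : Measure Ω) : Prop where
  measurable : ∀ x, Measurable (L x)
  nonneg : ∀ x ω, 0 ≤ L x ω
  integrable : ∀ x, Integrable (L x) m
  integral_eq_one : ∀ x, ∫ ω, L x ω ∂m = 1

/-- A prior with full support. -/
structure IsPrior (P : S → ℝ) : Prop where
  pos : ∀ x, 0 < P x
  sum_eq_one : ∑ x, P x = 1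

/-- The density of the observation. -/
def evidence (P : S → ℝ) (L : S → Ω → ℝ) (ω : Ω) : ℝ := ∑ x, P x * L x ω

/-- The posterior weights. -/
def posterior (P : S → ℝ) (L : S → Ω → ℝ) (ω : Ω) (x : S) : ℝ := P x * L x ω / evidence P L ω

/-- The entropy of a family of weights. -/
def entropy (q : S → ℝ) : ℝ := ∑ x, Real.negMulLog (q x)

/-- The mutual information in terms of the posterior entropy. -/
def info (P : S → ℝ) (L : S → Ω → ℝ) (m : Measure Ω) : ℝ :=
  entropy P - ∫ ω, evidence P L ω * entropy (posterior P L ω) ∂m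

/-- The variance of `u` under the weights `q`. -/
def wvar (q u : S → ℝ) : ℝ := ∑ x, q x * u x ^ 2 - (∑ x, q x * u x) ^ 2

/-- The average posterior variance. -/
def postVar (P : S → ℝ) (L : S → Ω → ℝ) (m : Measure Ω) (u : S → ℝ) : ℝ :=
  ∫ ω, evidence P L ω * wvar (posterior P L ω) u ∂m

/-- This bound makes the posterior entropy integrable against the evidence with no integrability of
`L log L`. -/
theorem negMulLog_mem {t : ℝ} (h0 : 0 ≤ t) (h1 : t ≤ 1) : |Real.negMulLog t| ≤ 1 := by
  rw [abs_of_nonneg (Real.negMulLog_nonneg h0 h1)]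
  rcases h0.eq_or_lt with h | h
  · simp [← h]
  · have := Real.one_sub_inv_le_log_of_pos h
    rw [Real.negMulLog]
    have h2 : t * (1 - t⁻¹) ≤ t * Real.log t := by gcongr
    rw [mul_sub, mul_inv_cancel₀ h.ne'] at h2
    linarith

theorem sum_mul_sq_sub (q u : S → ℝ) (hq : ∑ x, q x = 1) (c : ℝ) :
    ∑ x, q x * (u x - c) ^ 2 = wvar q u + (∑ x, q x * u x - c) ^ 2 := by
  have : ∀ x, q x * (u x - c) ^ 2 = q x * u x ^ 2 - 2 * c * (q x * u x) + c ^ 2 * q x :=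
    fun x => by ring
  simp_rw [this, Finset.sum_add_distrib, Finset.sum_sub_distrib, ← Finset.mul_sum, hq, wvar]
  ring

theorem wvar_nonneg (q u : S → ℝ) (hq0 : ∀ x, 0 ≤ q x) (hq : ∑ x, q x = 1) : 0 ≤ wvar q u := by
  have h := sum_mul_sq_sub q u hq (∑ x, q x * u x)
  rw [sub_self, zero_pow two_ne_zero, add_zero] at h
  rw [← h]
  exact Finset.sum_nonneg fun x _ => mul_nonneg (hq0 x) (sq_nonneg _)

theorem entropy_le_log_card {P : S → ℝ} (hP : IsPrior P) :
    entropy P ≤ Real.log (Fintype.card S) := by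
  have hne : Nonempty S := by
    by_contra h
    rw [not_nonempty_iff] at h
    have := hP.sum_eq_one
    simp at this
  have hc : (0 : ℝ) < Fintype.card S := by exact_mod_cast Fintype.card_pos
  have h1 : ∀ x, Real.negMulLog (P x) - P x * Real.log (Fintype.card S)
      ≤ 1 / Fintype.card S - P x := fun x => by
    have hx := hP.pos x
    -- Gibbs' inequality against the uniform law: `log t ≤ t - 1` at `t = 1 / (P x * |S|)`.
    have h := Real.log_le_sub_one_of_pos (show 0 < 1 / (P x * Fintype.card S) by positivity)
    rw [Real.log_div one_ne_zero (by positivity), Real.log_one,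
      Real.log_mul hx.ne' hc.ne'] at h
    have h2 := mul_le_mul_of_nonneg_left h hx.le
    have h3 : P x * (1 / (P x * Fintype.card S) - 1) = 1 / Fintype.card S - P x := by
      field_simp
    rw [h3] at h2
    rw [Real.negMulLog]
    linarith
  have h2 := Finset.sum_le_sum fun x (_ : x ∈ Finset.univ) => h1 x
  rw [Finset.sum_sub_distrib, Finset.sum_sub_distrib, ← Finset.sum_mul, hP.sum_eq_one] at h2
  simp only [Finset.sum_const, Finset.card_univ, nsmul_eq_mul] at h2
  rw [mul_one_div_cancel hc.ne'] at h2
  simp only [entropy]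
  linarith

end Posterior

theorem sum_posterior {S Ω : Type*} [Fintype S] {P : S → ℝ} {L : S → Ω → ℝ} {ω : Ω}
    (h : 0 < evidence P L ω) : ∑ x, posterior P L ω x = 1 := by
  simp only [posterior]
  rw [← Finset.sum_div, ← evidence, div_self h.ne']

/-! ### Mutual information as prior entropy minus posterior entropy -/

section MutualInformation

variable {S Ω : Type*} [Fintype S] [MeasurableSpace Ω]
variable {P : S → ℝ} {L : S → Ω → ℝ} {m : Measure Ω}

theorem evidence_nonneg (hP : IsPrior P) (hL : IsLikelihood L m) (ω : Ω) : 0 ≤ evidence P L ω :=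
  Finset.sum_nonneg fun x _ => mul_nonneg (hP.pos x).le (hL.nonneg x ω)

theorem evidence_measurable (hL : IsLikelihood L m) : Measurable (evidence P L) :=
  Finset.measurable_sum _ fun x _ => (hL.measurable x).const_mul _

theorem evidence_integrable (hL : IsLikelihood L m) : Integrable (evidence P L) m :=
  integrable_finsetSum _ fun x _ => (hL.integrable x).const_mul _

theorem integral_evidence (hP : IsPrior P) (hL : IsLikelihood L m) :
    ∫ ω, evidence P L ω ∂m = 1 := by
  simp only [evidence]
  rw [integral_finsetSum _ fun x _ => (hL.integrable x).const_mul _]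
  simp_rw [integral_const_mul, hL.integral_eq_one, mul_one, hP.sum_eq_one]

theorem posterior_measurable (hL : IsLikelihood L m) (x : S) :
    Measurable fun ω => posterior P L ω x :=
  ((hL.measurable x).const_mul _).div (evidence_measurable hL)

/-- Where the evidence vanishes the posterior is `0` by convention, and the identity survives
because each term of the evidence vanishes too. -/
theorem evidence_mul_posterior (hP : IsPrior P) (hL : IsLikelihood L m) (ω : Ω) (x : S) :
    evidence P L ω * posterior P L ω x = P x * L x ω := by
  rcases (evidence_nonneg hP hL ω).eq_or_lt with h | h
  · have h1 := (Finset.sum_eq_zero_iff_of_nonneg fun x _ =>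
      mul_nonneg (hP.pos x).le (hL.nonneg x ω)).1 h.symm x (Finset.mem_univ x)
    rw [← h, h1, zero_mul]
  · rw [posterior, mul_div_cancel₀ _ h.ne']

theorem posterior_nonneg (hP : IsPrior P) (hL : IsLikelihood L m) (ω : Ω) (x : S) :
    0 ≤ posterior P L ω x :=
  div_nonneg (mul_nonneg (hP.pos x).le (hL.nonneg x ω)) (evidence_nonneg hP hL ω)

theorem posterior_le_one (hP : IsPrior P) (hL : IsLikelihood L m) (ω : Ω) (x : S) :
    posterior P L ω x ≤ 1 :=
  div_le_one_of_le₀ (Finset.single_le_sum (f := fun x => P x * L x ω)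
    (fun x _ => mul_nonneg (hP.pos x).le (hL.nonneg x ω)) (Finset.mem_univ x))
    (evidence_nonneg hP hL ω)

theorem integrable_evidence_negMulLog (hP : IsPrior P) (hL : IsLikelihood L m) (x : S) :
    Integrable (fun ω => evidence P L ω * Real.negMulLog (posterior P L ω x)) m := by
  have hm : Measurable fun ω => Real.negMulLog (posterior P L ω x) :=
    Real.continuous_negMulLog.measurable.comp (posterior_measurable hL x)
  refine ((evidence_integrable (P := P) hL).bdd_mul hm.aestronglyMeasurable (c := 1)
    (ae_of_all _ fun ω => ?_)).congr (ae_of_all _ fun ω => mul_comm _ _)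
  exact negMulLog_mem (posterior_nonneg hP hL ω x) (posterior_le_one hP hL ω x)

theorem integrable_evidence_entropy (hP : IsPrior P) (hL : IsLikelihood L m) :
    Integrable (fun ω => evidence P L ω * entropy (posterior P L ω)) m := by
  simp only [entropy, Finset.mul_sum]
  exact integrable_finsetSum _ fun x _ => integrable_evidence_negMulLog hP hL x

theorem entropy_posterior_nonneg (hP : IsPrior P) (hL : IsLikelihood L m) (ω : Ω) :
    0 ≤ entropy (posterior P L ω) :=
  Finset.sum_nonneg fun x _ =>
    Real.negMulLog_nonneg (posterior_nonneg hP hL ω x) (posterior_le_one hP hL ω x)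

theorem info_le_entropy (hP : IsPrior P) (hL : IsLikelihood L m) : info P L m ≤ entropy P := by
  have : 0 ≤ ∫ ω, evidence P L ω * entropy (posterior P L ω) ∂m :=
    integral_nonneg fun ω => mul_nonneg (evidence_nonneg hP hL ω) (entropy_posterior_nonneg hP hL ω)
  rw [info]; linarith

/-- Used to place Bernoulli and Gaussian observations on one sample space, where they can be mixed.
-/
theorem info_comp {Ω' : Type*} [MeasurableSpace Ω'] {m' : Measure Ω'} {T : Ω' → Ω}
    (hT : MeasurePreserving T m' m) (hL : IsLikelihood L m) :
    info P (fun x ω => L x (T ω)) m' = info P L m := by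
  have hm : Measurable fun ω => evidence P L ω * entropy (posterior P L ω) :=
    (evidence_measurable hL).mul (Finset.measurable_sum _ fun x _ =>
      Real.continuous_negMulLog.measurable.comp (posterior_measurable hL x))
  simp only [info]
  rw [← hT.map_eq, integral_map hT.measurable.aemeasurable hm.aestronglyMeasurable]
  rfl

/-- The joint law with prior `P` on the points `g x` and conditional densities `D x`. -/
def mixture {α : Type*} [MeasurableSpace α] (P : S → ℝ) (g : S → α) (D : S → Ω → ℝ)
    (m : Measure Ω) : Measure (α × Ω) :=
  ∑ x, ENNReal.ofReal (P x) •
    (Measure.dirac (g x)).prod (m.withDensity fun ω => ENNReal.ofReal (D x ω))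

theorem lintegral_mixture {α : Type*} [MeasurableSpace α] (g : S → α) {D : S → Ω → ℝ}
    (hD : ∀ x, Measurable (D x)) [SFinite m] {F : α × Ω → ℝ≥0∞} (hF : Measurable F) :
    ∫⁻ z, F z ∂(mixture P g D m)
      = ∑ x, ENNReal.ofReal (P x) * ∫⁻ ω, ENNReal.ofReal (D x ω) * F (g x, ω) ∂m := by
  rw [mixture, lintegral_finsetSum_measure]
  refine Finset.sum_congr rfl fun x _ => ?_
  rw [lintegral_smul_measure, smul_eq_mul, Measure.dirac_prod, lintegral_map hF (by fun_prop),
    lintegral_withDensity_eq_lintegral_mul _ (by fun_prop) (by fun_prop)]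
  rfl

theorem mixture_apply {α : Type*} [MeasurableSpace α] (g : S → α) {D : S → Ω → ℝ}
    (hD : ∀ x, Measurable (D x)) [SFinite m] {A : Set (α × Ω)} (hA : MeasurableSet A) :
    mixture P g D m A
      = ∑ x, ENNReal.ofReal (P x) *
          ∫⁻ ω, ENNReal.ofReal (D x ω) * A.indicator 1 (g x, ω) ∂m := by
  rw [← lintegral_indicator_one hA, lintegral_mixture g hD (measurable_one.indicator hA)]

/-- The product of the marginals is again a mixture, with the evidence as conditional density for
every label, so the two laws can be compared fibre by fibre. -/
theorem mixture_fst_prod_snd {α : Type*} [MeasurableSpace α] (g : S → α) [IsProbabilityMeasure m]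
    (hP : IsPrior P) (hL : IsLikelihood L m) :
    (mixture P g L m).fst.prod (mixture P g L m).snd
      = mixture P g (fun _ => evidence P L) m := by
  have hprob : ∀ x, IsProbabilityMeasure (m.withDensity fun ω => ENNReal.ofReal (L x ω)) :=
    fun x => ⟨by
      rw [withDensity_apply _ MeasurableSet.univ, Measure.restrict_univ,
        ← ofReal_integral_eq_lintegral_ofReal (hL.integrable x) (ae_of_all _ (hL.nonneg x)),
        hL.integral_eq_one, ENNReal.ofReal_one]⟩
  have h1 : (mixture P g L m).fst = ∑ x, ENNReal.ofReal (P x) • Measure.dirac (g x) := by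
    rw [mixture, Measure.fst, Measure.map_finset_sum measurable_fst.aemeasurable]
    refine Finset.sum_congr rfl fun x _ => ?_
    have := hprob x
    rw [Measure.map_smul, ← Measure.fst, Measure.fst_prod]
  have h2 : (mixture P g L m).snd = m.withDensity fun ω => ENNReal.ofReal (evidence P L ω) := by
    ext A hA
    rw [Measure.snd_apply hA, mixture_apply g hL.measurable (measurable_snd hA),
      withDensity_apply _ hA, ← lintegral_indicator hA]
    have : ∀ ω, A.indicator (fun ω => ENNReal.ofReal (evidence P L ω)) ω
        = ∑ x, ENNReal.ofReal (P x) * (ENNReal.ofReal (L x ω) * A.indicator 1 ω) := fun ω => by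
      by_cases h : ω ∈ A
      · simp only [Set.indicator_of_mem h, Pi.one_apply, mul_one, evidence]
        rw [ENNReal.ofReal_sum_of_nonneg fun x _ => mul_nonneg (hP.pos x).le (hL.nonneg x ω)]
        exact Finset.sum_congr rfl fun x _ => ENNReal.ofReal_mul (hP.pos x).le
      · simp [Set.indicator_of_notMem h]
    simp_rw [this]
    have hmx : ∀ x, Measurable fun ω => ENNReal.ofReal (L x ω) * A.indicator (1 : Ω → ℝ≥0∞) ω :=
      fun x => (hL.measurable x).ennreal_ofReal.mul (measurable_one.indicator hA)
    rw [lintegral_finsetSum _ fun x _ => (hmx x).const_mul _]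
    refine Finset.sum_congr rfl fun x _ => ?_
    rw [lintegral_const_mul _ (hmx x)]
    rfl
  rw [h1, h2, mixture]
  ext A hA
  rw [Measure.prod_apply hA, lintegral_finsetSum_measure, Measure.finsetSum_apply]
  refine Finset.sum_congr rfl fun x _ => ?_
  rw [lintegral_smul_measure, lintegral_dirac' _ (measurable_measure_prodMk_left hA),
    Measure.smul_apply, Measure.dirac_prod, Measure.map_apply (by fun_prop) hA]

/-- Over the point `g x`, the joint law has density `L x / evidence` with respect to the product of
the marginals. Writing this ratio as posterior over prior turns the divergence into a difference of
entropies. Injectivity of `g` keeps the fibres apart. -/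
theorem mutualInfo_mixture {α : Type*} [MeasurableSpace α] [MeasurableSingletonClass α]
    {g : S → α} (hg : Function.Injective g) [IsProbabilityMeasure m]
    (hP : IsPrior P) (hL : IsLikelihood L m) :
    mutualInfo (mixture P g L m) ≠ ∞ ∧ (mutualInfo (mixture P g L m)).toReal = info P L m := by
  classical
  set ρ := mixture P g L m with hρ
  set ν := mixture P g (fun _ => evidence P L) m with hν
  have hZm := evidence_measurable (P := P) hL
  have hEm : ∀ x : S, Measurable ((fun _ => evidence P L) x) := fun _ => hZm
  -- The relative density as a function on `α × Ω`: the indicators recover the label from the point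
  -- `g x`.
  set h : α × Ω → ℝ := fun z =>
    ∑ x, ({g x} : Set α).indicator 1 z.1 * (L x z.2 / evidence P L z.2) with hh
  have hhm : Measurable h := by
    refine Finset.measurable_sum _ fun x _ => Measurable.mul ?_ ?_
    · exact (measurable_one.indicator (measurableSet_singleton _)).comp measurable_fst
    · exact ((hL.measurable x).comp measurable_snd).div (hZm.comp measurable_snd)
  have hhg : ∀ x ω, h (g x, ω) = L x ω / evidence P L ω := by
    intro x ω
    simp only [hh]
    rw [Finset.sum_eq_single x]
    · simp
    · intro y _ hy
      rw [Set.indicator_of_notMem, zero_mul]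
      simpa using fun hxy => hy (hg hxy).symm
    · simp
  have hLZ : ∀ x ω, evidence P L ω * (L x ω / evidence P L ω) = L x ω := by
    intro x ω
    have h1 := evidence_mul_posterior hP hL ω x
    rw [posterior, mul_div_assoc, mul_left_comm] at h1
    exact mul_left_cancel₀ (hP.pos x).ne' h1
  have hρν : ρ = ν.withDensity fun z => ENNReal.ofReal (h z) := by
    ext A hA
    rw [withDensity_apply _ hA, ← lintegral_indicator hA, hν,
      lintegral_mixture g hEm (hhm.ennreal_ofReal.indicator hA), hρ,
      mixture_apply g hL.measurable hA]
    refine Finset.sum_congr rfl fun x _ => ?_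
    congr 1
    refine lintegral_congr fun ω => ?_
    by_cases hω : (g x, ω) ∈ A
    · simp only [Set.indicator_of_mem hω, Pi.one_apply, mul_one]
      rw [hhg, ← ENNReal.ofReal_mul (evidence_nonneg hP hL ω), hLZ]
    · simp [Set.indicator_of_notMem hω]
  have hprob : IsProbabilityMeasure ρ := ⟨by
    rw [hρ, mixture_apply g hL.measurable MeasurableSet.univ]
    simp only [Set.indicator_univ, Pi.one_apply, mul_one]
    have : ∀ x, ∫⁻ ω, ENNReal.ofReal (L x ω) ∂m = 1 := fun x => by
      rw [← ofReal_integral_eq_lintegral_ofReal (hL.integrable x) (ae_of_all _ (hL.nonneg x)),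
        hL.integral_eq_one, ENNReal.ofReal_one]
    simp_rw [this, mul_one]
    rw [← ENNReal.ofReal_sum_of_nonneg fun x _ => (hP.pos x).le, hP.sum_eq_one,
      ENNReal.ofReal_one]⟩
  have hνeq : ρ.fst.prod ρ.snd = ν := mixture_fst_prod_snd g hP hL
  have hνprob : IsProbabilityMeasure ν := by rw [← hνeq]; infer_instance
  have hac : ρ ≪ ν := by rw [hρν]; exact withDensity_absolutelyContinuous _ _
  have hpt : ∀ x ω, P x * (evidence P L ω * InformationTheory.klFun (L x ω / evidence P L ω))
      = -(evidence P L ω * Real.negMulLog (posterior P L ω x)) - Real.log (P x) * (P x * L x ω)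
        + P x * evidence P L ω - P x * L x ω := by
    intro x ω
    rw [InformationTheory.klFun_apply]
    have h1 := hLZ x ω
    have h2 := evidence_mul_posterior hP hL ω x
    set r := L x ω / evidence P L ω with hr
    have hq : posterior P L ω x = P x * r := by rw [posterior, hr, mul_div_assoc]
    rw [hq, ← h1, Real.negMulLog_mul]
    simp only [Real.negMulLog]
    ring
  have hint : ∀ x, Integrable
      (fun ω => P x * (evidence P L ω * InformationTheory.klFun (L x ω / evidence P L ω))) m := by
    intro x
    simp_rw [hpt]
    exact (((integrable_evidence_negMulLog hP hL x).neg.sub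
      (((hL.integrable x).const_mul _).const_mul _)).add
      ((evidence_integrable hL).const_mul _)).sub ((hL.integrable x).const_mul _)
  have hkl : mutualInfo ρ = ENNReal.ofReal (∑ x, ∫ ω,
      P x * (evidence P L ω * InformationTheory.klFun (L x ω / evidence P L ω)) ∂m) := by
    have hnn : ∀ x ω, 0 ≤ InformationTheory.klFun (L x ω / evidence P L ω) := fun x ω =>
      InformationTheory.klFun_nonneg (div_nonneg (hL.nonneg x ω) (evidence_nonneg hP hL ω))
    rw [mutualInfo, hνeq, InformationTheory.klDiv_eq_lintegral_klFun_of_ac hac]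
    have hrn : ρ.rnDeriv ν =ᵐ[ν] fun z => ENNReal.ofReal (h z) := by
      rw [hρν]; exact Measure.rnDeriv_withDensity _ hhm.ennreal_ofReal
    have hstep : ∫⁻ z, ENNReal.ofReal (InformationTheory.klFun (ρ.rnDeriv ν z).toReal) ∂ν
        = ∫⁻ z, ENNReal.ofReal (InformationTheory.klFun ((ENNReal.ofReal (h z)).toReal)) ∂ν :=
      lintegral_congr_ae (hrn.mono fun z hz => by simp only [hz])
    rw [hstep, hν, lintegral_mixture g hEm (by
      exact (InformationTheory.measurable_klFun.comp
        hhm.ennreal_ofReal.ennreal_toReal).ennreal_ofReal),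
      ENNReal.ofReal_sum_of_nonneg fun x _ => integral_nonneg fun ω =>
        mul_nonneg (hP.pos x).le (mul_nonneg (evidence_nonneg hP hL ω) (hnn x ω))]
    refine Finset.sum_congr rfl fun x _ => ?_
    rw [integral_const_mul, ENNReal.ofReal_mul (hP.pos x).le, ofReal_integral_eq_lintegral_ofReal]
    · congr 1
      refine lintegral_congr fun ω => ?_
      rw [hhg, ENNReal.toReal_ofReal (div_nonneg (hL.nonneg x ω) (evidence_nonneg hP hL ω)),
        ← ENNReal.ofReal_mul (evidence_nonneg hP hL ω)]
    · have := (hint x).const_mul (P x)⁻¹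
      refine this.congr (ae_of_all _ fun ω => ?_)
      simp only
      rw [← mul_assoc, inv_mul_cancel₀ (hP.pos x).ne', one_mul]
    · exact ae_of_all _ fun ω => mul_nonneg (evidence_nonneg hP hL ω) (hnn x ω)
  refine ⟨by rw [hkl]; exact ENNReal.ofReal_ne_top, ?_⟩
  have hval : ∑ x, ∫ ω,
      P x * (evidence P L ω * InformationTheory.klFun (L x ω / evidence P L ω)) ∂m
        = info P L m := by
    have hx : ∀ x, ∫ ω,
        P x * (evidence P L ω * InformationTheory.klFun (L x ω / evidence P L ω)) ∂m
          = -(∫ ω, evidence P L ω * Real.negMulLog (posterior P L ω x) ∂m)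
            + Real.negMulLog (P x) := by
      intro x
      simp_rw [hpt]
      rw [integral_sub ?_ ((hL.integrable x).const_mul _), integral_add ?_
        ((evidence_integrable hL).const_mul _), integral_sub ?_
        (((hL.integrable x).const_mul _).const_mul _), integral_neg]
      · simp_rw [integral_const_mul, hL.integral_eq_one, integral_evidence hP hL, Real.negMulLog]
        ring
      · exact (integrable_evidence_negMulLog hP hL x).neg
      · exact (integrable_evidence_negMulLog hP hL x).neg.sub
          (((hL.integrable x).const_mul _).const_mul _)
      · exact ((integrable_evidence_negMulLog hP hL x).neg.sub
          (((hL.integrable x).const_mul _).const_mul _)).add ((evidence_integrable hL).const_mul _)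
    simp_rw [hx]
    rw [Finset.sum_add_distrib, Finset.sum_neg_distrib, info]
    simp only [entropy, Finset.mul_sum]
    rw [integral_finsetSum _ fun x _ => integrable_evidence_negMulLog hP hL x]
    ring
  rw [hkl, hval, ENNReal.toReal_ofReal]
  rw [← hval]
  exact Finset.sum_nonneg fun x _ => integral_nonneg fun ω => mul_nonneg (hP.pos x).le
    (mul_nonneg (evidence_nonneg hP hL ω) (InformationTheory.klFun_nonneg
      (div_nonneg (hL.nonneg x ω) (evidence_nonneg hP hL ω))))

end MutualInformation

end

end SBM

namespace SBM

noncomputable section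

/-! ### Chain rule and exchange of channels one observation at a time -/

section Chain

variable {S E W : Type*} [Fintype S] [Fintype E] [DecidableEq E] [MeasurableSpace W]
  {ν : Measure W} [IsProbabilityMeasure ν]

theorem integrable_of_update_eq_mul (e : E) {f A : (E → W) → ℝ} {b : W → ℝ} (hf : Measurable f)
    (h : ∀ z y, f (Function.update z e y) = A z * b y)
    (hA : Integrable A (Measure.pi fun _ => ν)) (hb : Integrable b ν) :
    Integrable f (Measure.pi fun _ => ν) := by
  rw [← (measurePreserving_update (fun _ : E => ν) e).integrable_comp hf.aestronglyMeasurable]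
  refine (hA.mul_prod hb).congr (ae_of_all _ fun p => ?_)
  simp [h]

theorem integral_of_update_eq_mul (e : E) {f A : (E → W) → ℝ} {b : W → ℝ} (hf : Measurable f)
    (h : ∀ z y, f (Function.update z e y) = A z * b y)
    (hA : Integrable A (Measure.pi fun _ => ν)) (hb : Integrable b ν) :
    ∫ z, f z ∂(Measure.pi fun _ => ν) = (∫ z, A z ∂(Measure.pi fun _ => ν)) * ∫ y, b y ∂ν := by
  rw [integral_eq_integral_update _ e (integrable_of_update_eq_mul e hf h hA hb)]
  simp_rw [h, integral_const_mul, integral_mul_const]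

variable {P : S → ℝ} {B : S → (E → W) → ℝ} {l : S → W → ℝ} {e : E}

omit [Fintype S] in
theorem isLikelihood_mul (hB : IsLikelihood B (Measure.pi fun _ => ν)) (hl : IsLikelihood l ν)
    (hBe : ∀ x z y, B x (Function.update z e y) = B x z) :
    IsLikelihood (fun x ω => B x ω * l x (ω e)) (Measure.pi fun _ => ν) := by
  have hm : ∀ x, Measurable fun ω : E → W => B x ω * l x (ω e) := fun x =>
    (hB.measurable x).mul ((hl.measurable x).comp (measurable_pi_apply e))
  have hu : ∀ x (z : E → W) y, (fun ω : E → W => B x ω * l x (ω e)) (Function.update z e y)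
      = B x z * l x y := fun x z y => by simp [hBe]
  exact ⟨hm, fun x ω => mul_nonneg (hB.nonneg x ω) (hl.nonneg x _),
    fun x => integrable_of_update_eq_mul e (hm x) (hu x) (hB.integrable x) (hl.integrable x),
    fun x => by
      rw [integral_of_update_eq_mul e (hm x) (hu x) (hB.integrable x) (hl.integrable x),
        hB.integral_eq_one, hl.integral_eq_one, one_mul]⟩

omit [Fintype E] [MeasurableSpace W] in
-- Sequential Bayes: the posterior given the other observations serves as the prior for observation
-- `e`.
theorem evidence_mul_update (hBe : ∀ x z y, B x (Function.update z e y) = B x z)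
    {z : E → W} (hz : 0 < evidence P B z) (y : W) :
    evidence P (fun x ω => B x ω * l x (ω e)) (Function.update z e y)
      = evidence P B z * evidence (posterior P B z) l y := by
  have : evidence P (fun x ω => B x ω * l x (ω e)) (Function.update z e y)
      = ∑ x, P x * (B x z * l x y) :=
    Finset.sum_congr rfl fun x _ => by simp [hBe]
  rw [this, evidence.eq_1 (posterior P B z), Finset.mul_sum]
  refine Finset.sum_congr rfl fun x _ => ?_
  rw [posterior]
  field_simp

omit [Fintype E] [MeasurableSpace W] in
theorem posterior_mul_update (hBe : ∀ x z y, B x (Function.update z e y) = B x z)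
    {z : E → W} (hz : 0 < evidence P B z) (y : W) :
    posterior P (fun x ω => B x ω * l x (ω e)) (Function.update z e y)
      = posterior (posterior P B z) l y := by
  ext x
  rw [posterior, evidence_mul_update hBe hz, posterior.eq_1 (posterior P B z) l y x,
    posterior.eq_1 P B z x]
  simp only [hBe, Function.update_self]
  field_simp

theorem isPrior_posterior {Ω : Type*} {P : S → ℝ} {B : S → Ω → ℝ} [Nonempty S] (hP : IsPrior P)
    {z : Ω} (hpos : ∀ x, 0 < B x z) : 0 < evidence P B z ∧ IsPrior (posterior P B z) := by
  have h : 0 < evidence P B z :=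
    Finset.sum_pos (fun x _ => mul_pos (hP.pos x) (hpos x)) Finset.univ_nonempty
  exact ⟨h, fun x => div_pos (mul_pos (hP.pos x) (hpos x)) h, sum_posterior h⟩

/-- The chain rule for mutual information: adding one conditionally independent observation. -/
theorem info_mul [Nonempty S] (hP : IsPrior P) (hB : IsLikelihood B (Measure.pi fun _ => ν))
    (hl : IsLikelihood l ν) (hBe : ∀ x z y, B x (Function.update z e y) = B x z)
    (hpos : ∀ x z, 0 < B x z) :
    Integrable (fun z => evidence P B z * info (posterior P B z) l ν) (Measure.pi fun _ => ν) ∧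
    info P (fun x ω => B x ω * l x (ω e)) (Measure.pi fun _ => ν)
      = info P B (Measure.pi fun _ => ν)
        + ∫ z, evidence P B z * info (posterior P B z) l ν ∂(Measure.pi fun _ => ν) := by
  have hL := isLikelihood_mul hB hl hBe
  have hi := integrable_evidence_entropy hP hL
  have hi2 := (integrable_update (fun _ : E => ν) e hi).integral_prod_left
  -- With the other observations fixed, the expected entropy after observation `e` is the current
  -- posterior entropy minus the information of one channel whose prior is that posterior.
  have hpt : ∀ z : E → W, ∫ y, evidence P (fun x ω => B x ω * l x (ω e)) (Function.update z e y)
        * entropy (posterior P (fun x ω => B x ω * l x (ω e)) (Function.update z e y)) ∂ν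
      = evidence P B z * entropy (posterior P B z)
        - evidence P B z * info (posterior P B z) l ν := by
    intro z
    have hz := (isPrior_posterior hP fun x => hpos x z).1
    simp_rw [evidence_mul_update hBe hz, posterior_mul_update hBe hz, info, mul_assoc,
      integral_const_mul]
    ring
  simp only [hpt] at hi2
  have h1 := integrable_evidence_entropy hP hB
  have h2 : Integrable (fun z => evidence P B z * info (posterior P B z) l ν)
      (Measure.pi fun _ => ν) :=
    (h1.sub hi2).congr (ae_of_all _ fun z => by simp)
  refine ⟨h2, ?_⟩
  rw [info, integral_eq_integral_update _ e hi]
  simp only [hpt]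
  rw [integral_sub h1 h2, info]
  ring

omit [DecidableEq E] in
theorem wvar_measurable {Ω : Type*} [MeasurableSpace Ω] {m : Measure Ω} {L : S → Ω → ℝ}
    (hL : IsLikelihood L m) (u : S → ℝ) : Measurable fun ω => wvar (posterior P L ω) u := by
  have := posterior_measurable (P := P) hL
  unfold wvar
  fun_prop

/-- A second moment about any centre dominates the variance. With the centre fixed the bound is
linear in `L`, so a further observation can be integrated out of it. -/
theorem evidence_mul_wvar_le {Ω : Type*} {P : S → ℝ} {L : S → Ω → ℝ} {ω : Ω}
    (hω : 0 < evidence P L ω) (u : S → ℝ) (c : ℝ) :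
    evidence P L ω * wvar (posterior P L ω) u ≤ ∑ x, P x * L x ω * (u x - c) ^ 2 := by
  have h := sum_mul_sq_sub (posterior P L ω) u (sum_posterior hω) c
  have h2 : ∑ x, P x * L x ω * (u x - c) ^ 2
      = evidence P L ω * ∑ x, posterior P L ω x * (u x - c) ^ 2 := by
    rw [Finset.mul_sum]
    refine Finset.sum_congr rfl fun x _ => ?_
    rw [posterior]; field_simp
  rw [h2, h]
  exact mul_le_mul_of_nonneg_left (by linarith [sq_nonneg (∑ x, posterior P L ω x * u x - c)])
    hω.le

theorem evidence_mul_wvar_eq {Ω : Type*} {P : S → ℝ} {L : S → Ω → ℝ} {ω : Ω}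
    (hω : 0 < evidence P L ω) (u : S → ℝ) :
    evidence P L ω * wvar (posterior P L ω) u
      = ∑ x, P x * L x ω * (u x - ∑ x, posterior P L ω x * u x) ^ 2 := by
  have h := sum_mul_sq_sub (posterior P L ω) u (sum_posterior hω) (∑ x, posterior P L ω x * u x)
  rw [sub_self, zero_pow two_ne_zero, add_zero] at h
  rw [← h, Finset.mul_sum]
  refine Finset.sum_congr rfl fun x _ => ?_
  rw [posterior.eq_1 P L ω x]; field_simp

theorem integrable_evidence_wvar {Ω : Type*} [MeasurableSpace Ω] {m : Measure Ω} {L : S → Ω → ℝ}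
    [Nonempty S] (hP : IsPrior P) (hL : IsLikelihood L m) (hpos : ∀ x z, 0 < L x z) (u : S → ℝ) :
    Integrable (fun ω => evidence P L ω * wvar (posterior P L ω) u) m := by
  refine Integrable.mono' (g := fun ω => ∑ x, P x * L x ω * (u x - 0) ^ 2)
    (integrable_finsetSum _ fun x _ => ((hL.integrable x).const_mul _).mul_const _)
    ((evidence_measurable hL).mul (wvar_measurable hL u)).aestronglyMeasurable
    (ae_of_all _ fun ω => ?_)
  obtain ⟨hz, hq⟩ := isPrior_posterior hP fun x => hpos x ω
  rw [Real.norm_of_nonneg (mul_nonneg hz.le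
    (wvar_nonneg _ _ (fun x => (hq.pos x).le) hq.sum_eq_one))]
  exact evidence_mul_wvar_le hz u 0

/-- The average posterior variance decreases when an observation is added. -/
theorem postVar_mul_le [Nonempty S] (hP : IsPrior P)
    (hB : IsLikelihood B (Measure.pi fun _ => ν))
    (hl : IsLikelihood l ν) (hBe : ∀ x z y, B x (Function.update z e y) = B x z)
    (hpos : ∀ x z, 0 < B x z) (hlpos : ∀ x y, 0 < l x y) (u : S → ℝ) :
    postVar P (fun x ω => B x ω * l x (ω e)) (Measure.pi fun _ => ν) u
      ≤ postVar P B (Measure.pi fun _ => ν) u := by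
  have hL := isLikelihood_mul hB hl hBe
  have hLpos : ∀ x (z : E → W), 0 < B x z * l x (z e) := fun x z => mul_pos (hpos x z) (hlpos x _)
  have hi := integrable_evidence_wvar hP hL hLpos u
  rw [postVar, integral_eq_integral_update _ e hi, postVar]
  refine integral_mono (integrable_update (fun _ : E => ν) e hi).integral_prod_left
    (integrable_evidence_wvar hP hB hpos u) fun z => ?_
  have hz := (isPrior_posterior hP fun x => hpos x z).1
  -- The old posterior mean is a suboptimal centre for the new posterior; with it the new
  -- observation integrates out and the old variance remains.
  set c := ∑ x, posterior P B z x * u x with hc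
  have hint : ∀ x, Integrable (fun y => P x * (B x z * l x y) * (u x - c) ^ 2) ν := fun x =>
    (((hl.integrable x).const_mul _).const_mul _).mul_const _
  calc ∫ y, evidence P (fun x ω => B x ω * l x (ω e)) (Function.update z e y)
        * wvar (posterior P (fun x ω => B x ω * l x (ω e)) (Function.update z e y)) u ∂ν
      ≤ ∫ y, ∑ x, P x * (B x z * l x y) * (u x - c) ^ 2 ∂ν := by
        refine integral_mono_of_nonneg (ae_of_all _ fun y => ?_)
          (integrable_finsetSum _ fun x _ => hint x) (ae_of_all _ fun y => ?_)
        · obtain ⟨h1, h2⟩ := isPrior_posterior (B := fun x ω => B x ω * l x (ω e)) hP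
            fun x => hLpos x (Function.update z e y)
          exact mul_nonneg h1.le (wvar_nonneg _ _ (fun x => (h2.pos x).le) h2.sum_eq_one)
        · have h1 := (isPrior_posterior (B := fun x ω => B x ω * l x (ω e)) hP
            fun x => hLpos x (Function.update z e y)).1
          refine (evidence_mul_wvar_le h1 u c).trans (le_of_eq ?_)
          exact Finset.sum_congr rfl fun x _ => by simp [hBe]
    _ = evidence P B z * wvar (posterior P B z) u := by
        rw [integral_finsetSum _ fun x _ => hint x, evidence_mul_wvar_eq hz]
        refine Finset.sum_congr rfl fun x _ => ?_
        simp_rw [integral_mul_const, integral_const_mul, hl.integral_eq_one, mul_one]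
        rfl

/-- The likelihood of the observations indexed by `T`. -/
def prodLik (T : Finset E) (l : E → S → W → ℝ) (x : S) (ω : E → W) : ℝ := ∏ e ∈ T, l e x (ω e)

omit [Fintype S] [Fintype E] [MeasurableSpace W] in
theorem prodLik_update (T : Finset E) (l : E → S → W → ℝ) (he : e ∉ T) (x : S) (z : E → W)
    (y : W) : prodLik T l x (Function.update z e y) = prodLik T l x z :=
  Finset.prod_congr rfl fun i hi => by
    have : i ≠ e := fun h => he (h ▸ hi)
    rw [Function.update_of_ne this]

omit [Fintype S] [Fintype E] [MeasurableSpace W] in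
theorem prodLik_insert {T : Finset E} (l : E → S → W → ℝ) (he : e ∉ T) :
    prodLik (insert e T) l = fun x ω => prodLik T l x ω * l e x (ω e) := by
  ext x ω
  rw [prodLik, Finset.prod_insert he, mul_comm, prodLik]

omit [Fintype S] in
theorem isLikelihood_prodLik {l : E → S → W → ℝ} (hl : ∀ e, IsLikelihood (l e) ν)
    (T : Finset E) : IsLikelihood (prodLik T l) (Measure.pi fun _ => ν) := by
  induction T using Finset.induction_on with
  | empty =>
    have h : ∀ x, prodLik (∅ : Finset E) l x = fun _ => 1 := fun x => by ext; simp [prodLik]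
    exact ⟨fun x => by rw [h]; exact measurable_const, fun x ω => by simp [h],
      fun x => by rw [h]; exact integrable_const _, fun x => by simp [h]⟩
  | insert e T he ih =>
    rw [prodLik_insert l he]
    exact isLikelihood_mul ih (hl e) (prodLik_update T l he)

theorem postVar_prodLik_mono [Nonempty S] (hP : IsPrior P) {l : E → S → W → ℝ}
    (hl : ∀ e, IsLikelihood (l e) ν) (hpos : ∀ e x y, 0 < l e x y) (u : S → ℝ) {T T' : Finset E}
    (h : T ⊆ T') : postVar P (prodLik T' l) (Measure.pi fun _ => ν) u
      ≤ postVar P (prodLik T l) (Measure.pi fun _ => ν) u := by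
  obtain ⟨U, hU⟩ : ∃ U, U = T' \ T := ⟨_, rfl⟩
  induction U using Finset.induction_on generalizing T with
  | empty => rw [(Finset.sdiff_eq_empty_iff_subset.1 hU.symm).antisymm h]
  | insert i U hi ih =>
    have hi' : i ∈ T' \ T := hU ▸ Finset.mem_insert_self i U
    rw [Finset.mem_sdiff] at hi'
    refine (ih (T := insert i T) (Finset.insert_subset hi'.1 h) ?_).trans ?_
    · rw [Finset.sdiff_insert, ← hU, Finset.erase_insert hi]
    · rw [prodLik_insert l hi'.2]
      exact postVar_mul_le hP (isLikelihood_prodLik hl T) (hl i) (prodLik_update T l hi'.2)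
        (fun x z => Finset.prod_pos fun j _ => hpos j x _) (hpos i) u

/-- Comparison of two families of channels whose one-step informations are close. -/
theorem abs_info_sub_info_le [Nonempty S] (hP : IsPrior P) {l l' : E → S → W → ℝ}
    (hl : ∀ e, IsLikelihood (l e) ν) (hl' : ∀ e, IsLikelihood (l' e) ν)
    (hpos : ∀ e x y, 0 < l e x y) (hpos' : ∀ e x y, 0 < l' e x y) (u : E → S → ℝ)
    {s c err : ℝ} (hs0 : 0 ≤ s) (hc : 0 ≤ c)
    (hlow : ∀ e q, IsPrior q → s * wvar q (u e) ≤ info q (l e) ν)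
    (hdiff : ∀ e q, IsPrior q →
      |info q (l e) ν - info q (l' e) ν| ≤ c * (s * wvar q (u e)) + err) :
    |info P (prodLik Finset.univ l) (Measure.pi fun _ => ν)
        - info P (prodLik Finset.univ l') (Measure.pi fun _ => ν)|
      ≤ c * Real.log (Fintype.card S) + Fintype.card E * err := by
  set m : Measure (E → W) := Measure.pi fun _ => ν with hm
  -- Hybrid channels: `l` on `T` and `l'` elsewhere. Letting `T` grow from `∅` to the whole set
  -- passes from `l'` to `l`.
  let mix : Finset E → E → S → W → ℝ := fun T e => if e ∈ T then l e else l' e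
  have hmix : ∀ T e, IsLikelihood (mix T e) ν := fun T e => by
    simp only [mix]; split_ifs <;> [exact hl e; exact hl' e]
  have hmixpos : ∀ T e x y, 0 < mix T e x y := fun T e => by
    simp only [mix]; split_ifs <;> [exact hpos e; exact hpos' e]
  -- The error accumulated so far is charged to the information of the `l`-observations in `T`
  -- alone, a quantity that the chain rule increases at each exchange.
  have key : ∀ T : Finset E, |info P (prodLik Finset.univ (mix T)) m
      - info P (prodLik Finset.univ (mix ∅)) m| ≤ c * info P (prodLik T l) m + T.card * err := by
    intro T
    induction T using Finset.induction_on with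
    | empty =>
      have : info P (prodLik ∅ l) m = 0 := by
        have h1 : ∀ ω : E → W, evidence P (prodLik ∅ l) ω = 1 := fun ω => by
          simp [evidence, prodLik, hP.sum_eq_one]
        have h2 : ∀ ω : E → W, posterior P (prodLik ∅ l) ω = P := fun ω => by
          ext x; simp [posterior, h1, prodLik]
        simp [info, h1, h2, hm]
      simp [this]
    | insert e T he ih =>
      set U := Finset.univ.erase e with hU
      have heU : e ∉ U := Finset.notMem_erase e _
      have hUi : insert e U = Finset.univ := Finset.insert_erase (Finset.mem_univ e)
      set B := prodLik U (mix T) with hBdef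
      have hBeq : prodLik U (mix (insert e T)) = B := by
        ext x ω
        refine Finset.prod_congr rfl fun i hi => ?_
        have : i ≠ e := Finset.ne_of_mem_erase hi
        simp [mix, this]
      have hBl : IsLikelihood B m := isLikelihood_prodLik (hmix T) U
      have hBe := prodLik_update U (mix T) heU
      have hBpos : ∀ x z, 0 < B x z := fun x z => Finset.prod_pos fun j _ => hmixpos T j x _
      obtain ⟨i1, e1⟩ := info_mul hP hBl (hl e) hBe hBpos
      obtain ⟨i2, e2⟩ := info_mul hP hBl (hl' e) hBe hBpos
      have f1 : prodLik Finset.univ (mix (insert e T)) = fun x ω => B x ω * l e x (ω e) := by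
        rw [← hUi, prodLik_insert _ heU, hBeq]; simp [mix]
      have f2 : prodLik Finset.univ (mix T) = fun x ω => B x ω * l' e x (ω e) := by
        rw [← hUi, prodLik_insert _ heU]; simp [mix, he, hBdef]
      have hTl := isLikelihood_prodLik hl T (ν := ν)
      have hTpos : ∀ x z, 0 < prodLik T l x z := fun x z => Finset.prod_pos fun j _ => hpos j x _
      obtain ⟨i3, e3⟩ := info_mul hP hTl (hl e) (prodLik_update T l he) hTpos
      rw [← prodLik_insert l he] at e3
      -- Forgetting the `l'`-observations raises the variance, but leaves a system made of `l` only,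
      -- where `hlow` bounds this variance by the next increment of information.
      have hV : postVar P B m (u e) ≤ postVar P (prodLik T l) m (u e) := by
        have hTU : T ⊆ U := fun i hi => Finset.mem_erase.2 ⟨fun h => he (h ▸ hi), Finset.mem_univ i⟩
        have h1 := postVar_prodLik_mono hP (hmix T) (hmixpos T) (u e) hTU
        have h2 : prodLik T (mix T) = prodLik T l := by
          ext x ω
          exact Finset.prod_congr rfl fun i hi => by simp [mix, hi]
        rwa [h2] at h1
      have hs : s * postVar P (prodLik T l) m (u e)
          ≤ ∫ z, evidence P (prodLik T l) z * info (posterior P (prodLik T l) z) (l e) ν ∂m := by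
        rw [postVar, ← integral_const_mul]
        refine integral_mono ((integrable_evidence_wvar hP hTl hTpos _).const_mul _) i3 fun z => ?_
        obtain ⟨hz, hq⟩ := isPrior_posterior hP fun x => hTpos x z
        have := mul_le_mul_of_nonneg_left (hlow e _ hq) hz.le
        simp only
        linarith
      have hstep : |info P (prodLik Finset.univ (mix (insert e T))) m
          - info P (prodLik Finset.univ (mix T)) m| ≤ c * (s * postVar P B m (u e)) + err := by
        rw [f1, f2, e1, e2, add_sub_add_left_eq_sub, ← integral_sub i1 i2]
        have hi := integrable_evidence_wvar hP hBl hBpos (u e)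
        calc |∫ z, (evidence P B z * info (posterior P B z) (l e) ν
              - evidence P B z * info (posterior P B z) (l' e) ν) ∂m|
            ≤ ∫ z, |evidence P B z * info (posterior P B z) (l e) ν
              - evidence P B z * info (posterior P B z) (l' e) ν| ∂m := abs_integral_le_integral_abs
          _ ≤ ∫ z, (c * s * (evidence P B z * wvar (posterior P B z) (u e))
                + err * evidence P B z) ∂m := by
              refine integral_mono (i1.sub i2).abs ((hi.const_mul _).add
                ((evidence_integrable hBl).const_mul _)) fun z => ?_
              obtain ⟨hz, hq⟩ := isPrior_posterior hP fun x => hBpos x z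
              simp only
              rw [← mul_sub, abs_mul, abs_of_pos hz]
              have := mul_le_mul_of_nonneg_left (hdiff e _ hq) hz.le
              linarith
          _ = c * (s * postVar P B m (u e)) + err := by
              rw [integral_add (hi.const_mul _) ((evidence_integrable hBl).const_mul _),
                integral_const_mul, integral_const_mul, integral_evidence hP hBl, postVar]
              ring
      have hfin : c * (s * postVar P B m (u e))
          ≤ c * (∫ z, evidence P (prodLik T l) z
            * info (posterior P (prodLik T l) z) (l e) ν ∂m) := by
        exact mul_le_mul_of_nonneg_left ((mul_le_mul_of_nonneg_left hV hs0).trans hs) hc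
      rw [Finset.card_insert_of_notMem he, e3]
      push_cast
      have htri := abs_sub_le (info P (prodLik Finset.univ (mix (insert e T))) m)
        (info P (prodLik Finset.univ (mix T)) m) (info P (prodLik Finset.univ (mix ∅)) m)
      linarith
  have hfin := key Finset.univ
  have h1 : mix Finset.univ = l := by ext e x y; simp [mix]
  have h2 : mix ∅ = l' := by ext e x y; simp [mix]
  rw [h1, h2] at hfin
  have h3 : info P (prodLik Finset.univ l) m ≤ Real.log (Fintype.card S) :=
    (info_le_entropy hP (isLikelihood_prodLik hl _)).trans (entropy_le_log_card hP)
  have h4 := mul_le_mul_of_nonneg_left h3 hc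
  rw [Finset.card_univ] at hfin
  linarith

end Chain

end

end SBM

namespace SBM

noncomputable section

/-! ### Information of one weak Bernoulli observation -/

section Scalar

variable {S : Type*} [Fintype S]

theorem evidence_mul_entropy {Ω : Type*} {P : S → ℝ} {L : S → Ω → ℝ} {ω : Ω} [Nonempty S]
    (hP : IsPrior P) (hpos : ∀ x, 0 < L x ω) :
    evidence P L ω * entropy (posterior P L ω)
      = ∑ x, Real.negMulLog (P x) * L x ω - ∑ x, P x * (L x ω * Real.log (L x ω))
        + evidence P L ω * Real.log (evidence P L ω) := by
  obtain ⟨hz, hq⟩ := isPrior_posterior hP hpos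
  have : ∀ x, evidence P L ω * Real.negMulLog (posterior P L ω x)
      = Real.negMulLog (P x) * L x ω - P x * (L x ω * Real.log (L x ω))
        + P x * L x ω * Real.log (evidence P L ω) := by
    intro x
    have hx := hP.pos x
    have hl := hpos x
    rw [Real.negMulLog, posterior, Real.log_div (by positivity) hz.ne',
      Real.log_mul hx.ne' hl.ne', Real.negMulLog]
    field_simp
    ring
  rw [entropy, Finset.mul_sum]
  simp_rw [this]
  rw [Finset.sum_add_distrib, Finset.sum_sub_distrib, ← Finset.sum_mul]
  rfl

/-- The logarithm of the posterior is `log P + log L - log evidence`, and the prior entropy cancels.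
Integrability of the evidence term follows from that of the other terms. -/
theorem info_eq {Ω : Type*} [MeasurableSpace Ω] {m : Measure Ω} {P : S → ℝ} {L : S → Ω → ℝ}
    [Nonempty S] (hP : IsPrior P) (hL : IsLikelihood L m) (hpos : ∀ x ω, 0 < L x ω)
    (hint : ∀ x, Integrable (fun ω => L x ω * Real.log (L x ω)) m) :
    Integrable (fun ω => evidence P L ω * Real.log (evidence P L ω)) m ∧
    info P L m = ∑ x, P x * ∫ ω, L x ω * Real.log (L x ω) ∂m
      - ∫ ω, evidence P L ω * Real.log (evidence P L ω) ∂m := by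
  have hpt := fun ω => evidence_mul_entropy hP fun x => hpos x ω
  have h0 := integrable_evidence_entropy hP hL
  have h1 : Integrable (fun ω => ∑ x, Real.negMulLog (P x) * L x ω) m :=
    integrable_finsetSum _ fun x _ => (hL.integrable x).const_mul _
  have h2 : Integrable (fun ω => ∑ x, P x * (L x ω * Real.log (L x ω))) m :=
    integrable_finsetSum _ fun x _ => (hint x).const_mul _
  have h3 : Integrable (fun ω => evidence P L ω * Real.log (evidence P L ω)) m :=
    ((h0.sub h1).add h2).congr (ae_of_all _ fun ω => by
      simp only [Pi.add_apply, Pi.sub_apply, hpt ω]; ring)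
  refine ⟨h3, ?_⟩
  rw [info]
  simp_rw [hpt]
  have h12 : Integrable (fun ω => ∑ x, Real.negMulLog (P x) * L x ω
      - ∑ x, P x * (L x ω * Real.log (L x ω))) m := h1.sub h2
  rw [integral_add h12 h3, integral_sub h1 h2,
    integral_finsetSum _ fun x _ => (hL.integrable x).const_mul _,
    integral_finsetSum _ fun x _ => (hint x).const_mul _]
  simp_rw [integral_const_mul, hL.integral_eq_one, mul_one, entropy]
  ring

theorem wvar_affine (q u : S → ℝ) (hq : ∑ x, q x = 1) (a b : ℝ) :
    wvar q (fun x => a * (1 + b * u x)) = a ^ 2 * b ^ 2 * wvar q u := by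
  simp only [wvar]
  have h1 : ∑ x, q x * (a * (1 + b * u x)) ^ 2
      = a ^ 2 * ∑ x, q x + 2 * a ^ 2 * b * ∑ x, q x * u x + a ^ 2 * b ^ 2 * ∑ x, q x * u x ^ 2 := by
    simp_rw [Finset.mul_sum]
    rw [← Finset.sum_add_distrib, ← Finset.sum_add_distrib]
    exact Finset.sum_congr rfl fun x _ => by ring
  have h2 : ∑ x, q x * (a * (1 + b * u x)) = a * ∑ x, q x + a * b * ∑ x, q x * u x := by
    simp_rw [Finset.mul_sum]
    rw [← Finset.sum_add_distrib]
    exact Finset.sum_congr rfl fun x _ => by ring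
  rw [h1, h2, hq]
  ring

/-- Jensen's inequality for `f t - A / 2 * t ^ 2`: the quadratic part contributes a multiple of the
variance. Negative `A` is allowed and yields the upper bound on the information. -/
theorem wvar_le_of_convex {f : ℝ → ℝ} {D : Set ℝ} {A : ℝ}
    (hf : ConvexOn ℝ D fun t => f t - A / 2 * t ^ 2) {q M : S → ℝ} (hq0 : ∀ x, 0 ≤ q x)
    (hq : ∑ x, q x = 1) (hM : ∀ x, M x ∈ D) :
    A / 2 * wvar q M ≤ ∑ x, q x * f (M x) - f (∑ x, q x * M x) := by
  have h := hf.map_sum_le (t := Finset.univ) (w := q) (p := M) (fun x _ => hq0 x) hq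
    fun x _ => hM x
  simp only [smul_eq_mul, mul_sub, Finset.sum_sub_distrib] at h
  have h2 : ∑ x, q x * (A / 2 * M x ^ 2) = A / 2 * ∑ x, q x * M x ^ 2 := by
    rw [Finset.mul_sum]; exact Finset.sum_congr rfl fun x _ => by ring
  rw [h2] at h
  rw [wvar]
  linarith

theorem hasDerivAt_deriv_binEntropy {t : ℝ} (h0 : 0 < t) (h1 : t < 1) :
    HasDerivAt (fun t => Real.log (1 - t) - Real.log t) (-(1 / t + 1 / (1 - t))) t := by
  have := (((hasDerivAt_id t).const_sub 1).log (by simp; linarith)).sub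
    ((hasDerivAt_id t).log h0.ne')
  refine this.congr_deriv ?_
  simp; ring

theorem convexOn_neg_binEntropy {lo hi A : ℝ} (hlo : 0 < lo) (hhi : hi < 1)
    (hA : ∀ t ∈ Set.Icc lo hi, A ≤ 1 / t + 1 / (1 - t)) :
    ConvexOn ℝ (Set.Icc lo hi) fun t => -Real.binEntropy t - A / 2 * t ^ 2 := by
  have hmem : ∀ t ∈ interior (Set.Icc lo hi), 0 < t ∧ t < 1 ∧ t ∈ Set.Icc lo hi := fun t ht => by
    have := interior_subset ht
    exact ⟨hlo.trans_le this.1, this.2.trans_lt hhi, this⟩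
  refine convexOn_of_hasDerivWithinAt2_nonneg (convex_Icc _ _)
    (f' := fun t => -(Real.log (1 - t) - Real.log t) - A * t)
    (f'' := fun t => (1 / t + 1 / (1 - t)) - A) (by fun_prop) ?_ ?_ ?_
  · intro t ht
    obtain ⟨h0, h1, _⟩ := hmem t ht
    have := (Real.hasDerivAt_binEntropy h0.ne' h1.ne).neg.sub (((hasDerivAt_id t).pow 2).const_mul (A / 2))
    refine (this.congr_deriv ?_).hasDerivWithinAt
    simp; ring
  · intro t ht
    obtain ⟨h0, h1, _⟩ := hmem t ht
    have := (hasDerivAt_deriv_binEntropy h0 h1).neg.sub ((hasDerivAt_id t).const_mul A)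
    refine (this.congr_deriv ?_).hasDerivWithinAt
    ring
  · intro t ht
    have := hA t (hmem t ht).2.2
    linarith

theorem convexOn_binEntropy_add {lo hi A : ℝ} (hlo : 0 < lo) (hhi : hi < 1)
    (hA : ∀ t ∈ Set.Icc lo hi, 1 / t + 1 / (1 - t) ≤ A) :
    ConvexOn ℝ (Set.Icc lo hi) fun t => Real.binEntropy t - (-A) / 2 * t ^ 2 := by
  have hmem : ∀ t ∈ interior (Set.Icc lo hi), 0 < t ∧ t < 1 ∧ t ∈ Set.Icc lo hi := fun t ht => by
    have := interior_subset ht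
    exact ⟨hlo.trans_le this.1, this.2.trans_lt hhi, this⟩
  refine convexOn_of_hasDerivWithinAt2_nonneg (convex_Icc _ _)
    (f' := fun t => (Real.log (1 - t) - Real.log t) + A * t)
    (f'' := fun t => -(1 / t + 1 / (1 - t)) + A) (by fun_prop) ?_ ?_ ?_
  · intro t ht
    obtain ⟨h0, h1, _⟩ := hmem t ht
    have := (Real.hasDerivAt_binEntropy h0.ne' h1.ne).sub (((hasDerivAt_id t).pow 2).const_mul (-A / 2))
    refine (this.congr_deriv ?_).hasDerivWithinAt
    simp; ring
  · intro t ht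
    obtain ⟨h0, h1, _⟩ := hmem t ht
    have := (hasDerivAt_deriv_binEntropy h0 h1).add ((hasDerivAt_id t).const_mul A)
    refine (this.congr_deriv ?_).hasDerivWithinAt
    ring
  · intro t ht
    have := hA t (hmem t ht).2.2
    linarith

/-- The uniform law on `Bool`. -/
def fairCoin : Measure Bool := bernoulliMeasure true false ⟨1 / 2, by norm_num, by norm_num⟩

instance : IsProbabilityMeasure fairCoin := by unfold fairCoin; infer_instance

theorem integral_fairCoin (f : Bool → ℝ) : ∫ b, f b ∂fairCoin = (f true + f false) / 2 := by
  rw [fairCoin, integral_bernoulliMeasure]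
  simp only [smul_eq_mul]
  ring

/-- The Bernoulli likelihood with respect to a fair coin. -/
def bernLik (M : S → ℝ) (x : S) (b : Bool) : ℝ := if b then 2 * M x else 2 * (1 - M x)

omit [Fintype S] in
theorem isLikelihood_bernLik {M : S → ℝ} (hM : ∀ x, M x ∈ Set.Icc (0 : ℝ) 1) :
    IsLikelihood (bernLik M) fairCoin := by
  refine ⟨fun x => measurable_of_finite _, fun x b => ?_, fun x => .of_finite, fun x => ?_⟩
  · have := hM x
    cases b <;> simp [bernLik] <;> linarith [this.1, this.2]
  · rw [integral_fairCoin]; simp [bernLik]; ring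

omit [Fintype S] in
theorem bernLik_pos {M : S → ℝ} (hM : ∀ x, M x ∈ Set.Ioo (0 : ℝ) 1) (x : S) (b : Bool) :
    0 < bernLik M x b := by
  have := hM x
  cases b <;> simp [bernLik] <;> linarith [this.1, this.2]

theorem info_bernLik [Nonempty S] {M q : S → ℝ} (hM : ∀ x, M x ∈ Set.Ioo (0 : ℝ) 1)
    (hq : IsPrior q) :
    info q (bernLik M) fairCoin
      = Real.binEntropy (∑ x, q x * M x) - ∑ x, q x * Real.binEntropy (M x) := by
  have hL := isLikelihood_bernLik fun x => Set.Ioo_subset_Icc_self (hM x)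
  rw [(info_eq hq hL (bernLik_pos hM) fun x => .of_finite).2]
  simp_rw [integral_fairCoin]
  have e1 : evidence q (bernLik M) true = 2 * ∑ x, q x * M x := by
    simp only [evidence, bernLik, if_true, Finset.mul_sum]
    exact Finset.sum_congr rfl fun x _ => by ring
  have e2 : evidence q (bernLik M) false = 2 * (1 - ∑ x, q x * M x) := by
    have : ∑ x, q x * (1 - M x) = 1 - ∑ x, q x * M x := by
      simp_rw [mul_sub, Finset.sum_sub_distrib, mul_one, hq.sum_eq_one]
    rw [← this, Finset.mul_sum]
    simp only [evidence, bernLik, Bool.false_eq_true, if_false]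
    exact Finset.sum_congr rfl fun x _ => by ring
  have key : ∀ t : ℝ, 0 < t → t < 1 →
      (2 * t * Real.log (2 * t) + 2 * (1 - t) * Real.log (2 * (1 - t))) / 2
        = Real.log 2 - Real.binEntropy t := by
    intro t h0 h1
    rw [Real.log_mul two_ne_zero h0.ne', Real.log_mul two_ne_zero (by linarith),
      Real.binEntropy_eq_negMulLog_add_negMulLog_one_sub, Real.negMulLog, Real.negMulLog]
    ring
  have hlo : 0 < ∑ x, q x * M x :=
    Finset.sum_pos (fun x _ => mul_pos (hq.pos x) (hM x).1) Finset.univ_nonempty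
  have hhi : ∑ x, q x * M x < 1 := by
    rw [← hq.sum_eq_one]
    exact Finset.sum_lt_sum_of_nonempty Finset.univ_nonempty fun x _ => by
      nlinarith [hq.pos x, (hM x).2]
  rw [e1, e2, key _ hlo hhi]
  have : ∀ x, q x * ((bernLik M x true * Real.log (bernLik M x true)
      + bernLik M x false * Real.log (bernLik M x false)) / 2)
        = q x * Real.log 2 - q x * Real.binEntropy (M x) := fun x => by
    rw [← mul_sub, ← key _ (hM x).1 (hM x).2]; simp [bernLik]
  simp_rw [this]
  rw [Finset.sum_sub_distrib, ← Finset.sum_mul, hq.sum_eq_one]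
  ring

/-- The information carried by a weak Bernoulli observation. -/
theorem info_bernLik_bounds [Nonempty S] {q u : S → ℝ} (hq : IsPrior q) {δ ε κ : ℝ} (hδ : 0 < δ)
    (hκ : κ ≤ 1 / 2) (hδκ : δ * (1 + κ) ≤ 1 / 2) (hu : ∀ x, |ε * u x| ≤ κ) :
    δ * ε ^ 2 / 2 * (1 - κ) * wvar q u ≤ info q (bernLik fun x => δ * (1 + ε * u x)) fairCoin ∧
    info q (bernLik fun x => δ * (1 + ε * u x)) fairCoin
      ≤ δ * ε ^ 2 / 2 * (1 + 2 * κ + 2 * δ) * wvar q u := by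
  have hκ0 : 0 ≤ κ := (abs_nonneg _).trans (hu (Classical.arbitrary S))
  set M : S → ℝ := fun x => δ * (1 + ε * u x) with hMdef
  have hlo : 0 < δ * (1 - κ) := mul_pos hδ (by linarith)
  have hM : ∀ x, M x ∈ Set.Icc (δ * (1 - κ)) (δ * (1 + κ)) := fun x => by
    have := abs_le.1 (hu x)
    constructor <;> simp only [hMdef] <;> gcongr <;> linarith
  have hM' : ∀ x, M x ∈ Set.Ioo (0 : ℝ) 1 := fun x =>
    ⟨hlo.trans_le (hM x).1, (hM x).2.trans_lt (by linarith)⟩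
  rw [info_bernLik hM' hq]
  have hq0 : ∀ x, 0 ≤ q x := fun x => (hq.pos x).le
  have hV := wvar_affine q u hq.sum_eq_one δ ε
  have hVn := wvar_nonneg q u hq0 hq.sum_eq_one
  constructor
  -- On the range of `M`, the second derivative `1 / t + 1 / (1 - t)` of minus the binary entropy is
  -- at least `(1 - κ) / δ`, because `1 / (1 + κ) ≥ 1 - κ`.
  · have h := wvar_le_of_convex (convexOn_neg_binEntropy (A := (1 - κ) / δ) hlo
      (by linarith : δ * (1 + κ) < 1) fun t ht => ?_) hq0 hq.sum_eq_one hM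
    · rw [hV] at h
      simp only [mul_neg, Finset.sum_neg_distrib] at h
      have e : (1 - κ) / δ / 2 * (δ ^ 2 * ε ^ 2 * wvar q u)
          = δ * ε ^ 2 / 2 * (1 - κ) * wvar q u := by
        field_simp
      rw [e] at h
      linarith
    · have ht0 : 0 < t := hlo.trans_le ht.1
      have ht1 : 0 < 1 - t := by linarith [ht.2]
      have h1 : (1 - κ) / δ ≤ 1 / t := by
        rw [div_le_div_iff₀ hδ ht0]
        calc (1 - κ) * t ≤ (1 - κ) * (δ * (1 + κ)) := by
              gcongr
              · linarith
              · exact ht.2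
          _ = δ * (1 - κ ^ 2) := by ring
          _ ≤ 1 * δ := by nlinarith [sq_nonneg κ]
      have h2 : 0 < 1 / (1 - t) := by positivity
      linarith
  -- Here `1 / t ≤ (1 + 2 κ) / δ`, because `1 / (1 - κ) ≤ 1 + 2 κ` for `κ ≤ 1 / 2`, and `1 / (1 - t)
  -- ≤ 2`.
  · have h := wvar_le_of_convex (convexOn_binEntropy_add (A := (1 + 2 * κ) / δ + 2) hlo
      (by linarith : δ * (1 + κ) < 1) fun t ht => ?_) hq0 hq.sum_eq_one hM
    · rw [hV] at h
      have e : -((1 + 2 * κ) / δ + 2) / 2 * (δ ^ 2 * ε ^ 2 * wvar q u)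
          = -(δ * ε ^ 2 / 2 * (1 + 2 * κ + 2 * δ) * wvar q u) := by
        field_simp
      rw [e] at h
      linarith
    · have ht0 : 0 < t := hlo.trans_le ht.1
      have h1 : 1 / t ≤ (1 + 2 * κ) / δ := by
        rw [div_le_div_iff₀ ht0 hδ]
        have : (1 + 2 * κ) * (δ * (1 - κ)) ≤ (1 + 2 * κ) * t := by
          gcongr; exact ht.1
        nlinarith [mul_nonneg hδ.le (mul_nonneg hκ0 (by linarith : 0 ≤ 1 - 2 * κ))]
      have h2 : 1 / (1 - t) ≤ 2 := by
        rw [div_le_iff₀ (by linarith [ht.2])]; linarith [ht.2]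
      linarith

theorem monotoneOn_log_sub : MonotoneOn
    (fun t : ℝ => Real.log t - ((t - 1) - (t - 1) ^ 2 / 2)) (Set.Ioi 0) := by
  refine monotoneOn_of_hasDerivWithinAt_nonneg (f' := fun t => (t - 1) ^ 2 / t) (convex_Ioi 0) ?_ ?_ ?_
  · intro t ht
    have : t ≠ 0 := (Set.mem_Ioi.1 ht).ne'
    fun_prop (disch := assumption)
  · intro t ht
    rw [interior_Ioi] at ht
    have ht0 : t ≠ 0 := (Set.mem_Ioi.1 ht).ne'
    have := (Real.hasDerivAt_log ht0).sub (((hasDerivAt_id t).sub_const 1).sub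
      ((((hasDerivAt_id t).sub_const 1).pow 2).div_const 2))
    refine (this.congr_deriv ?_).hasDerivWithinAt
    simp
    field_simp
    ring
  · intro t ht
    rw [interior_Ioi] at ht
    exact div_nonneg (sq_nonneg _) (Set.mem_Ioi.1 ht).le

theorem monotoneOn_sub_log : MonotoneOn
    (fun t : ℝ => (t - 1 / t) / 2 - Real.log t) (Set.Ioi 0) := by
  refine monotoneOn_of_hasDerivWithinAt_nonneg (f' := fun t => (1 - 1 / t) ^ 2 / 2) (convex_Ioi 0) ?_ ?_ ?_
  · intro t ht
    have : t ≠ 0 := (Set.mem_Ioi.1 ht).ne'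
    fun_prop (disch := assumption)
  · intro t ht
    rw [interior_Ioi] at ht
    have ht0 : t ≠ 0 := (Set.mem_Ioi.1 ht).ne'
    have := (((hasDerivAt_id t).sub ((hasDerivAt_inv ht0))).div_const 2).sub
      (Real.hasDerivAt_log ht0)
    simp only [one_div]
    refine (this.congr_deriv ?_).hasDerivWithinAt
    simp; field_simp; ring
  · intro t ht
    positivity

/-- Two increasing functions vanish at `1`, so the inequalities reverse there. Both bounds on the
logarithm become polynomials after multiplication by `t`. -/
theorem log_bounds_of_le_one {t : ℝ} (h0 : 0 < t) (h1 : t ≤ 1) :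
    Real.log t ≤ (t - 1) - (t - 1) ^ 2 / 2 ∧ (t - 1 / t) / 2 ≤ Real.log t := by
  have a := monotoneOn_log_sub (Set.mem_Ioi.2 h0) (Set.mem_Ioi.2 one_pos) h1
  have b := monotoneOn_sub_log (Set.mem_Ioi.2 h0) (Set.mem_Ioi.2 one_pos) h1
  norm_num at a b
  exact ⟨by linarith, by rw [one_div]; linarith⟩

theorem log_bounds_of_one_le {t : ℝ} (h1 : 1 ≤ t) :
    (t - 1) - (t - 1) ^ 2 / 2 ≤ Real.log t ∧ Real.log t ≤ (t - 1 / t) / 2 := by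
  have h0 : 0 < t := one_pos.trans_le h1
  have a := monotoneOn_log_sub (Set.mem_Ioi.2 one_pos) (Set.mem_Ioi.2 h0) h1
  have b := monotoneOn_sub_log (Set.mem_Ioi.2 one_pos) (Set.mem_Ioi.2 h0) h1
  norm_num at a b
  exact ⟨by linarith, by rw [one_div]; linarith⟩

/-- Second-order expansion of `t log t - t + 1` at `1`. The logarithm bounds keep the error cubic on
all of `t > 0`, so likelihood ratios need no truncation. -/
theorem abs_klFun_sub_le {t : ℝ} (ht : 0 < t) :
    |InformationTheory.klFun t - (t - 1) ^ 2 / 2| ≤ |t - 1| ^ 3 := by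
  rw [InformationTheory.klFun_apply]
  have e : t * ((t - 1 / t) / 2) = (t ^ 2 - 1) / 2 := by field_simp
  rcases le_total t 1 with h | h
  · obtain ⟨h1, h2⟩ := log_bounds_of_le_one ht h
    have h1' := mul_le_mul_of_nonneg_left h1 ht.le
    have h2' := mul_le_mul_of_nonneg_left h2 ht.le
    rw [e] at h2'
    have h3 : 0 ≤ (1 - t) ^ 3 := pow_nonneg (by linarith) 3
    rw [abs_of_nonpos (by linarith : t - 1 ≤ 0), abs_le]
    constructor <;> nlinarith
  · obtain ⟨h1, h2⟩ := log_bounds_of_one_le h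
    have h1' := mul_le_mul_of_nonneg_left h1 ht.le
    have h2' := mul_le_mul_of_nonneg_left h2 ht.le
    rw [e] at h2'
    have h3 : 0 ≤ (t - 1) ^ 3 := pow_nonneg (by linarith) 3
    rw [abs_of_nonneg (by linarith : 0 ≤ t - 1), abs_le]
    constructor <;> nlinarith

end Scalar

/-! ### Information of one weak Gaussian observation -/

section GaussianLikelihood

variable {S : Type*} [Fintype S]

theorem integral_gauss_shift (a : ℝ) (f : ℝ → ℝ) :
    ∫ y, Real.exp (a * y - a ^ 2 / 2) * f y ∂(gaussianReal 0 1) = ∫ y, f y ∂(gaussianReal a 1) := by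
  rw [gaussianReal_eq_withDensity a,
    integral_withDensity_eq_integral_toReal_smul (by fun_prop) (by simp)]
  simp [ENNReal.toReal_ofReal (Real.exp_pos _).le]

theorem integrable_gauss_shift (a : ℝ) {f : ℝ → ℝ} (hf : Integrable f (gaussianReal a 1)) :
    Integrable (fun y => Real.exp (a * y - a ^ 2 / 2) * f y) (gaussianReal 0 1) := by
  rw [gaussianReal_eq_withDensity a,
    integrable_withDensity_iff_integrable_smul' (by fun_prop) (by simp)] at hf
  simpa only [ENNReal.toReal_ofReal (Real.exp_pos _).le, smul_eq_mul] using hf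

theorem integrable_exp_gauss (c : ℝ) :
    Integrable (fun y => Real.exp (c * y)) (gaussianReal 0 1) := integrable_exp_mul_gaussianReal c

theorem integral_exp_gauss (c : ℝ) :
    ∫ y, Real.exp (c * y) ∂(gaussianReal 0 1) = Real.exp (c ^ 2 / 2) := by
  have := congrFun (mgf_fun_id_gaussianReal (μ := 0) (v := 1)) c
  simpa [mgf] using this

/-- The likelihood of a Gaussian observation with signal `a x`. -/
def gaussLik (a : S → ℝ) (x : S) (y : ℝ) : ℝ := Real.exp (a x * y - a x ^ 2 / 2)

omit [Fintype S] in
theorem isLikelihood_gaussLik (a : S → ℝ) : IsLikelihood (gaussLik a) (gaussianReal 0 1) := by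
  refine ⟨fun x => by unfold gaussLik; fun_prop, fun x y => (Real.exp_pos _).le, fun x => ?_,
    fun x => ?_⟩
  · simpa [gaussLik] using! integrable_gauss_shift (a x) (f := fun _ => 1) (integrable_const _)
  · simpa [gaussLik] using integral_gauss_shift (a x) fun _ => 1

omit [Fintype S] in
theorem gaussLik_mul_log (a : S → ℝ) (x : S) :
    Integrable (fun y => gaussLik a x y * Real.log (gaussLik a x y)) (gaussianReal 0 1) ∧
    ∫ y, gaussLik a x y * Real.log (gaussLik a x y) ∂(gaussianReal 0 1) = a x ^ 2 / 2 := by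
  have hi : Integrable (fun y : ℝ => y) (gaussianReal (a x) 1) :=
    (memLp_id_gaussianReal' 2 (by norm_num) : MemLp (fun y : ℝ => y) 2 _).integrable (by norm_num)
  simp only [gaussLik, Real.log_exp]
  refine ⟨integrable_gauss_shift (a x) ((hi.const_mul _).sub (integrable_const _)), ?_⟩
  rw [integral_gauss_shift (a x) fun y => a x * y - a x ^ 2 / 2,
    integral_sub (hi.const_mul _) (integrable_const _), integral_const_mul,
    integral_id_gaussianReal]
  simp
  ring

omit [Fintype S] in
-- The `k`-th moment of the likelihood is `exp ((k ^ 2 - k) / 2 * t ^ 2)`. In the binomial expansion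
-- the orders `1` and `t ^ 2` cancel; the quadratic remainders of the exponentials add up to `36 + 4
-- * 9 + 6 = 78`.
theorem integral_gaussLik_sub_pow_four {a : S → ℝ} {x : S} (ha : 6 * a x ^ 2 ≤ 1) :
    Integrable (fun y => (gaussLik a x y - 1) ^ 4) (gaussianReal 0 1) ∧
    ∫ y, (gaussLik a x y - 1) ^ 4 ∂(gaussianReal 0 1) ≤ 78 * a x ^ 4 := by
  set t := a x with ht
  have hk : ∀ k : ℝ, Integrable (fun y => Real.exp (-(k * t ^ 2 / 2)) * Real.exp ((k * t) * y))
      (gaussianReal 0 1) := fun k => (integrable_exp_gauss _).const_mul _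
  have hv : ∀ k : ℝ, ∫ y, Real.exp (-(k * t ^ 2 / 2)) * Real.exp ((k * t) * y) ∂(gaussianReal 0 1)
      = Real.exp ((k ^ 2 - k) / 2 * t ^ 2) := fun k => by
    rw [integral_const_mul, integral_exp_gauss, ← Real.exp_add]; congr 1; ring
  have hv' : ∀ k c : ℝ, ∫ y, c * (Real.exp (-(k * t ^ 2 / 2)) * Real.exp ((k * t) * y))
      ∂(gaussianReal 0 1) = c * Real.exp ((k ^ 2 - k) / 2 * t ^ 2) := fun k c => by
    rw [integral_const_mul, hv]
  have hpow : ∀ (k : ℕ) (y : ℝ), gaussLik a x y ^ k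
      = Real.exp (-((k : ℝ) * t ^ 2 / 2)) * Real.exp (((k : ℝ) * t) * y) := fun k y => by
    rw [gaussLik, ← Real.exp_nat_mul, ← Real.exp_add]; congr 1; ring
  have hexp : ∀ y, (gaussLik a x y - 1) ^ 4 = gaussLik a x y ^ 4 - 4 * gaussLik a x y ^ 3
      + 6 * gaussLik a x y ^ 2 - 4 * gaussLik a x y ^ 1 + 1 := fun y => by ring
  simp_rw [hexp, hpow]
  have i4 := hk (4 : ℕ)
  have i3 := (hk (3 : ℕ)).const_mul 4
  have i2 := (hk (2 : ℕ)).const_mul 6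
  have i1 := (hk (1 : ℕ)).const_mul 4
  have j3 := i4.sub' i3
  have j2 := j3.fun_add i2
  have j1 := j2.sub' i1
  refine ⟨j1.fun_add (integrable_const 1), ?_⟩
  rw [integral_add j1 (integrable_const 1), integral_sub j2 i1, integral_add j3 i2,
    integral_sub i4 i3, hv, hv', hv', hv']
  norm_num
  have hb : ∀ k : ℝ, 0 ≤ k → k ≤ 6 → |Real.exp (k * t ^ 2) - 1 - k * t ^ 2| ≤ (k * t ^ 2) ^ 2 :=
    fun k h0 h1 => Real.abs_exp_sub_one_sub_id_le (by
      rw [abs_of_nonneg (by positivity)]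
      exact (mul_le_mul_of_nonneg_right h1 (sq_nonneg t)).trans ha)
  have b6 := abs_le.1 (hb 6 (by norm_num) le_rfl)
  have b3 := abs_le.1 (hb 3 (by norm_num) (by norm_num))
  have b1 := abs_le.1 (hb 1 (by norm_num) (by norm_num))
  rw [one_mul] at b1
  nlinarith [b6.2, b3.1, b1.2]

/-- The information carried by a weak Gaussian observation. -/
theorem abs_info_gaussLik_sub_le [Nonempty S] {q a : S → ℝ} (hq : IsPrior q) {r : ℝ}
    (hr : 0 < r) (hr1 : 6 * r ^ 2 ≤ 1) (ha : ∀ x, |a x| ≤ r) :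
    |info q (gaussLik a) (gaussianReal 0 1) - wvar q a / 2| ≤ 41 * r ^ 3 := by
  have hL := isLikelihood_gaussLik a
  have hq0 : ∀ x, 0 ≤ q x := fun x => (hq.pos x).le
  obtain ⟨hZi, hinfo⟩ := info_eq hq hL (fun x y => Real.exp_pos _)
    fun x => (gaussLik_mul_log a x).1
  set Z := evidence q (gaussLik a) with hZ
  have hZpos : ∀ y, 0 < Z y := fun y => (isPrior_posterior (B := gaussLik a) hq fun x => Real.exp_pos _).1
  have hZm : Measurable Z := evidence_measurable hL
  have hZint : Integrable Z (gaussianReal 0 1) := evidence_integrable hL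
  have ha2 : ∀ x, a x ^ 2 ≤ r ^ 2 := fun x => sq_le_sq' (abs_le.1 (ha x)).1 (abs_le.1 (ha x)).2
  have hZsub : ∀ y, Z y - 1 = ∑ x, q x * (gaussLik a x y - 1) := fun y => by
    simp_rw [mul_sub, Finset.sum_sub_distrib, mul_one, hq.sum_eq_one]; rfl
  have h4 := fun x => integral_gaussLik_sub_pow_four (a := a) (x := x) (by linarith [ha2 x])
  have hi4' : Integrable (fun y => ∑ x, q x * (gaussLik a x y - 1) ^ 4) (gaussianReal 0 1) :=
    integrable_finsetSum _ fun x _ => (h4 x).1.const_mul _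
  have hle4 : ∀ y, (Z y - 1) ^ 4 ≤ ∑ x, q x * (gaussLik a x y - 1) ^ 4 := fun y => by
    rw [hZsub]
    have := (Even.convexOn_pow (𝕜 := ℝ) (n := 4) (by decide)).map_sum_le (t := Finset.univ)
      (w := q) (p := fun x => gaussLik a x y - 1) (fun x _ => hq0 x) hq.sum_eq_one
      fun x _ => Set.mem_univ _
    simpa using this
  have hi4 : Integrable (fun y => (Z y - 1) ^ 4) (gaussianReal 0 1) :=
    hi4'.mono' (by fun_prop) (ae_of_all _ fun y => by
      rw [Real.norm_of_nonneg (by positivity)]; exact hle4 y)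
  have hb4 : ∫ y, (Z y - 1) ^ 4 ∂(gaussianReal 0 1) ≤ 78 * r ^ 4 := by
    calc ∫ y, (Z y - 1) ^ 4 ∂(gaussianReal 0 1)
        ≤ ∫ y, ∑ x, q x * (gaussLik a x y - 1) ^ 4 ∂(gaussianReal 0 1) :=
          integral_mono hi4 hi4' hle4
      _ = ∑ x, q x * ∫ y, (gaussLik a x y - 1) ^ 4 ∂(gaussianReal 0 1) := by
          rw [integral_finsetSum _ fun x _ => (h4 x).1.const_mul _]
          simp_rw [integral_const_mul]
      _ ≤ ∑ x, q x * (78 * r ^ 4) := by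
          refine Finset.sum_le_sum fun x _ => mul_le_mul_of_nonneg_left ((h4 x).2.trans ?_) (hq0 x)
          have := mul_le_mul (ha2 x) (ha2 x) (sq_nonneg _) (sq_nonneg _)
          nlinarith
      _ = 78 * r ^ 4 := by rw [← Finset.sum_mul, hq.sum_eq_one, one_mul]
  have hxx : ∀ x x' y, gaussLik a x y * gaussLik a x' y
      = Real.exp (-(a x ^ 2 / 2) - a x' ^ 2 / 2) * Real.exp ((a x + a x') * y) := fun x x' y => by
    simp only [gaussLik]
    rw [← Real.exp_add, ← Real.exp_add]; congr 1; ring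
  have hZ2 : ∀ y, Z y ^ 2 = ∑ x, ∑ x', q x * q x' * (gaussLik a x y * gaussLik a x' y) := fun y => by
    rw [hZ, evidence, sq, Finset.sum_mul_sum]
    exact Finset.sum_congr rfl fun x _ => Finset.sum_congr rfl fun x' _ => by ring
  have hixx : ∀ x x', Integrable (fun y => gaussLik a x y * gaussLik a x' y) (gaussianReal 0 1) :=
    fun x x' => by simp_rw [hxx]; exact (integrable_exp_gauss _).const_mul _
  have hvxx : ∀ x x', ∫ y, gaussLik a x y * gaussLik a x' y ∂(gaussianReal 0 1)
      = Real.exp (a x * a x') := fun x x' => by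
    simp_rw [hxx]
    rw [integral_const_mul, integral_exp_gauss, ← Real.exp_add]; congr 1; ring
  have hiZ2 : Integrable (fun y => Z y ^ 2) (gaussianReal 0 1) := by
    simp_rw [hZ2]
    exact integrable_finsetSum _ fun x _ => integrable_finsetSum _ fun x' _ =>
      (hixx x x').const_mul _
  have hvZ2 : ∫ y, Z y ^ 2 ∂(gaussianReal 0 1)
      = ∑ x, ∑ x', q x * q x' * Real.exp (a x * a x') := by
    simp_rw [hZ2]
    rw [integral_finsetSum _ fun x _ => integrable_finsetSum _ fun x' _ =>
      (hixx x x').const_mul _]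
    refine Finset.sum_congr rfl fun x _ => ?_
    rw [integral_finsetSum _ fun x' _ => (hixx x x').const_mul _]
    exact Finset.sum_congr rfl fun x' _ => by rw [integral_const_mul, hvxx]
  have hsq : ∀ y, (Z y - 1) ^ 2 = Z y ^ 2 - 2 * Z y + 1 := fun y => by ring
  have hi2 : Integrable (fun y => (Z y - 1) ^ 2) (gaussianReal 0 1) := by
    simp_rw [hsq]; exact (hiZ2.sub (hZint.const_mul 2)).add (integrable_const _)
  have hZone : ∫ y, Z y ∂(gaussianReal 0 1) = 1 := integral_evidence hq hL
  -- With two independent replicas this integral is the mean of `exp (a a') - 1`, whose first-order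
  -- term is the squared mean of `a`.
  have hv2 : |∫ y, (Z y - 1) ^ 2 ∂(gaussianReal 0 1) - (∑ x, q x * a x) ^ 2| ≤ r ^ 4 := by
    have e1 : ∫ y, (Z y - 1) ^ 2 ∂(gaussianReal 0 1)
        = ∑ x, ∑ x', q x * q x' * Real.exp (a x * a x') - 1 := by
      simp_rw [hsq]
      have : Integrable (fun y => Z y ^ 2 - 2 * Z y) (gaussianReal 0 1) :=
        hiZ2.sub (hZint.const_mul 2)
      rw [integral_add this (integrable_const _), integral_sub hiZ2 (hZint.const_mul 2),
        integral_const_mul, hZone, hvZ2]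
      simp; ring
    have e2 : ∑ x, ∑ x', q x * q x' * Real.exp (a x * a x') - 1 - (∑ x, q x * a x) ^ 2
        = ∑ x, ∑ x', q x * q x' * (Real.exp (a x * a x') - 1 - a x * a x') := by
      have o : (1 : ℝ) = ∑ x, ∑ x', q x * q x' := by
        rw [← Finset.sum_mul_sum, hq.sum_eq_one, one_mul]
      have o2 : (∑ x, q x * a x) ^ 2 = ∑ x, ∑ x', q x * q x' * (a x * a x') := by
        rw [sq, Finset.sum_mul_sum]
        exact Finset.sum_congr rfl fun x _ => Finset.sum_congr rfl fun x' _ => by ring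
      conv_lhs => rw [o, o2]
      simp_rw [← Finset.sum_sub_distrib]
      exact Finset.sum_congr rfl fun x _ => Finset.sum_congr rfl fun x' _ => by ring
    rw [e1, e2]
    calc |∑ x, ∑ x', q x * q x' * (Real.exp (a x * a x') - 1 - a x * a x')|
        ≤ ∑ x, ∑ x', q x * q x' * r ^ 4 := by
          refine (Finset.abs_sum_le_sum_abs _ _).trans (Finset.sum_le_sum fun x _ =>
            (Finset.abs_sum_le_sum_abs _ _).trans (Finset.sum_le_sum fun x' _ => ?_))
          have hm : (a x * a x') ^ 2 ≤ r ^ 4 := by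
            have := mul_le_mul (ha2 x) (ha2 x') (sq_nonneg _) (sq_nonneg _)
            nlinarith
          have hm1 : |a x * a x'| ≤ 1 := by
            rw [abs_le_one_iff_mul_self_le_one]
            nlinarith
          rw [abs_mul, abs_of_nonneg (mul_nonneg (hq0 x) (hq0 x'))]
          exact mul_le_mul_of_nonneg_left ((Real.abs_exp_sub_one_sub_id_le hm1).trans hm)
            (mul_nonneg (hq0 x) (hq0 x'))
      _ = r ^ 4 := by
          simp_rw [← Finset.sum_mul]
          rw [← Finset.sum_mul_sum, hq.sum_eq_one]; ring
  -- As `Z` has mean one, `Z log Z` may be replaced by `klFun Z`, whose expansion at `1` has no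
  -- linear term.
  have hkl : ∀ y, Z y * Real.log (Z y) = InformationTheory.klFun (Z y) + (Z y - 1) := fun y => by
    rw [InformationTheory.klFun_apply]; ring
  have hikl : Integrable (fun y => InformationTheory.klFun (Z y)) (gaussianReal 0 1) :=
    (hZi.sub (hZint.sub (integrable_const 1))).congr (ae_of_all _ fun y => by
      simp only [Pi.sub_apply, hkl]; ring)
  have hvkl : ∫ y, Z y * Real.log (Z y) ∂(gaussianReal 0 1)
      = ∫ y, InformationTheory.klFun (Z y) ∂(gaussianReal 0 1) := by
    simp_rw [hkl]
    rw [integral_add hikl (hZint.sub' (integrable_const 1)),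
      integral_sub hZint (integrable_const 1), hZone]
    simp
  have hcub : |∫ y, InformationTheory.klFun (Z y) ∂(gaussianReal 0 1)
      - ∫ y, (Z y - 1) ^ 2 / 2 ∂(gaussianReal 0 1)| ≤ 40 * r ^ 3 + r ^ 5 / 2 := by
    rw [← integral_sub hikl (hi2.div_const 2)]
    calc |∫ y, (InformationTheory.klFun (Z y) - (Z y - 1) ^ 2 / 2) ∂(gaussianReal 0 1)|
        ≤ ∫ y, |InformationTheory.klFun (Z y) - (Z y - 1) ^ 2 / 2| ∂(gaussianReal 0 1) :=
          abs_integral_le_integral_abs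
      _ ≤ ∫ y, (r / 2 * (Z y - 1) ^ 2 + 1 / (2 * r) * (Z y - 1) ^ 4) ∂(gaussianReal 0 1) := by
          refine integral_mono (hikl.sub (hi2.div_const 2)).abs
            ((hi2.const_mul _).add (hi4.const_mul _)) fun y => ?_
          refine (abs_klFun_sub_le (hZpos y)).trans ?_
          have h1 : (Z y - 1) ^ 2 = |Z y - 1| ^ 2 := (sq_abs _).symm
          have h2 : (Z y - 1) ^ 4 = |Z y - 1| ^ 4 := by
            rw [← abs_pow, abs_of_nonneg (by positivity)]
          rw [h1, h2]
          set v := |Z y - 1|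
          -- The cubic error is split between the second and fourth moments by AM–GM with weight
          -- `r`, so that both parts are of order `r ^ 3`.
          have : 0 ≤ v ^ 2 * (r - v) ^ 2 / (2 * r) := by positivity
          have e : v ^ 2 * (r - v) ^ 2 / (2 * r)
              = r / 2 * v ^ 2 + 1 / (2 * r) * v ^ 4 - v ^ 3 := by field_simp; ring
          linarith
      _ = r / 2 * ∫ y, (Z y - 1) ^ 2 ∂(gaussianReal 0 1)
          + 1 / (2 * r) * ∫ y, (Z y - 1) ^ 4 ∂(gaussianReal 0 1) := by
          rw [integral_add (hi2.const_mul _) (hi4.const_mul _), integral_const_mul,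
            integral_const_mul]
      _ ≤ r / 2 * (r ^ 2 + r ^ 4) + 1 / (2 * r) * (78 * r ^ 4) := by
          gcongr
          have h1 := (abs_le.1 hv2).2
          have h2 : (∑ x, q x * a x) ^ 2 ≤ r ^ 2 := by
            have := wvar_nonneg q a hq0 hq.sum_eq_one
            rw [wvar] at this
            have h3 : ∑ x, q x * a x ^ 2 ≤ ∑ x, q x * r ^ 2 :=
              Finset.sum_le_sum fun x _ => mul_le_mul_of_nonneg_left (ha2 x) (hq0 x)
            rw [← Finset.sum_mul, hq.sum_eq_one, one_mul] at h3
            linarith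
          linarith
      _ = 39 * r ^ 3 + (r ^ 3 + r ^ 5) / 2 := by field_simp; ring
      _ ≤ 40 * r ^ 3 + r ^ 5 / 2 := by have := pow_pos hr 3; linarith
  rw [hinfo, hvkl]
  simp_rw [(gaussLik_mul_log a _).2]
  rw [integral_div] at hcub
  have e : ∑ x, q x * (a x ^ 2 / 2) = (∑ x, q x * a x ^ 2) / 2 := by
    rw [Finset.sum_div]; exact Finset.sum_congr rfl fun x _ => by ring
  rw [e, wvar]
  have h1 := abs_le.1 hcub
  have h2 := abs_le.1 hv2
  have hr2 : r ≤ 1 / 2 := by nlinarith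
  have h3 : r ^ 4 ≤ r ^ 3 * (1 / 2) := by
    rw [pow_succ r 3]; exact mul_le_mul_of_nonneg_left hr2 (by positivity)
  have h4 : r ^ 5 ≤ r ^ 3 * (1 / 2) := by
    rw [pow_succ r 4]
    calc r ^ 4 * r ≤ r ^ 4 * 1 := mul_le_mul_of_nonneg_left (by linarith) (by positivity)
      _ ≤ _ := by linarith
  rw [abs_le]
  constructor <;> linarith [h1.1, h1.2, h2.1, h2.2]

end GaussianLikelihood

end

end SBM

namespace SBM

noncomputable section

/-! ### Partition functions and Gibbs averages -/

section Gibbs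

variable {S : Type*} [Fintype S]

/-- The partition function with weights `w` and energy `H`. -/
def part (w H : S → ℝ) : ℝ := ∑ x, w x * Real.exp (H x)

/-- The logarithm of the partition function. -/
def logPart (w H : S → ℝ) : ℝ := Real.log (part w H)

/-- The Gibbs average of `f`. -/
def gmean (w H f : S → ℝ) : ℝ := (∑ x, w x * Real.exp (H x) * f x) / part w H

/-- Nonnegative weights that do not all vanish. -/
structure IsWeight (w : S → ℝ) : Prop where
  nonneg : ∀ x, 0 ≤ w x
  exists_pos : ∃ x, 0 < w x

variable {w : S → ℝ}

theorem part_pos (hw : IsWeight w) (H : S → ℝ) : 0 < part w H := by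
  obtain ⟨x, hx⟩ := hw.exists_pos
  exact Finset.sum_pos' (fun y _ => mul_nonneg (hw.nonneg y) (Real.exp_pos _).le)
    ⟨x, Finset.mem_univ x, mul_pos hx (Real.exp_pos _)⟩

theorem gmean_mono (hw : IsWeight w) (H : S → ℝ) {f g : S → ℝ}
    (h : ∀ x, 0 < w x → f x ≤ g x) : gmean w H f ≤ gmean w H g := by
  refine div_le_div_of_nonneg_right (Finset.sum_le_sum fun x _ => ?_) (part_pos hw H).le
  rcases (hw.nonneg x).eq_or_lt with h0 | h0
  · simp [← h0]
  · exact mul_le_mul_of_nonneg_left (h x h0) (by positivity)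

theorem gmean_const (hw : IsWeight w) (H : S → ℝ) (c : ℝ) : gmean w H (fun _ => c) = c := by
  rw [gmean, ← Finset.sum_mul, ← part, mul_div_cancel_left₀ _ (part_pos hw H).ne']

theorem gmean_add (w H f g : S → ℝ) :
    gmean w H (fun x => f x + g x) = gmean w H f + gmean w H g := by
  simp only [gmean, mul_add, Finset.sum_add_distrib, add_div]

theorem gmean_sub (w H f g : S → ℝ) :
    gmean w H (fun x => f x - g x) = gmean w H f - gmean w H g := by
  simp only [gmean, mul_sub, Finset.sum_sub_distrib, sub_div]

theorem gmean_const_mul (w H : S → ℝ) (c : ℝ) (f : S → ℝ) :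
    gmean w H (fun x => c * f x) = c * gmean w H f := by
  simp only [gmean, mul_left_comm _ c, ← Finset.mul_sum, mul_div_assoc]

theorem gmean_sum {κ : Type*} (s : Finset κ) (w H : S → ℝ) (f : κ → S → ℝ) :
    gmean w H (fun x => ∑ k ∈ s, f k x) = ∑ k ∈ s, gmean w H (f k) := by
  simp only [gmean, Finset.mul_sum]
  rw [Finset.sum_comm, Finset.sum_div]

theorem abs_gmean_le (hw : IsWeight w) (H : S → ℝ) {f : S → ℝ} {K : ℝ} (h : ∀ x, |f x| ≤ K) :
    |gmean w H f| ≤ K := by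
  rw [abs_le]
  constructor
  · rw [← gmean_const hw H (-K)]
    exact gmean_mono hw H fun x _ => (abs_le.1 (h x)).1
  · rw [← gmean_const hw H K]
    exact gmean_mono hw H fun x _ => (abs_le.1 (h x)).2

theorem logPart_le_add (hw : IsWeight w) {H H' : S → ℝ} {c : ℝ} (h : ∀ x, H x ≤ H' x + c) :
    logPart w H ≤ logPart w H' + c := by
  rw [logPart, logPart, ← Real.log_exp c, ← Real.log_mul (part_pos hw H').ne' (Real.exp_pos c).ne']
  refine Real.log_le_log (part_pos hw H) ?_
  rw [part, part, Finset.sum_mul]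
  refine Finset.sum_le_sum fun x _ => ?_
  rw [mul_assoc, ← Real.exp_add]
  exact mul_le_mul_of_nonneg_left (Real.exp_le_exp.2 (by simpa using h x)) (hw.nonneg x)

theorem abs_logPart_sub_le (hw : IsWeight w) {H H' : S → ℝ} {c : ℝ} (h : ∀ x, |H x - H' x| ≤ c) :
    |logPart w H - logPart w H'| ≤ c := by
  rw [abs_le]
  have h1 := logPart_le_add hw (H := H) (H' := H') (c := c) fun x => by
    linarith [(abs_le.1 (h x)).2]
  have h2 := logPart_le_add hw (H := H') (H' := H) (c := c) fun x => by
    linarith [(abs_le.1 (h x)).1]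
  constructor <;> linarith

theorem hasDerivAt_sum_exp {H : ℝ → S → ℝ} {H' f : S → ℝ} {t : ℝ}
    (h : ∀ x, HasDerivAt (fun t => H t x) (H' x) t) :
    HasDerivAt (fun t => ∑ x, w x * Real.exp (H t x) * f x)
      (∑ x, w x * Real.exp (H t x) * (f x * H' x)) t := by
  refine (HasDerivAt.fun_sum fun x _ => (((h x).exp.const_mul (w x)).mul_const (f x))).congr_deriv
    (Finset.sum_congr rfl fun x _ => by ring)

theorem hasDerivAt_part {H : ℝ → S → ℝ} {H' : S → ℝ} {t : ℝ}
    (h : ∀ x, HasDerivAt (fun t => H t x) (H' x) t) :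
    HasDerivAt (fun t => part w (H t)) (∑ x, w x * Real.exp (H t x) * H' x) t := by
  simpa [part] using! hasDerivAt_sum_exp (w := w) (f := fun _ => 1) h

theorem hasDerivAt_logPart (hw : IsWeight w) {H : ℝ → S → ℝ} {H' : S → ℝ} {t : ℝ}
    (h : ∀ x, HasDerivAt (fun t => H t x) (H' x) t) :
    HasDerivAt (fun t => logPart w (H t)) (gmean w (H t) H') t :=
  (hasDerivAt_part h).log (part_pos hw _).ne'

theorem hasDerivAt_gmean (hw : IsWeight w) {H : ℝ → S → ℝ} {H' f : S → ℝ} {t : ℝ}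
    (h : ∀ x, HasDerivAt (fun t => H t x) (H' x) t) :
    HasDerivAt (fun t => gmean w (H t) f)
      (gmean w (H t) (fun x => f x * H' x) - gmean w (H t) f * gmean w (H t) H') t := by
  refine ((hasDerivAt_sum_exp h).div (hasDerivAt_part h) (part_pos hw _).ne').congr_deriv ?_
  have := (part_pos hw (H t)).ne'
  simp only [gmean]
  field_simp

end Gibbs

/-! ### Free energy of a vector Gaussian channel and its derivative -/

section Interpolation

variable {S ι : Type*} [Fintype S] [Fintype ι]

/-- The energy of the configuration `x` in a vector Gaussian channel with signals `a x`, noise `z`,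
planted signal `s` and amplitudes `α`. -/
def ham (a : S → ι → ℝ) (s α z : ι → ℝ) (x : S) : ℝ :=
  ∑ e, (α e * a x e * z e + α e ^ 2 * (a x e * s e - a x e ^ 2 / 2))

/-- The average free energy of a vector Gaussian channel. -/
def freeEnergy (w : S → ℝ) (a : S → ι → ℝ) (s α : ι → ℝ) : ℝ :=
  ∫ z, logPart w (ham a s α z) ∂(stdGauss ι)

variable {w : S → ℝ} {a : S → ι → ℝ} {s : ι → ℝ}

omit [Fintype S] in
theorem ham_measurable (a : S → ι → ℝ) (s α : ι → ℝ) (x : S) :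
    Measurable fun z => ham a s α z x := by
  unfold ham; fun_prop

theorem part_measurable (w : S → ℝ) (a : S → ι → ℝ) (s α : ι → ℝ) :
    Measurable fun z => part w (ham a s α z) :=
  Finset.measurable_sum _ fun x _ =>
    ((Real.measurable_exp.comp (ham_measurable a s α x)).const_mul _)

theorem logPart_measurable (w : S → ℝ) (a : S → ι → ℝ) (s α : ι → ℝ) :
    Measurable fun z => logPart w (ham a s α z) :=
  Real.measurable_log.comp (part_measurable w a s α)

theorem gmean_measurable (w : S → ℝ) (a : S → ι → ℝ) (s α : ι → ℝ) (f : S → ℝ) :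
    Measurable fun z => gmean w (ham a s α z) f :=
  (Finset.measurable_sum _ fun x _ =>
    ((Real.measurable_exp.comp (ham_measurable a s α x)).const_mul _).mul_const _).div
    (part_measurable w a s α)

theorem abs_logPart_ham_sub_le (hw : IsWeight w) {A : ι → ℝ} (hA : ∀ x e, |a x e| ≤ A e)
    (α z z' : ι → ℝ) :
    |logPart w (ham a s α z) - logPart w (ham a s α z')|
      ≤ ∑ e, |α e| * A e * |z e - z' e| := by
  refine abs_logPart_sub_le hw fun x => ?_
  rw [ham, ham, ← Finset.sum_sub_distrib]
  refine (Finset.abs_sum_le_sum_abs _ _).trans (Finset.sum_le_sum fun e _ => ?_)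
  have : α e * a x e * z e + α e ^ 2 * (a x e * s e - a x e ^ 2 / 2)
      - (α e * a x e * z' e + α e ^ 2 * (a x e * s e - a x e ^ 2 / 2))
      = α e * a x e * (z e - z' e) := by ring
  rw [this, abs_mul, abs_mul]
  have := hA x e
  gcongr

theorem integrable_logPart_ham (hw : IsWeight w) (a : S → ι → ℝ) (s α : ι → ℝ) :
    Integrable (fun z => logPart w (ham a s α z)) (stdGauss ι) := by
  refine (memLp_of_lipschitz (c := fun e => |α e| * ∑ x, |a x e|) (fun z z' => ?_)
    (logPart_measurable w a s α)).integrable (by norm_num)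
  exact abs_logPart_ham_sub_le hw (A := fun e => ∑ x, |a x e|)
    (fun x e => Finset.single_le_sum (f := fun x => |a x e|) (fun x _ => abs_nonneg _)
      (Finset.mem_univ x)) α z z'

theorem integrable_gmean (hw : IsWeight w) (a : S → ι → ℝ) (s α : ι → ℝ) (f : S → ℝ) :
    Integrable (fun z => gmean w (ham a s α z) f) (stdGauss ι) :=
  Integrable.of_bound (gmean_measurable w a s α f).aestronglyMeasurable (∑ x, |f x|)
    (ae_of_all _ fun _ => abs_gmean_le hw _ fun x =>
      Finset.single_le_sum (f := fun x => |f x|) (fun _ _ => abs_nonneg _) (Finset.mem_univ x))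

omit [Fintype S] in
theorem ham_update [DecidableEq ι] (a : S → ι → ℝ) (s α z : ι → ℝ) (e : ι) (y : ℝ) (x : S) :
    ham a s α (Function.update z e y) x = ham a s α z x + α e * a x e * (y - z e) := by
  rw [← sub_eq_iff_eq_add', ham, ham, ← Finset.sum_sub_distrib, Finset.sum_eq_single e]
  · simp; ring
  · intro i _ hi
    simp [Function.update_of_ne hi]
  · simp

/-- Gaussian integration by parts: the derivative of a Gibbs average of `a e` in `z e` is `α e`
times the Gibbs variance. -/
theorem integral_mul_gmean [DecidableEq ι] (hw : IsWeight w) (a : S → ι → ℝ) (s α : ι → ℝ)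
    (e : ι) :
    ∫ z, z e * gmean w (ham a s α z) (fun x => a x e) ∂(stdGauss ι)
      = α e * ∫ z, (gmean w (ham a s α z) (fun x => a x e ^ 2)
          - gmean w (ham a s α z) (fun x => a x e) ^ 2) ∂(stdGauss ι) := by
  obtain ⟨K, hK⟩ : ∃ K, ∀ x, |a x e| ≤ K := ⟨∑ x, |a x e|, fun x =>
    Finset.single_le_sum (f := fun x => |a x e|) (fun x _ => abs_nonneg _) (Finset.mem_univ x)⟩
  have hK2 : ∀ x, |a x e ^ 2| ≤ K ^ 2 := fun x => by
    rw [abs_pow]; exact pow_le_pow_left₀ (abs_nonneg _) (hK x) 2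
  rw [← integral_const_mul]
  refine integral_mul_stdGauss e (K := max K (|α e| * (K ^ 2 + K ^ 2))) (fun z y => ?_)
    (gmean_measurable w a s α _) (((gmean_measurable w a s α _).sub
      ((gmean_measurable w a s α _).pow_const 2)).const_mul _)
    (fun z => (abs_gmean_le hw _ hK).trans (le_max_left _ _)) (fun z => ?_)
  · have h := hasDerivAt_gmean hw (H := fun y => ham a s α (Function.update z e y))
      (H' := fun x => α e * a x e) (f := fun x => a x e) (t := y) (fun x => by
        simp_rw [ham_update]
        have := (((hasDerivAt_id y).sub_const (z e)).const_mul (α e * a x e)).const_add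
          (ham a s α z x)
        simpa using this)
    refine h.congr_deriv ?_
    have : (fun x => a x e * (α e * a x e)) = fun x => α e * a x e ^ 2 := by ext x; ring
    rw [this, gmean_const_mul, gmean_const_mul]
    ring
  · refine le_trans ?_ (le_max_right _ _)
    rw [abs_mul]
    refine mul_le_mul_of_nonneg_left ((abs_sub _ _).trans (add_le_add
      (abs_gmean_le hw _ hK2) ?_)) (abs_nonneg _)
    rw [abs_pow]
    exact pow_le_pow_left₀ (abs_nonneg _) (abs_gmean_le hw _ hK) 2

/-- The derivative of the free energy along a path of amplitudes. -/
theorem hasDerivAt_freeEnergy (hw : IsWeight w) (a : S → ι → ℝ) (s : ι → ℝ) {α α' : ι → ℝ → ℝ}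
    (hα : ∀ e t, HasDerivAt (α e) (α' e t) t) (hα1 : ∀ e t, |α e t| ≤ 1)
    (hα1' : ∀ e t, |α' e t| ≤ 1) (t : ℝ) :
    HasDerivAt (fun t => freeEnergy w a s fun e => α e t)
      (∑ e, α e t * α' e t * ∫ z, (2 * s e * gmean w (ham a s (fun e => α e t) z) (fun x => a x e)
        - gmean w (ham a s (fun e => α e t) z) (fun x => a x e) ^ 2) ∂(stdGauss ι)) t := by
  classical
  set D : ℝ → (ι → ℝ) → S → ℝ := fun t z x =>
    ∑ e, (α' e t * a x e * z e + 2 * α e t * α' e t * (a x e * s e - a x e ^ 2 / 2)) with hD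
  have hderiv : ∀ z t, HasDerivAt (fun t => logPart w (ham a s (fun e => α e t) z))
      (gmean w (ham a s (fun e => α e t) z) (D t z)) t := by
    intro z t
    refine hasDerivAt_logPart hw (H := fun t => ham a s (fun e => α e t) z) fun x => ?_
    simp only [ham, hD]
    refine HasDerivAt.fun_sum fun e _ => ?_
    have h1 := ((hα e t).mul_const (a x e)).mul_const (z e)
    have h2 := ((hα e t).pow 2).mul_const (a x e * s e - a x e ^ 2 / 2)
    refine (h1.add h2).congr_deriv ?_
    simp
  set b : ι → ℝ := fun e => ∑ x, |a x e| with hb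
  set c : ι → ℝ := fun e => ∑ x, |a x e * s e - a x e ^ 2 / 2| with hc
  have hbb : ∀ x e, |a x e| ≤ b e := fun x e =>
    Finset.single_le_sum (f := fun x => |a x e|) (fun x _ => abs_nonneg _) (Finset.mem_univ x)
  have hcc : ∀ x e, |a x e * s e - a x e ^ 2 / 2| ≤ c e := fun x e =>
    Finset.single_le_sum (f := fun x => |a x e * s e - a x e ^ 2 / 2|) (fun x _ => abs_nonneg _)
      (Finset.mem_univ x)
  have hbound : ∀ z t, |gmean w (ham a s (fun e => α e t) z) (D t z)|
      ≤ ∑ e, (b e * |z e| + 2 * c e) := by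
    intro z t
    refine abs_gmean_le hw _ fun x => ?_
    refine (Finset.abs_sum_le_sum_abs _ _).trans (Finset.sum_le_sum fun e _ =>
      (abs_add_le _ _).trans (add_le_add ?_ ?_))
    · rw [abs_mul, abs_mul]
      calc |α' e t| * |a x e| * |z e| ≤ 1 * b e * |z e| := by
            gcongr
            · exact hα1' e t
            · exact hbb x e
        _ = _ := by ring
    · rw [abs_mul, abs_mul, abs_mul, abs_two]
      calc 2 * |α e t| * |α' e t| * |a x e * s e - a x e ^ 2 / 2| ≤ 2 * 1 * 1 * c e := by
            gcongr
            · exact hα1 e t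
            · exact hα1' e t
            · exact hcc x e
        _ = _ := by ring
  have hdom : Integrable (fun z : ι → ℝ => ∑ e, (b e * |z e| + 2 * c e)) (stdGauss ι) :=
    integrable_finsetSum _ fun e _ =>
      ((integrable_abs_eval_stdGauss e).const_mul _).add (integrable_const _)
  have hDm : Measurable fun z => gmean w (ham a s (fun e => α e t) z) (D t z) := by
    refine (Finset.measurable_sum _ fun x _ => ?_).div (part_measurable w a s _)
    refine ((Real.measurable_exp.comp (ham_measurable a s _ x)).const_mul _).mul ?_
    simp only [hD]
    fun_prop
  have key := (hasDerivAt_integral_of_dominated_loc_of_deriv_le (μ := stdGauss ι)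
    (F := fun t z => logPart w (ham a s (fun e => α e t) z))
    (F' := fun t z => gmean w (ham a s (fun e => α e t) z) (D t z)) (x₀ := t)
    (s := Set.univ) (bound := fun z => ∑ e, (b e * |z e| + 2 * c e)) univ_mem
    (Eventually.of_forall fun t => (logPart_measurable w a s _).aestronglyMeasurable)
    (integrable_logPart_ham hw a s _) hDm.aestronglyMeasurable
    (ae_of_all _ fun z t _ => hbound z t) hdom (ae_of_all _ fun z t _ => hderiv z t)).2
  refine key.congr_deriv ?_
  set β : ι → ℝ := fun e => α e t with hβ
  have hsplit : ∀ z, gmean w (ham a s β z) (D t z)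
      = ∑ e, (α' e t * (z e * gmean w (ham a s β z) (fun x => a x e))
        + 2 * β e * α' e t * (s e * gmean w (ham a s β z) (fun x => a x e)
          - gmean w (ham a s β z) (fun x => a x e ^ 2) / 2)) := by
    intro z
    simp only [hD]
    rw [gmean_sum]
    refine Finset.sum_congr rfl fun e _ => ?_
    have : (fun x => α' e t * a x e * z e + 2 * α e t * α' e t * (a x e * s e - a x e ^ 2 / 2))
        = fun x => (α' e t * z e + 2 * α e t * α' e t * s e) * a x e
          - (α e t * α' e t) * a x e ^ 2 := by ext x; ring
    rw [this, gmean_sub, gmean_const_mul, gmean_const_mul]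
    ring
  have i1 : ∀ e, Integrable (fun z => z e * gmean w (ham a s β z) (fun x => a x e))
      (stdGauss ι) := fun e => by
    have h : Integrable (fun z : ι → ℝ => z e) (stdGauss ι) :=
      (memLp_eval_stdGauss e).integrable (by norm_num)
    exact (h.bdd_mul (gmean_measurable w a s β (fun x => a x e)).aestronglyMeasurable
      (c := b e) (ae_of_all _ fun z => abs_gmean_le hw _ fun x => hbb x e)).congr
      (ae_of_all _ fun z => mul_comm _ _)
  have i2 : ∀ e, Integrable (fun z => gmean w (ham a s β z) (fun x => a x e)) (stdGauss ι) :=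
    fun e => integrable_gmean hw a s β _
  have i3 : ∀ e, Integrable (fun z => gmean w (ham a s β z) (fun x => a x e ^ 2)) (stdGauss ι) :=
    fun e => integrable_gmean hw a s β _
  have i4 : ∀ e, Integrable (fun z => gmean w (ham a s β z) (fun x => a x e) ^ 2)
      (stdGauss ι) := fun e =>
    Integrable.of_bound ((gmean_measurable w a s β _).pow_const 2).aestronglyMeasurable (b e ^ 2)
      (ae_of_all _ fun z => by
        rw [norm_pow]
        exact pow_le_pow_left₀ (norm_nonneg _) (abs_gmean_le hw _ fun x => hbb x e) 2)
  simp_rw [hsplit]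
  have i5 : ∀ e, Integrable (fun z => s e * gmean w (ham a s β z) (fun x => a x e)
      - gmean w (ham a s β z) (fun x => a x e ^ 2) / 2) (stdGauss ι) := fun e =>
    ((i2 e).const_mul _).sub' ((i3 e).div_const 2)
  rw [integral_finsetSum _ fun e _ => ((i1 e).const_mul _).fun_add ((i5 e).const_mul _)]
  refine Finset.sum_congr rfl fun e _ => ?_
  -- Integration by parts replaces the noise by a Gibbs variance, whose second moment cancels the
  -- quadratic term of the energy. Twice the planted value times the mean, minus the squared mean,
  -- is left.
  rw [integral_add ((i1 e).const_mul _) ((i5 e).const_mul _), integral_const_mul,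
    integral_const_mul, integral_mul_gmean hw, integral_sub (i3 e) (i4 e),
    integral_sub ((i2 e).const_mul _) ((i3 e).div_const 2), integral_const_mul, integral_div,
    integral_sub ((i2 e).const_mul _) (i4 e), integral_const_mul]
  simp only [hβ]
  ring

end Interpolation

end

end SBM

namespace SBM

noncomputable section

/-! ### Sums over pairs -/

section Pairs

theorem sum_pairs {n : ℕ} (g : Fin n → Fin n → ℝ) (hg : ∀ i j, g i j = g j i) :
    ∑ e : Pairs n, g e.1.1 e.1.2 = (∑ i, ∑ j, g i j - ∑ i, g i i) / 2 := by
  have h1 : ∑ e : Pairs n, g e.1.1 e.1.2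
      = ∑ e ∈ (Finset.univ : Finset (Fin n × Fin n)).filter (fun e => e.1 < e.2), g e.1 e.2 := by
    rw [← Finset.sum_subtype_eq_sum_filter]
    simp
  have h2 : ∑ e ∈ (Finset.univ : Finset (Fin n × Fin n)).filter (fun e => e.2 < e.1), g e.1 e.2
      = ∑ e ∈ (Finset.univ : Finset (Fin n × Fin n)).filter (fun e => e.1 < e.2), g e.1 e.2 := by
    refine Finset.sum_nbij' Prod.swap Prod.swap ?_ ?_ ?_ ?_ ?_
    · simp
    · simp
    · simp
    · simp
    · intro e _; exact hg _ _
  have h3 : ∑ e ∈ (Finset.univ : Finset (Fin n × Fin n)).filter (fun e => e.1 = e.2), g e.1 e.2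
      = ∑ i, g i i := by
    refine Finset.sum_nbij' Prod.fst (fun i => (i, i)) ?_ ?_ ?_ ?_ ?_
    · simp
    · simp
    · rintro ⟨i, j⟩ h; simp at h; simp [h]
    · simp
    · rintro ⟨i, j⟩ h; simp at h; simp [h]
  have h4 : ∑ i, ∑ j, g i j = ∑ e : Fin n × Fin n, g e.1 e.2 := by
    rw [Fintype.sum_prod_type]
  have h5 : ∀ e : Fin n × Fin n, g e.1 e.2 = (if e.1 < e.2 then g e.1 e.2 else 0)
      + (if e.2 < e.1 then g e.1 e.2 else 0) + (if e.1 = e.2 then g e.1 e.2 else 0) := by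
    rintro ⟨i, j⟩
    rcases lt_trichotomy i j with h | h | h
    · simp [h, h.not_gt, h.ne]
    · simp [h]
    · simp [h, h.not_gt, h.ne']
  rw [h4, Finset.sum_congr rfl fun e _ => h5 e, Finset.sum_add_distrib, Finset.sum_add_distrib,
    ← Finset.sum_filter, ← Finset.sum_filter, ← Finset.sum_filter, h2, h3, h1]
  ring

theorem card_pairs (n : ℕ) : (Fintype.card (Pairs n) : ℝ) = ((n : ℝ) ^ 2 - n) / 2 := by
  have := sum_pairs (n := n) (fun _ _ => 1) fun _ _ => rfl
  simp only [Finset.sum_const, Finset.card_univ, Fintype.card_fin, nsmul_eq_mul, mul_one] at this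
  rw [this]; ring

end Pairs

/-! ### Independent labels -/

section ProductPrior

variable {A : Type*} [Fintype A]

/-- The law of `n` i.i.d. labels with weights `P`. -/
def prodPrior (P : A → ℝ) (n : ℕ) (x : Fin n → A) : ℝ := ∏ i, P (x i)

theorem sum_prod_pi {n : ℕ} (F : Fin n → A → ℝ) :
    ∑ x : Fin n → A, ∏ i, F i (x i) = ∏ i, ∑ b, F i b := by
  classical
  rw [Finset.prod_univ_sum, Fintype.piFinset_univ]

theorem isPrior_prodPrior {P : A → ℝ} (hP : IsPrior P) (n : ℕ) : IsPrior (prodPrior P n) := by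
  refine ⟨fun x => Finset.prod_pos fun i _ => hP.pos _, ?_⟩
  simp only [prodPrior]
  rw [sum_prod_pi]
  simp [hP.sum_eq_one]

theorem sum_prodPrior_mul {P : A → ℝ} (hP : IsPrior P) {n : ℕ} (i : Fin n) (f : A → ℝ) :
    ∑ x, prodPrior P n x * f (x i) = ∑ b, P b * f b := by
  have h : ∀ x, prodPrior P n x * f (x i)
      = ∏ j, (P (x j) * if j = i then f (x j) else 1) := fun x => by
    rw [Finset.prod_mul_distrib, prodPrior]
    simp
  simp_rw [h]
  rw [sum_prod_pi (fun j b => P b * if j = i then f b else 1), Finset.prod_eq_single i]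
  · simp
  · intro j _ hj; simp [hj, hP.sum_eq_one]
  · simp

theorem sum_prodPrior_mul_mul {P : A → ℝ} (hP : IsPrior P) {n : ℕ} {i j : Fin n} (hij : i ≠ j)
    (f g : A → ℝ) :
    ∑ x, prodPrior P n x * (f (x i) * g (x j)) = (∑ b, P b * f b) * ∑ b, P b * g b := by
  have h : ∀ x, prodPrior P n x * (f (x i) * g (x j))
      = ∏ k, (P (x k) * ((if k = i then f (x k) else 1) * if k = j then g (x k) else 1)) :=
    fun x => by
      rw [Finset.prod_mul_distrib, Finset.prod_mul_distrib, prodPrior]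
      simp
  simp_rw [h]
  rw [sum_prod_pi (fun k b => P b * ((if k = i then f b else 1) * if k = j then g b else 1)),
    Finset.prod_eq_mul i j hij]
  · simp [hij, hij.symm]
  · intro k _ hk; simp [hk.1, hk.2, hP.sum_eq_one]
  · simp
  · simp

/-- Cauchy–Schwarz, then independence: centred summands have no cross terms. -/
theorem sum_prodPrior_abs_sum_le {P : A → ℝ} (hP : IsPrior P) (n : ℕ) {f : A → ℝ}
    (hf : ∑ b, P b * f b = 0) :
    ∑ x, prodPrior P n x * |∑ i, f (x i)| ≤ √(n * ∑ b, P b * f b ^ 2) := by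
  have hQ := isPrior_prodPrior hP n
  refine Real.le_sqrt_of_sq_le ?_
  have h1 := wvar_nonneg (prodPrior P n) (fun x => |∑ i, f (x i)|) (fun x => (hQ.pos x).le)
    hQ.sum_eq_one
  rw [wvar, sub_nonneg] at h1
  refine h1.trans (le_of_eq ?_)
  have h2 : ∀ x, prodPrior P n x * |∑ i, f (x i)| ^ 2
      = ∑ i, ∑ j, prodPrior P n x * (f (x i) * f (x j)) := fun x => by
    rw [sq_abs, sq, Finset.sum_mul_sum, Finset.mul_sum]
    exact Finset.sum_congr rfl fun i _ => by rw [Finset.mul_sum]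
  simp_rw [h2]
  rw [Finset.sum_comm]
  have h3 : ∀ i : Fin n, ∑ x, ∑ j, prodPrior P n x * (f (x i) * f (x j)) = ∑ b, P b * f b ^ 2 := by
    intro i
    rw [Finset.sum_comm, Finset.sum_eq_single i]
    · rw [← sum_prodPrior_mul hP i (fun b => f b ^ 2)]
      exact Finset.sum_congr rfl fun x _ => by rw [sq]
    · intro j _ hj
      rw [sum_prodPrior_mul_mul hP hj.symm, hf, zero_mul]
    · simp
  simp_rw [h3]
  simp

end ProductPrior

/-! ### The Nishimori identity -/

section Nishimori

variable {S ι : Type*} [Fintype S] [Fintype ι]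

theorem gmean_gmean_comm (w H : S → ℝ) (f : S → S → ℝ) :
    gmean w H (fun x => gmean w H fun x' => f x x')
      = gmean w H (fun x' => gmean w H fun x => f x x') := by
  simp only [gmean, mul_div_assoc', ← Finset.sum_div]
  congr 2
  simp only [Finset.mul_sum]
  rw [Finset.sum_comm]
  exact Finset.sum_congr rfl fun x _ => Finset.sum_congr rfl fun x' _ => by ring

theorem gmean_mul_gmean (w H f g : S → ℝ) :
    gmean w H f * gmean w H g = gmean w H (fun x => gmean w H fun x' => f x * g x') := by
  simp_rw [gmean_const_mul, mul_comm (f _) (gmean w H g)]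
  rw [gmean_const_mul, mul_comm]

theorem IsPrior.isWeight [Nonempty S] {P : S → ℝ} (hP : IsPrior P) : IsWeight P :=
  ⟨fun x => (hP.pos x).le, ⟨Classical.arbitrary S, hP.pos _⟩⟩

omit [Fintype S] in
-- Up to a shift of the noise the energy depends on the planted configuration only through the
-- observation.
theorem ham_planted (a : S → ι → ℝ) (α : ι → ℝ) (x y : S) (z : ι → ℝ) :
    ham a (a y) α z x = ham a 0 α (fun e => z e + α e * a y e) x := by
  refine Finset.sum_congr rfl fun e _ => ?_
  simp; ring

omit [Fintype S] in
theorem ham_eq (a : S → ι → ℝ) (α : ι → ℝ) (x : S) (z : ι → ℝ) :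
    ham a 0 α z x = ∑ e, ((α e * a x e) * z e - (α e * a x e) ^ 2 / 2) := by
  refine Finset.sum_congr rfl fun e _ => ?_
  simp; ring

/-- Averages over the planted signal are averages over the density of the observation. -/
theorem sum_integral_planted {P : S → ℝ} (hw : IsWeight P) (a : S → ι → ℝ) (α : ι → ℝ)
    {F : S → (ι → ℝ) → ℝ} (hF : ∀ x, Measurable (F x))
    (hi : ∀ x, Integrable (fun z => F x fun e => z e + α e * a x e) (stdGauss ι)) :
    ∑ x, P x * ∫ z, F x (fun e => z e + α e * a x e) ∂(stdGauss ι)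
      = ∫ z, part P (ham a 0 α z) * gmean P (ham a 0 α z) (fun x => F x z) ∂(stdGauss ι) := by
  have hi' : ∀ x, Integrable (fun z => Real.exp (ham a 0 α z x) * F x z) (stdGauss ι) := by
    intro x
    simp_rw [ham_eq]
    exact (integrable_stdGauss_add_iff _ (hF x)).1 (hi x)
  have h1 : ∀ z, part P (ham a 0 α z) * gmean P (ham a 0 α z) (fun x => F x z)
      = ∑ x, P x * (Real.exp (ham a 0 α z x) * F x z) := by
    intro z
    simp_rw [← mul_assoc]
    rw [gmean, mul_div_cancel₀ _ (part_pos hw _).ne']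
  simp_rw [h1]
  rw [integral_finsetSum _ fun x _ => (hi' x).const_mul _]
  refine Finset.sum_congr rfl fun x _ => ?_
  rw [integral_const_mul, integral_stdGauss_add _ (hF x)]
  simp_rw [ham_eq]

/-- The Nishimori identity. -/
theorem nishimori [Nonempty S] {P : S → ℝ} (hP : IsPrior P) (a : S → ι → ℝ) (α : ι → ℝ)
    (f : S → S → ℝ) :
    ∑ y, P y * ∫ z, gmean P (ham a (a y) α z) (fun x => f x y) ∂(stdGauss ι)
      = ∑ y, P y * ∫ z, gmean P (ham a (a y) α z)
          (fun x => gmean P (ham a (a y) α z) fun x' => f x x') ∂(stdGauss ι) := by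
  have hw := hP.isWeight
  have hm : ∀ x : S, ∀ z, ham a (a x) α z = ham a 0 α fun e => z e + α e * a x e := fun x z => by
    ext y; exact ham_planted a α y x z
  have hb1 : ∀ y z, |gmean P (ham a 0 α z) (fun x => f x y)| ≤ ∑ x, |f x y| := fun y z =>
    abs_gmean_le hw _ fun x =>
      Finset.single_le_sum (f := fun x => |f x y|) (fun _ _ => abs_nonneg _) (Finset.mem_univ x)
  have hmeas2 : Measurable fun z => gmean P (ham a 0 α z)
      (fun x => gmean P (ham a 0 α z) fun x' => f x x') := by
    refine (Finset.measurable_sum _ fun x _ => ?_).div (part_measurable P a 0 α)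
    exact ((Real.measurable_exp.comp (ham_measurable a 0 α x)).const_mul _).mul
      (gmean_measurable P a 0 α _)
  have hb2 : ∀ z, |gmean P (ham a 0 α z) (fun x => gmean P (ham a 0 α z) fun x' => f x x')|
      ≤ ∑ x, ∑ x', |f x x'| := fun z => by
    refine abs_gmean_le hw _ fun x => (abs_gmean_le hw _ (K := ∑ x', |f x x'|) fun x' => ?_).trans
      ?_
    · exact Finset.single_le_sum (f := fun x' => |f x x'|) (fun _ _ => abs_nonneg _)
        (Finset.mem_univ x')
    · exact Finset.single_le_sum (f := fun x => ∑ x', |f x x'|)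
        (fun _ _ => Finset.sum_nonneg fun _ _ => abs_nonneg _) (Finset.mem_univ x)
  have hshift : ∀ x : S, Measurable fun (z : ι → ℝ) e => z e + α e * a x e := fun x => by fun_prop
  -- In terms of the observation, averaging over the planted configuration amounts to weighting by
  -- the evidence and sampling it from the posterior. It is then exchangeable with a replica.
  simp_rw [hm]
  rw [sum_integral_planted hw a α (F := fun y z => gmean P (ham a 0 α z) fun x => f x y)
      (fun y => gmean_measurable P a 0 α _) (fun y => Integrable.of_bound
        ((gmean_measurable P a 0 α _).comp (hshift y)).aestronglyMeasurable _
        (ae_of_all _ fun z => hb1 y _)),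
    sum_integral_planted hw a α (F := fun _ z => gmean P (ham a 0 α z)
        (fun x => gmean P (ham a 0 α z) fun x' => f x x'))
      (fun y => hmeas2) (fun y => Integrable.of_bound
        (hmeas2.comp (hshift y)).aestronglyMeasurable _ (ae_of_all _ fun z => hb2 _))]
  simp_rw [gmean_const hw]
  refine integral_congr_ae (ae_of_all _ fun z => ?_)
  simp only
  rw [gmean_gmean_comm]

end Nishimori

/-! ### Derivative of the interpolation in terms of overlaps -/

section Overlap

variable {A : Type*} [Fintype A] {n : ℕ}

/-- The (unnormalized) overlap of two configurations. -/
def overlap (φ : A → ℝ) (x y : Fin n → A) : ℝ := ∑ i, φ (x i) * φ (y i)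

/-- The signal of the rank-one channel. -/
def pairSignal (φ : A → ℝ) (c : ℝ) (x : Fin n → A) (e : Pairs n) : ℝ :=
  c * φ (x e.1.1) * φ (x e.1.2)

/-- The signal of the rank-one channel together with that of scalar channels on the sites. -/
def fullSignal (φ : A → ℝ) (c r : ℝ) (x : Fin n → A) : Pairs n ⊕ Fin n → ℝ :=
  Sum.elim (pairSignal φ c x) fun i => r * φ (x i)

/-- The amplitudes of the interpolation. -/
def amp (n : ℕ) (e : Pairs n ⊕ Fin n) (t : ℝ) : ℝ :=
  Sum.elim (fun _ => Real.sin t) (fun _ => Real.cos t) e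

/-- The integrand of the derivative of the interpolation. -/
def interpRate (w : (Fin n → A) → ℝ) (φ : A → ℝ) (c r : ℝ) (s : Pairs n ⊕ Fin n → ℝ)
    (H : (Fin n → A) → ℝ) : ℝ :=
  ∑ e, (2 * s (Sum.inl e) * gmean w H (fun x => fullSignal φ c r x (Sum.inl e))
      - gmean w H (fun x => fullSignal φ c r x (Sum.inl e)) ^ 2)
    - ∑ i, (2 * s (Sum.inr i) * gmean w H (fun x => fullSignal φ c r x (Sum.inr i))
      - gmean w H (fun x => fullSignal φ c r x (Sum.inr i)) ^ 2)

/-- Full double sums over sites are squared overlaps; the pairs `i < j` give half of them once the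
diagonal is removed. -/
theorem sum_gmean_pair (w H : (Fin n → A) → ℝ) (φ : A → ℝ) (y : Fin n → A) :
    ∑ e : Pairs n, (2 * (φ (y e.1.1) * φ (y e.1.2)) * gmean w H (fun x => φ (x e.1.1) * φ (x e.1.2))
        - gmean w H (fun x => φ (x e.1.1) * φ (x e.1.2)) ^ 2)
      = (2 * gmean w H (fun x => overlap φ x y ^ 2)
        - gmean w H (fun x => gmean w H fun x' => overlap φ x x' ^ 2)
        - ∑ i, (2 * φ (y i) ^ 2 * gmean w H (fun x => φ (x i) ^ 2)
          - gmean w H (fun x => φ (x i) ^ 2) ^ 2)) / 2 := by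
  have hov : ∀ x x' : Fin n → A, overlap φ x x' ^ 2
      = ∑ i, ∑ j, (φ (x i) * φ (x j)) * (φ (x' i) * φ (x' j)) := fun x x' => by
    rw [overlap, sq, Finset.sum_mul_sum]
    exact Finset.sum_congr rfl fun i _ => Finset.sum_congr rfl fun j _ => by ring
  rw [sum_pairs (fun i j => 2 * (φ (y i) * φ (y j)) * gmean w H (fun x => φ (x i) * φ (x j))
        - gmean w H (fun x => φ (x i) * φ (x j)) ^ 2)
      fun i j => by
        have : (fun x : Fin n → A => φ (x i) * φ (x j)) = fun x => φ (x j) * φ (x i) := by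
          ext x; ring
        rw [this, mul_comm (φ (y i))]]
  have h1 : gmean w H (fun x => overlap φ x y ^ 2)
      = ∑ i, ∑ j, (φ (y i) * φ (y j)) * gmean w H (fun x => φ (x i) * φ (x j)) := by
    simp_rw [hov, gmean_sum]
    refine Finset.sum_congr rfl fun i _ => Finset.sum_congr rfl fun j _ => ?_
    rw [← gmean_const_mul]
    congr 1; ext x; ring
  have h2 : gmean w H (fun x => gmean w H fun x' => overlap φ x x' ^ 2)
      = ∑ i, ∑ j, gmean w H (fun x => φ (x i) * φ (x j)) ^ 2 := by
    simp_rw [hov, gmean_sum, sq, gmean_mul_gmean]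
  have h3 : ∀ i, (fun x : Fin n → A => φ (x i) * φ (x i)) = fun x => φ (x i) ^ 2 := fun i => by
    ext x; ring
  simp_rw [h3, h1, h2, Finset.sum_sub_distrib, Finset.mul_sum]
  have h4 : ∀ i, 2 * (φ (y i) * φ (y i)) = 2 * φ (y i) ^ 2 := fun i => by ring
  simp_rw [h4]
  simp only [mul_assoc]

/-- Completion of the square: the site channels supply exactly the term linear in the overlap. The
sign `sg` allows overlaps near `-n q` while the signal-to-noise ratio stays `lam * q` with `q ≥ 0`.
-/
theorem interpRate_eq {w : (Fin n → A) → ℝ} (hw : IsWeight w) (H : (Fin n → A) → ℝ) (φ : A → ℝ)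
    {c r lam q sg : ℝ} (hn : (n : ℝ) ≠ 0) (hc : c ^ 2 = lam / n) (hr : r ^ 2 = lam * q)
    (hsg : sg ^ 2 = 1) (y : Fin n → A) :
    interpRate w φ c r (Sum.elim (pairSignal φ c y) fun i => sg * r * φ (y i)) H
      = lam / (2 * n) * (2 * gmean w H (fun x => (overlap φ x y - sg * (n * q)) ^ 2)
        - gmean w H (fun x => gmean w H fun x' => (overlap φ x x' - n * q) ^ 2)
        - n ^ 2 * q ^ 2
        - ∑ i, (2 * φ (y i) ^ 2 * gmean w H (fun x => φ (x i) ^ 2)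
          - gmean w H (fun x => φ (x i) ^ 2) ^ 2)) := by
  have e1 : ∀ e : Pairs n, gmean w H (fun x => fullSignal φ c r x (Sum.inl e))
      = c * gmean w H (fun x => φ (x e.1.1) * φ (x e.1.2)) := fun e => by
    rw [← gmean_const_mul]; simp [fullSignal, pairSignal, mul_assoc]
  have e2 : ∀ i, gmean w H (fun x => fullSignal φ c r x (Sum.inr i))
      = r * gmean w H (fun x => φ (x i)) := fun i => by
    rw [← gmean_const_mul]; simp [fullSignal]
  have s1 : ∑ e : Pairs n, (2 * (Sum.elim (pairSignal φ c y) (fun i => sg * r * φ (y i))) (Sum.inl e)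
        * gmean w H (fun x => fullSignal φ c r x (Sum.inl e))
      - gmean w H (fun x => fullSignal φ c r x (Sum.inl e)) ^ 2)
      = c ^ 2 * ∑ e : Pairs n, (2 * (φ (y e.1.1) * φ (y e.1.2))
          * gmean w H (fun x => φ (x e.1.1) * φ (x e.1.2))
        - gmean w H (fun x => φ (x e.1.1) * φ (x e.1.2)) ^ 2) := by
    rw [Finset.mul_sum]
    refine Finset.sum_congr rfl fun e _ => ?_
    rw [e1]; simp [pairSignal]; ring
  have o1 : gmean w H (fun x => overlap φ x y) = ∑ i, φ (y i) * gmean w H (fun x => φ (x i)) := by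
    simp only [overlap]
    rw [gmean_sum]
    refine Finset.sum_congr rfl fun i _ => ?_
    rw [← gmean_const_mul]; congr 1; ext x; ring
  have o2 : gmean w H (fun x => gmean w H fun x' => overlap φ x x')
      = ∑ i, gmean w H (fun x => φ (x i)) ^ 2 := by
    simp only [overlap, gmean_sum, sq, gmean_mul_gmean]
  have s2 : ∑ i, (2 * (Sum.elim (pairSignal φ c y) (fun i => sg * r * φ (y i))) (Sum.inr i)
        * gmean w H (fun x => fullSignal φ c r x (Sum.inr i))
      - gmean w H (fun x => fullSignal φ c r x (Sum.inr i)) ^ 2)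
      = r ^ 2 * (2 * sg * gmean w H (fun x => overlap φ x y)
        - gmean w H (fun x => gmean w H fun x' => overlap φ x x')) := by
    rw [o1, o2, Finset.mul_sum, ← Finset.sum_sub_distrib, Finset.mul_sum]
    refine Finset.sum_congr rfl fun i _ => ?_
    rw [e2]; simp; ring
  have q1 : gmean w H (fun x => (overlap φ x y - sg * (n * q)) ^ 2)
      = gmean w H (fun x => overlap φ x y ^ 2) - 2 * sg * (n * q) * gmean w H (fun x => overlap φ x y)
        + (n * q) ^ 2 := by
    have : (fun x => (overlap φ x y - sg * (n * q)) ^ 2) = fun x => (overlap φ x y ^ 2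
        - 2 * sg * (n * q) * overlap φ x y) + (n * q) ^ 2 := by
      ext x; linear_combination (n * q) ^ 2 * hsg
    rw [this, gmean_add, gmean_sub, gmean_const_mul, gmean_const hw]
  have q2 : gmean w H (fun x => gmean w H fun x' => (overlap φ x x' - n * q) ^ 2)
      = gmean w H (fun x => gmean w H fun x' => overlap φ x x' ^ 2)
        - 2 * (n * q) * gmean w H (fun x => gmean w H fun x' => overlap φ x x') + (n * q) ^ 2 := by
    have : ∀ x : Fin n → A, (fun x' => (overlap φ x x' - n * q) ^ 2) = fun x' =>
        (overlap φ x x' ^ 2 - 2 * (n * q) * overlap φ x x') + (n * q) ^ 2 := fun x => by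
      ext x'; ring
    simp_rw [this, gmean_add, gmean_sub, gmean_const_mul, gmean_const hw]
  rw [interpRate, s1, s2, sum_gmean_pair, q1, q2, hc, hr]
  field_simp
  ring

theorem abs_diag_le {w : (Fin n → A) → ℝ} (hw : IsWeight w) (H : (Fin n → A) → ℝ) {φ : A → ℝ}
    {K : ℝ} (hφ : ∀ b, φ b ^ 2 ≤ K) (y : Fin n → A) :
    |∑ i, (2 * φ (y i) ^ 2 * gmean w H (fun x => φ (x i) ^ 2)
      - gmean w H (fun x => φ (x i) ^ 2) ^ 2)| ≤ n * (3 * K ^ 2) := by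
  have h0 : (n : ℝ) * (3 * K ^ 2) = ∑ _i : Fin n, 3 * K ^ 2 := by simp
  rw [h0]
  refine (Finset.abs_sum_le_sum_abs _ _).trans (Finset.sum_le_sum fun i _ => ?_)
  have h1 : |gmean w H (fun x => φ (x i) ^ 2)| ≤ K := abs_gmean_le hw H fun x => by
    rw [abs_of_nonneg (sq_nonneg _)]; exact hφ _
  have h2 : 0 ≤ K := (sq_nonneg _).trans (hφ (y i))
  calc |2 * φ (y i) ^ 2 * gmean w H (fun x => φ (x i) ^ 2)
        - gmean w H (fun x => φ (x i) ^ 2) ^ 2|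
      ≤ |2 * φ (y i) ^ 2 * gmean w H (fun x => φ (x i) ^ 2)|
        + |gmean w H (fun x => φ (x i) ^ 2) ^ 2| := abs_sub _ _
    _ ≤ 2 * K * K + K ^ 2 := by
        rw [abs_mul, abs_of_nonneg (by positivity : 0 ≤ 2 * φ (y i) ^ 2), abs_pow]
        have := hφ (y i)
        gcongr
    _ = 3 * K ^ 2 := by ring

end Overlap

end

end SBM

namespace SBM

noncomputable section

/-! ### Interpolation bounds -/

section Path

variable {A : Type*} [Fintype A] {n : ℕ}

/-- The rate `sin t * cos t` is the derivative of `sin t ^ 2 / 2`, whence the factor `1 / 2`.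
Trigonometric amplitudes stay differentiable at both ends, unlike `√t` and `√(1 - t)`. -/
theorem le_add_of_hasDerivAt_sin_cos {f k : ℝ → ℝ} {C : ℝ}
    (hf : ∀ t, HasDerivAt f (Real.sin t * Real.cos t * k t) t) (hk : ∀ t, k t ≤ C) :
    f (Real.pi / 2) ≤ f 0 + C / 2 := by
  have hg : ∀ t, HasDerivAt (fun t => f t - C / 2 * Real.sin t ^ 2)
      (Real.sin t * Real.cos t * (k t - C)) t := fun t => by
    refine ((hf t).sub (((Real.hasDerivAt_sin t).pow 2).const_mul (C / 2))).congr_deriv ?_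
    simp; ring
  have hanti : AntitoneOn (fun t => f t - C / 2 * Real.sin t ^ 2) (Set.Icc 0 (Real.pi / 2)) := by
    refine antitoneOn_of_deriv_nonpos (convex_Icc _ _)
      (fun t _ => (hg t).continuousAt.continuousWithinAt)
      (fun t _ => (hg t).differentiableAt.differentiableWithinAt) fun t ht => ?_
    rw [interior_Icc] at ht
    rw [(hg t).deriv]
    refine mul_nonpos_of_nonneg_of_nonpos (mul_nonneg ?_ ?_) (sub_nonpos.2 (hk t))
    · exact (Real.sin_pos_of_pos_of_lt_pi ht.1 (by linarith [ht.2, Real.pi_pos])).le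
    · exact (Real.cos_pos_of_mem_Ioo ⟨by linarith [ht.1, Real.pi_pos], ht.2⟩).le
  have := hanti (Set.left_mem_Icc.2 (by positivity)) (Set.right_mem_Icc.2 (by positivity))
    (by positivity)
  simp at this
  linarith

theorem integrable_rate {S ι : Type*} [Fintype S] [Fintype ι] {w : S → ℝ} (hw : IsWeight w)
    (a : S → ι → ℝ) (s α : ι → ℝ) (e : ι) :
    Integrable (fun z => 2 * s e * gmean w (ham a s α z) (fun x => a x e)
      - gmean w (ham a s α z) (fun x => a x e) ^ 2) (stdGauss ι) := by
  refine ((integrable_gmean hw a s α _).const_mul _).sub' ?_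
  refine Integrable.of_bound ((gmean_measurable w a s α _).pow_const 2).aestronglyMeasurable
    ((∑ x, |a x e|) ^ 2) (ae_of_all _ fun z => ?_)
  rw [norm_pow]
  exact pow_le_pow_left₀ (norm_nonneg _) (abs_gmean_le hw _ fun x =>
    Finset.single_le_sum (f := fun x => |a x e|) (fun x _ => abs_nonneg _) (Finset.mem_univ x)) 2

theorem integrable_interpRate {w : (Fin n → A) → ℝ} (hw : IsWeight w) (φ : A → ℝ) (c r : ℝ)
    (s : Pairs n ⊕ Fin n → ℝ) (α : Pairs n ⊕ Fin n → ℝ) :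
    Integrable (fun z => interpRate w φ c r s (ham (fullSignal φ c r) s α z)) (stdGauss _) :=
  (integrable_finsetSum _ fun e _ => integrable_rate hw (fullSignal φ c r) s α (Sum.inl e)).sub'
    (integrable_finsetSum _ fun e _ => integrable_rate hw (fullSignal φ c r) s α (Sum.inr e))

theorem hasDerivAt_interp {w : (Fin n → A) → ℝ} (hw : IsWeight w) (φ : A → ℝ) (c r : ℝ)
    (s : Pairs n ⊕ Fin n → ℝ) (t : ℝ) :
    HasDerivAt (fun t => freeEnergy w (fullSignal φ c r) s fun e => amp n e t)
      (Real.sin t * Real.cos t * ∫ z, interpRate w φ c r s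
        (ham (fullSignal φ c r) s (fun e => amp n e t) z) ∂(stdGauss _)) t := by
  have h := hasDerivAt_freeEnergy hw (fullSignal φ c r) s (α := amp n)
    (α' := fun e t => Sum.elim (fun _ => Real.cos t) (fun _ => -Real.sin t) e)
    (by
      rintro (e | e) t
      · exact Real.hasDerivAt_sin t
      · exact Real.hasDerivAt_cos t)
    (by
      rintro (e | e) t
      · exact Real.abs_sin_le_one t
      · exact Real.abs_cos_le_one t)
    (by
      rintro (e | e) t
      · exact Real.abs_cos_le_one t
      · simpa using Real.abs_sin_le_one t) t
  refine h.congr_deriv ?_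
  have hi := integrable_rate hw (fullSignal φ c r) s fun e => amp n e t
  simp only [interpRate]
  rw [integral_sub (integrable_finsetSum _ fun e _ => hi (Sum.inl e))
      (integrable_finsetSum _ fun e _ => hi (Sum.inr e)),
    integral_finsetSum _ fun e _ => hi (Sum.inl e),
    integral_finsetSum _ fun e _ => hi (Sum.inr e), Fintype.sum_sum_type, mul_sub,
    Finset.mul_sum, Finset.mul_sum, sub_eq_add_neg, ← Finset.sum_neg_distrib]
  congr 1
  refine Finset.sum_congr rfl fun e _ => ?_
  simp only [amp, Sum.elim_inr]
  ring

/-- On the restricted support the planted square is at most `(n η) ^ 2`, and the replica square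
enters with a minus sign and is dropped. No average over `y` is involved, so the Nishimori identity,
which fails for a restricted prior, is not required. -/
theorem interp_upper {w : (Fin n → A) → ℝ} (hw : IsWeight w) {φ : A → ℝ} {K : ℝ}
    (hφ : ∀ b, φ b ^ 2 ≤ K) {c r lam q sg η : ℝ} (hn : n ≠ 0) (hlam : 0 ≤ lam)
    (hc : c ^ 2 = lam / n) (hr : r ^ 2 = lam * q) (hsg : sg ^ 2 = 1) (y : Fin n → A)
    (hsupp : ∀ x, 0 < w x → |overlap φ x y - sg * (n * q)| ≤ n * η) :
    freeEnergy w (fullSignal φ c r) (Sum.elim (pairSignal φ c y) fun i => sg * r * φ (y i))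
        (fun e => amp n e (Real.pi / 2))
      ≤ freeEnergy w (fullSignal φ c r) (Sum.elim (pairSignal φ c y) fun i => sg * r * φ (y i))
        (fun e => amp n e 0) + (lam * n * (η ^ 2 / 2 - q ^ 2 / 4) + 3 / 4 * lam * K ^ 2) := by
  have hn' : (0 : ℝ) < n := by positivity
  have hC : lam * n * (η ^ 2 / 2 - q ^ 2 / 4) + 3 / 4 * lam * K ^ 2
      = (lam / (2 * n) * (2 * (n * η) ^ 2 - n ^ 2 * q ^ 2 + n * (3 * K ^ 2))) / 2 := by
    field_simp; ring
  rw [hC]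
  refine le_add_of_hasDerivAt_sin_cos (hasDerivAt_interp hw φ c r _) fun t => ?_
  refine (integral_mono (integrable_interpRate hw φ c r _ _) (integrable_const _)
    fun z => ?_).trans (by simp only [integral_const, probReal_univ, one_smul]; exact le_rfl)
  simp only
  rw [interpRate_eq hw _ φ hn'.ne' hc hr hsg y]
  refine mul_le_mul_of_nonneg_left ?_ (by positivity)
  set H := ham (fullSignal φ c r) (Sum.elim (pairSignal φ c y) fun i => sg * r * φ (y i))
    (fun e => amp n e t) z
  have h1 : gmean w H (fun x => (overlap φ x y - sg * (n * q)) ^ 2) ≤ (n * η) ^ 2 := by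
    rw [← gmean_const hw H ((n * η) ^ 2)]
    refine gmean_mono hw H fun x hx => ?_
    rw [← sq_abs]
    exact pow_le_pow_left₀ (abs_nonneg _) (hsupp x hx) 2
  have h2 : 0 ≤ gmean w H (fun x => gmean w H fun x' => (overlap φ x x' - n * q) ^ 2) := by
    rw [← gmean_const hw H 0]
    refine gmean_mono hw H fun x _ => ?_
    rw [← gmean_const hw H 0]
    exact gmean_mono hw H fun x' _ => sq_nonneg _
  have h3 := (abs_le.1 (abs_diag_le hw H hφ y)).1
  linarith

/-- Averaged over the planted configuration, the planted term `U` and the replica term `V` agree, so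
`2 U - V = U ≥ 0` can be dropped. The path lemma bounds from above, hence it is applied to the
negated free energy. -/
theorem interp_lower [Nonempty A] {P : (Fin n → A) → ℝ} (hP : IsPrior P) {φ : A → ℝ} {K : ℝ}
    (hφ : ∀ b, φ b ^ 2 ≤ K) {c r lam q : ℝ} (hn : n ≠ 0) (hlam : 0 ≤ lam)
    (hc : c ^ 2 = lam / n) (hr : r ^ 2 = lam * q) :
    ∑ y, P y * freeEnergy P (fullSignal φ c r) (fullSignal φ c r y) (fun e => amp n e 0)
        - lam * n * (q ^ 2 / 4) - 3 / 4 * lam * K ^ 2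
      ≤ ∑ y, P y * freeEnergy P (fullSignal φ c r) (fullSignal φ c r y)
          (fun e => amp n e (Real.pi / 2)) := by
  have hn' : (0 : ℝ) < n := by positivity
  have hw := hP.isWeight
  have key := le_add_of_hasDerivAt_sin_cos
    (f := fun t => -∑ y, P y * freeEnergy P (fullSignal φ c r) (fullSignal φ c r y)
      (fun e => amp n e t))
    (k := fun t => -∑ y, P y * ∫ z, interpRate P φ c r (fullSignal φ c r y)
        (ham (fullSignal φ c r) (fullSignal φ c r y) (fun e => amp n e t) z) ∂(stdGauss _))
    (C := lam / (2 * n) * (n ^ 2 * q ^ 2 + n * (3 * K ^ 2)))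
    (fun t => by
      refine (HasDerivAt.fun_sum fun y _ =>
        (hasDerivAt_interp hw φ c r (fullSignal φ c r y) t).const_mul (P y)).neg.congr_deriv ?_
      rw [mul_neg, Finset.mul_sum]
      congr 1
      exact Finset.sum_congr rfl fun y _ => by ring)
    (fun t => by
      set α : Pairs n ⊕ Fin n → ℝ := fun e => amp n e t
      set H : (Fin n → A) → (Pairs n ⊕ Fin n → ℝ) → (Fin n → A) → ℝ := fun y z =>
        ham (fullSignal φ c r) (fullSignal φ c r y) α z
      have hN := nishimori hP (fullSignal φ c r) α (fun x y => (overlap φ x y - n * q) ^ 2)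
      have hbd : ∀ f : (Fin n → A) → ℝ, ∀ y z, |gmean P (H y z) f| ≤ ∑ x, |f x| := fun f y z =>
        abs_gmean_le hw _ fun x => Finset.single_le_sum (f := fun x => |f x|)
          (fun _ _ => abs_nonneg _) (Finset.mem_univ x)
      have i1 : ∀ y, Integrable (fun z => gmean P (H y z) fun x =>
          (overlap φ x y - n * q) ^ 2) (stdGauss _) := fun y => integrable_gmean hw _ _ _ _
      have i2 : ∀ y, Integrable (fun z => gmean P (H y z) fun x => gmean P (H y z) fun x' =>
          (overlap φ x x' - n * q) ^ 2) (stdGauss _) := fun y => by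
        refine Integrable.of_bound (Measurable.aestronglyMeasurable ?_)
          (∑ x, ∑ x', |(overlap φ x x' - n * q) ^ 2|) (ae_of_all _ fun z =>
            abs_gmean_le hw _ fun x => (hbd _ y z).trans
              (Finset.single_le_sum (f := fun x => ∑ x', |(overlap φ x x' - n * q) ^ 2|)
              (fun _ _ => Finset.sum_nonneg fun _ _ => abs_nonneg _) (Finset.mem_univ x)))
        refine (Finset.measurable_sum _ fun x _ => ?_).div (part_measurable P _ _ α)
        exact ((Real.measurable_exp.comp (ham_measurable _ _ α x)).const_mul _).mul
          (gmean_measurable P _ _ α _)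
      have hlow : ∀ y, lam / (2 * n) * (2 * ∫ z, gmean P (H y z) (fun x =>
            (overlap φ x y - n * q) ^ 2) ∂(stdGauss _)
          - (∫ z, gmean P (H y z) (fun x => gmean P (H y z) fun x' =>
            (overlap φ x x' - n * q) ^ 2) ∂(stdGauss _))
          - (n ^ 2 * q ^ 2 + n * (3 * K ^ 2)))
          ≤ ∫ z, interpRate P φ c r (fullSignal φ c r y) (H y z) ∂(stdGauss _) := fun y => by
        have hint : lam / (2 * n) * (2 * ∫ z, gmean P (H y z) (fun x =>
            (overlap φ x y - n * q) ^ 2) ∂(stdGauss _)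
          - (∫ z, gmean P (H y z) (fun x => gmean P (H y z) fun x' =>
            (overlap φ x x' - n * q) ^ 2) ∂(stdGauss _))
          - (n ^ 2 * q ^ 2 + n * (3 * K ^ 2)))
          = ∫ z, lam / (2 * n) * (2 * gmean P (H y z) (fun x => (overlap φ x y - n * q) ^ 2)
            - gmean P (H y z) (fun x => gmean P (H y z) fun x' => (overlap φ x x' - n * q) ^ 2)
            - (n ^ 2 * q ^ 2 + n * (3 * K ^ 2))) ∂(stdGauss _) := by
          rw [integral_const_mul, integral_sub (((i1 y).const_mul _).sub' (i2 y))
            (integrable_const _), integral_sub ((i1 y).const_mul _) (i2 y), integral_const_mul]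
          simp
        rw [hint]
        refine integral_mono (((((i1 y).const_mul _).sub' (i2 y)).sub'
          (integrable_const _)).const_mul _) (integrable_interpRate hw φ c r _ _) fun z => ?_
        have hs : fullSignal φ c r y
            = Sum.elim (pairSignal φ c y) fun i => (1 : ℝ) * r * φ (y i) := by
          simp [fullSignal]
        have he := interpRate_eq hw (H y z) φ (sg := 1) hn'.ne' hc hr (by norm_num) y
        rw [← hs] at he
        simp only
        rw [he]
        refine mul_le_mul_of_nonneg_left ?_ (by positivity)
        have h3 := (abs_le.1 (abs_diag_le hw (H y z) hφ y)).2
        simp only [one_mul]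
        linarith
      have hsum := Finset.sum_le_sum fun y (_ : y ∈ Finset.univ) =>
        mul_le_mul_of_nonneg_left (hlow y) (hP.pos y).le
      set U := fun y => ∫ z, gmean P (H y z) (fun x => (overlap φ x y - n * q) ^ 2) ∂(stdGauss _)
      set V := fun y => ∫ z, gmean P (H y z) (fun x => gmean P (H y z) fun x' =>
            (overlap φ x x' - n * q) ^ 2) ∂(stdGauss _)
      have hU : 0 ≤ ∑ y, P y * U y := Finset.sum_nonneg fun y _ => mul_nonneg (hP.pos y).le
        (integral_nonneg fun z => by
          rw [Pi.zero_apply, ← gmean_const hw (H y z) 0]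
          exact gmean_mono hw _ fun x _ => sq_nonneg _)
      have hUV : ∑ y, P y * U y = ∑ y, P y * V y := hN
      have hcalc : ∑ y, P y * (lam / (2 * n) * (2 * U y - V y - (n ^ 2 * q ^ 2 + n * (3 * K ^ 2))))
          = lam / (2 * n) * (2 * ∑ y, P y * U y - ∑ y, P y * V y)
            - lam / (2 * n) * (n ^ 2 * q ^ 2 + n * (3 * K ^ 2)) := by
        have : ∀ y, P y * (lam / (2 * n) * (2 * U y - V y - (n ^ 2 * q ^ 2 + n * (3 * K ^ 2))))
            = lam / (2 * n) * (2 * (P y * U y)) - lam / (2 * n) * (P y * V y)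
              - P y * (lam / (2 * n) * (n ^ 2 * q ^ 2 + n * (3 * K ^ 2))) := fun y => by ring
        simp_rw [this, Finset.sum_sub_distrib, ← Finset.mul_sum, ← Finset.sum_mul,
          hP.sum_eq_one]
        ring
      rw [hcalc] at hsum
      have hpos : 0 ≤ lam / (2 * n) * (2 * ∑ y, P y * U y - ∑ y, P y * V y) :=
        mul_nonneg (by positivity) (by linarith)
      simp only [α, H] at hsum ⊢
      linarith)
  have hC : (lam / (2 * n) * (n ^ 2 * q ^ 2 + n * (3 * K ^ 2))) / 2
      = lam * n * (q ^ 2 / 4) + 3 / 4 * lam * K ^ 2 := by field_simp; ring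
  rw [hC] at key
  linarith

end Path

/-! ### Endpoints of the interpolation -/

section Endpoints

/-- Projecting a product of standard Gaussians on some of its coordinates. -/
theorem measurePreserving_comp_inl (ι κ : Type*) [Fintype ι] [Fintype κ] :
    MeasurePreserving (fun (z : ι ⊕ κ → ℝ) i => z (Sum.inl i)) (stdGauss (ι ⊕ κ)) (stdGauss ι) :=
  measurePreserving_fst.comp
    (measurePreserving_sumPiEquivProdPi (fun _ : ι ⊕ κ => gaussianReal 0 1))

variable {A : Type*} [Fintype A] {n : ℕ}

theorem freeEnergy_amp_pi_div_two (w : (Fin n → A) → ℝ) (φ : A → ℝ) (c r : ℝ)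
    (s : Pairs n → ℝ) (s' : Fin n → ℝ) :
    freeEnergy w (fullSignal φ c r) (Sum.elim s s') (fun e => amp n e (Real.pi / 2))
      = freeEnergy w (pairSignal φ c) s fun _ => 1 := by
  rw [freeEnergy, freeEnergy, ← (measurePreserving_comp_inl (Pairs n) (Fin n)).map_eq,
    integral_map (measurePreserving_comp_inl _ _).measurable.aemeasurable
      (logPart_measurable w _ _ _).aestronglyMeasurable]
  refine integral_congr_ae (ae_of_all _ fun z => ?_)
  simp only
  congr 1
  ext x
  simp [ham, amp, fullSignal]

/-- The free energy of a scalar Gaussian channel with signal `r * φ` and planted value `τ`. -/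
def siteEnergy (P φ : A → ℝ) (r τ : ℝ) : ℝ :=
  ∫ z, logPart P (fun b => r * φ b * z + (r * φ b * τ - (r * φ b) ^ 2 / 2)) ∂(gaussianReal 0 1)

theorem siteLog_measurable (P φ : A → ℝ) (r τ : ℝ) : Measurable fun z : ℝ =>
    logPart P (fun b => r * φ b * z + (r * φ b * τ - (r * φ b) ^ 2 / 2)) := by
  unfold logPart part
  fun_prop

theorem integrable_siteLog {P : A → ℝ} (hP : IsWeight P) (φ : A → ℝ) (r τ : ℝ) :
    Integrable (fun z : ℝ =>
      logPart P (fun b => r * φ b * z + (r * φ b * τ - (r * φ b) ^ 2 / 2)))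
      (gaussianReal 0 1) := by
  set f := fun z : ℝ => logPart P (fun b => r * φ b * z + (r * φ b * τ - (r * φ b) ^ 2 / 2))
  refine Integrable.mono' (g := fun z => |f 0| + (∑ b, |r * φ b|) * |z|)
    ((integrable_const _).fun_add (integrable_id_gauss.abs.const_mul _))
    (siteLog_measurable P φ r τ).aestronglyMeasurable (ae_of_all _ fun z => ?_)
  have h := abs_logPart_sub_le hP
    (H := fun b => r * φ b * z + (r * φ b * τ - (r * φ b) ^ 2 / 2))
    (H' := fun b => r * φ b * 0 + (r * φ b * τ - (r * φ b) ^ 2 / 2))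
    (c := (∑ b, |r * φ b|) * |z|) fun b => by
      rw [show r * φ b * z + (r * φ b * τ - (r * φ b) ^ 2 / 2)
        - (r * φ b * 0 + (r * φ b * τ - (r * φ b) ^ 2 / 2)) = r * φ b * z by ring, abs_mul]
      exact mul_le_mul_of_nonneg_right (Finset.single_le_sum (f := fun b => |r * φ b|)
        (fun _ _ => abs_nonneg _) (Finset.mem_univ b)) (abs_nonneg _)
  have h' : |f z - f 0| ≤ (∑ b, |r * φ b|) * |z| := h
  rw [Real.norm_eq_abs]
  have := abs_sub_abs_le_abs_sub (f z) (f 0)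
  linarith

theorem part_prodPrior (P : A → ℝ) (h : Fin n → A → ℝ) :
    part (prodPrior P n) (fun x => ∑ i, h i (x i)) = ∏ i, part P (h i) := by
  simp only [part, prodPrior, Real.exp_sum, ← Finset.prod_mul_distrib]
  exact sum_prod_pi fun i b => P b * Real.exp (h i b)

/-- Since `sin 0 = 0`, the pairs disappear from the energy, and the partition function of
independent labels factorizes over the sites. -/
theorem freeEnergy_amp_zero {P : A → ℝ} (hP : IsWeight P) (φ : A → ℝ) (c r : ℝ)
    (s : Pairs n → ℝ) (s' : Fin n → ℝ) :
    freeEnergy (prodPrior P n) (fullSignal φ c r) (Sum.elim s s') (fun e => amp n e 0)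
      = ∑ i, siteEnergy P φ r (s' i) := by
  have h : ∀ z, logPart (prodPrior P n)
      (ham (fullSignal φ c r) (Sum.elim s s') (fun e => amp n e 0) z)
      = ∑ i, logPart P (fun b => r * φ b * z (Sum.inr i)
        + (r * φ b * s' i - (r * φ b) ^ 2 / 2)) := fun z => by
    have : ham (fullSignal φ c r) (Sum.elim s s') (fun e => amp n e 0) z
        = fun x => ∑ i, (fun i b => r * φ b * z (Sum.inr i)
        + (r * φ b * s' i - (r * φ b) ^ 2 / 2)) i (x i) := by
      ext x; simp [ham, amp, fullSignal]
    rw [this, logPart, part_prodPrior P (fun i b => r * φ b * z (Sum.inr i)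
        + (r * φ b * s' i - (r * φ b) ^ 2 / 2)), Real.log_prod fun i _ => (part_pos hP _).ne']
    rfl
  have hi : ∀ i : Fin n, Integrable (fun z : Pairs n ⊕ Fin n → ℝ => logPart P
      (fun b => r * φ b * z (Sum.inr i) + (r * φ b * s' i - (r * φ b) ^ 2 / 2)))
      (stdGauss _) := fun i =>
    (measurePreserving_eval (fun _ : Pairs n ⊕ Fin n => gaussianReal 0 1)
      (Sum.inr i)).integrable_comp_of_integrable (integrable_siteLog hP φ r (s' i))
  have hmp : ∀ i : Fin n, MeasurePreserving (fun z : Pairs n ⊕ Fin n → ℝ => z (Sum.inr i))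
      (stdGauss _) (gaussianReal 0 1) := fun i =>
    measurePreserving_eval (fun _ : Pairs n ⊕ Fin n => gaussianReal 0 1) (Sum.inr i)
  rw [freeEnergy]
  simp_rw [h]
  rw [integral_finsetSum _ fun i _ => hi i]
  refine Finset.sum_congr rfl fun i _ => ?_
  rw [siteEnergy, ← (hmp i).map_eq, integral_map (hmp i).measurable.aemeasurable
    (siteLog_measurable P φ r _).aestronglyMeasurable]

theorem freeEnergy_mono {S ι : Type*} [Fintype S] [Fintype ι] {w w' : S → ℝ} (hw : IsWeight w)
    (hw' : IsWeight w') (h : ∀ x, w x ≤ w' x) (a : S → ι → ℝ) (s α : ι → ℝ) :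
    freeEnergy w a s α ≤ freeEnergy w' a s α := by
  refine integral_mono (integrable_logPart_ham hw a s α) (integrable_logPart_ham hw' a s α)
    fun z => Real.log_le_log (part_pos hw _) (Finset.sum_le_sum fun x _ =>
      mul_le_mul_of_nonneg_right (h x) (Real.exp_pos _).le)

/-- In a scalar channel, flipping the sign of the planted value lowers the average free energy. -/
theorem sum_siteEnergy_neg_le [Nonempty A] {P : A → ℝ} (hP : IsPrior P) (φ : A → ℝ) (r : ℝ) :
    ∑ b, P b * siteEnergy P φ r (-(r * φ b)) ≤ ∑ b, P b * siteEnergy P φ r (r * φ b) := by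
  have hw := hP.isWeight
  set Z : ℝ → ℝ := fun y => part P (fun b => r * φ b * y - (r * φ b) ^ 2 / 2) with hZ
  have hZpos : ∀ y, 0 < Z y := fun y => part_pos hw _
  have hlm : Measurable fun y => Real.log (Z y) := by
    simp only [hZ, part]; fun_prop
  have hform : ∀ τ y, logPart P (fun b => r * φ b * y + (r * φ b * τ - (r * φ b) ^ 2 / 2))
      = Real.log (Z (y + τ)) := fun τ y => by
    rw [logPart]; congr 2; ext b; ring
  have hshift : ∀ τ, Integrable (fun y => Real.log (Z (y + τ))) (gaussianReal 0 1) := fun τ => by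
    simp_rw [← hform]; exact integrable_siteLog hw φ r τ
  have hmap : ∀ τ : ℝ, MeasurePreserving (fun y : ℝ => y + τ) (gaussianReal 0 1)
      (gaussianReal τ 1) := fun τ =>
    ⟨by fun_prop, by rw [gaussianReal_map_add_const, zero_add]⟩
  have hneg : MeasurePreserving (fun y : ℝ => -y) (gaussianReal 0 1) (gaussianReal 0 1) :=
    ⟨by fun_prop, by rw [gaussianReal_map_neg, neg_zero]⟩
  have hpart : ∀ f : ℝ → ℝ, (∀ y, Z y * f y
      = ∑ b, P b * (Real.exp (r * φ b * y - (r * φ b) ^ 2 / 2) * f y)) := fun f y => by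
    simp only [hZ, part, Finset.sum_mul, mul_assoc]
  have i1 : ∀ τ, Integrable (fun y => Real.log (Z y)) (gaussianReal τ 1) := fun τ => by
    rw [← (hmap τ).map_eq, integrable_map_measure hlm.aestronglyMeasurable
      (hmap τ).measurable.aemeasurable]
    exact hshift τ
  have hlm' : Measurable fun y => Real.log (Z (-y)) := hlm.comp measurable_neg
  have hflip : ∀ τ, (fun y => Real.log (Z (y + -τ)))
      = (fun y => Real.log (Z (-(y + τ)))) ∘ fun y => -y := fun τ => by
    ext y; simp only [Function.comp_apply]; congr 2; ring
  have hs' : ∀ τ, Integrable (fun y => Real.log (Z (-(y + τ)))) (gaussianReal 0 1) := fun τ => by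
    have := hshift (-τ)
    rw [hflip] at this
    exact (hneg.integrable_comp (hlm'.comp
      (measurable_id.add_const τ)).aestronglyMeasurable).1 this
  have i2 : ∀ τ, Integrable (fun y => Real.log (Z (-y))) (gaussianReal τ 1) := fun τ => by
    rw [← (hmap τ).map_eq, integrable_map_measure hlm'.aestronglyMeasurable
      (hmap τ).measurable.aemeasurable]
    exact hs' τ
  have e1 : ∀ b, siteEnergy P φ r (r * φ b)
      = ∫ y, Real.exp (r * φ b * y - (r * φ b) ^ 2 / 2) * Real.log (Z y) ∂(gaussianReal 0 1) := by
    intro b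
    rw [siteEnergy]
    simp_rw [hform]
    rw [integral_gauss_shift _ fun y => Real.log (Z y), ← (hmap (r * φ b)).map_eq,
      integral_map (hmap _).measurable.aemeasurable hlm.aestronglyMeasurable]
  have e2 : ∀ b, siteEnergy P φ r (-(r * φ b))
      = ∫ y, Real.exp (r * φ b * y - (r * φ b) ^ 2 / 2) * Real.log (Z (-y))
        ∂(gaussianReal 0 1) := by
    intro b
    rw [siteEnergy]
    simp_rw [hform]
    rw [integral_gauss_shift _ fun y => Real.log (Z (-y)), ← (hmap (r * φ b)).map_eq,
      integral_map (hmap _).measurable.aemeasurable hlm'.aestronglyMeasurable, hflip]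
    conv_rhs => rw [← hneg.map_eq]
    exact (integral_map (f := fun y => Real.log (Z (-(y + r * φ b))))
      hneg.measurable.aemeasurable
      (hlm'.comp (measurable_id.add_const (r * φ b))).aestronglyMeasurable).symm
  have hL := isLikelihood_gaussLik fun b => r * φ b
  have hLe : ∀ b y, gaussLik (fun b => r * φ b) b y
      = Real.exp (r * φ b * y - (r * φ b) ^ 2 / 2) := fun b y => rfl
  have iZ : Integrable Z (gaussianReal 0 1) :=
    integrable_finsetSum _ fun b _ => (hL.integrable b).const_mul _
  have iZ' : Integrable (fun y => Z (-y)) (gaussianReal 0 1) :=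
    hneg.integrable_comp_of_integrable iZ
  have eZ : ∫ y, Z (-y) ∂(gaussianReal 0 1) = ∫ y, Z y ∂(gaussianReal 0 1) := by
    conv_rhs => rw [← hneg.map_eq]
    rw [integral_map hneg.measurable.aemeasurable
      (by rw [hneg.map_eq]; exact iZ.aestronglyMeasurable)]
  have j1 : ∀ b, Integrable (fun y => P b * (Real.exp (r * φ b * y - (r * φ b) ^ 2 / 2)
      * Real.log (Z y))) (gaussianReal 0 1) := fun b =>
    (integrable_gauss_shift _ (i1 _)).const_mul _
  have j2 : ∀ b, Integrable (fun y => P b * (Real.exp (r * φ b * y - (r * φ b) ^ 2 / 2)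
      * Real.log (Z (-y)))) (gaussianReal 0 1) := fun b =>
    (integrable_gauss_shift _ (i2 _)).const_mul _
  have s1 : ∑ b, P b * siteEnergy P φ r (r * φ b)
      = ∫ y, Z y * Real.log (Z y) ∂(gaussianReal 0 1) := by
    simp_rw [hpart fun y => Real.log (Z y), e1]
    rw [integral_finsetSum _ fun b _ => j1 b]
    exact Finset.sum_congr rfl fun b _ => (integral_const_mul _ _).symm
  have s2 : ∑ b, P b * siteEnergy P φ r (-(r * φ b))
      = ∫ y, Z y * Real.log (Z (-y)) ∂(gaussianReal 0 1) := by
    simp_rw [hpart fun y => Real.log (Z (-y)), e2]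
    rw [integral_finsetSum _ fun b _ => j2 b]
    exact Finset.sum_congr rfl fun b _ => (integral_const_mul _ _).symm
  have k1 : Integrable (fun y => Z y * Real.log (Z y)) (gaussianReal 0 1) := by
    simp_rw [hpart fun y => Real.log (Z y)]
    exact integrable_finsetSum _ fun b _ => j1 b
  have k2 : Integrable (fun y => Z y * Real.log (Z (-y))) (gaussianReal 0 1) := by
    simp_rw [hpart fun y => Real.log (Z (-y))]
    exact integrable_finsetSum _ fun b _ => j2 b
  rw [s1, s2]
  -- Gibbs' inequality between two densities: `Z` and its reflection have the same integral because
  -- the noise is symmetric.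
  have hle : ∫ y, Z y * Real.log (Z (-y)) ∂(gaussianReal 0 1)
      ≤ ∫ y, (Z y * Real.log (Z y) + (Z (-y) - Z y)) ∂(gaussianReal 0 1) := by
    refine integral_mono k2 (k1.fun_add (iZ'.sub' iZ)) fun y => ?_
    have h := Real.log_le_sub_one_of_pos (div_pos (hZpos (-y)) (hZpos y))
    rw [Real.log_div (hZpos _).ne' (hZpos _).ne'] at h
    have h2 := mul_le_mul_of_nonneg_left h (hZpos y).le
    have h3 : Z y * (Z (-y) / Z y - 1) = Z (-y) - Z y := by
      have := (hZpos y).ne'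
      field_simp
    simp only
    linarith
  rw [integral_add k1 (iZ'.sub' iZ), integral_sub iZ' iZ, eZ] at hle
  linarith

end Endpoints

end

end SBM

namespace SBM

noncomputable section

/-! ### Replica-symmetric bounds on the free energy -/

section ReplicaSymmetric

variable {A : Type*} [Fintype A]

/-- The replica-symmetric potential of a rank-one channel with prior `P` and labels `φ`. -/
def rsValue (P φ : A → ℝ) (lam q : ℝ) : ℝ :=
  -(lam * q ^ 2 / 4) + ∑ b, P b * siteEnergy P φ (√(lam * q)) (√(lam * q) * φ b)

/-- The average of the free energy of the rank-one channel over the planted configuration. -/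
def plantedEnergy (P φ : A → ℝ) (lam : ℝ) (n : ℕ) : ℝ :=
  ∑ y, prodPrior P n y * freeEnergy (prodPrior P n) (pairSignal φ √(lam / n))
    (pairSignal φ √(lam / n) y) fun _ => 1

variable [Nonempty A] {P φ : A → ℝ} {K lam : ℝ}

/-- The replica-symmetric lower bound. -/
theorem rsValue_le_plantedEnergy (hP : IsPrior P) (hφ : ∀ b, φ b ^ 2 ≤ K) (hlam : 0 ≤ lam)
    {q : ℝ} (hq : 0 ≤ q) {n : ℕ} (hn : n ≠ 0) :
    n * rsValue P φ lam q - 3 / 4 * lam * K ^ 2 ≤ plantedEnergy P φ lam n := by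
  have hQ := isPrior_prodPrior hP n
  have h := interp_lower hQ hφ (c := √(lam / n)) (r := √(lam * q)) hn hlam
    (Real.sq_sqrt (by positivity)) (Real.sq_sqrt (by positivity))
  have e1 : ∀ y : Fin n → A, freeEnergy (prodPrior P n) (fullSignal φ √(lam / n) √(lam * q))
      (fullSignal φ √(lam / n) √(lam * q) y) (fun e => amp n e (Real.pi / 2))
      = freeEnergy (prodPrior P n) (pairSignal φ √(lam / n)) (pairSignal φ √(lam / n) y)
        fun _ => 1 := fun y => freeEnergy_amp_pi_div_two _ φ _ _ _ _
  have e0 : ∀ y : Fin n → A, freeEnergy (prodPrior P n) (fullSignal φ √(lam / n) √(lam * q))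
      (fullSignal φ √(lam / n) √(lam * q) y) (fun e => amp n e 0)
      = ∑ i, siteEnergy P φ √(lam * q) (√(lam * q) * φ (y i)) := fun y =>
    freeEnergy_amp_zero hP.isWeight φ _ _ _ _
  simp_rw [e1, e0, Finset.mul_sum] at h
  rw [Finset.sum_comm] at h
  simp_rw [sum_prodPrior_mul hP _ fun b => siteEnergy P φ √(lam * q) (√(lam * q) * φ b)] at h
  rw [Finset.sum_const, Finset.card_univ, Fintype.card_fin, nsmul_eq_mul] at h
  refine le_trans (le_of_eq ?_) h
  rw [rsValue]
  ring

omit [Fintype A] [Nonempty A] in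
theorem abs_overlap_le (hφ : ∀ b, φ b ^ 2 ≤ K) {n : ℕ} (x y : Fin n → A) :
    |overlap φ x y| ≤ n * K := by
  have h0 : (n : ℝ) * K = ∑ _i : Fin n, K := by simp
  rw [h0]
  refine (Finset.abs_sum_le_sum_abs _ _).trans (Finset.sum_le_sum fun i _ => ?_)
  rw [abs_le]
  constructor <;> nlinarith [hφ (x i), hφ (y i), sq_nonneg (φ (x i) + φ (y i)),
    sq_nonneg (φ (x i) - φ (y i))]

/-- The prior restricted to configurations having a given overlap with `y`, up to `n * η`. -/
def binWeight (P φ : A → ℝ) (n : ℕ) (η : ℝ) (y : Fin n → A) (k : ℤ) (x : Fin n → A) : ℝ :=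
  if ⌊overlap φ x y / (n * η)⌋ = k then prodPrior P n x else 0

omit [Fintype A] [Nonempty A] in
-- Overlaps are at most `n K` in absolute value, so the number of windows depends on `K / η` and not
-- on `n`.
theorem sum_binWeight (P : A → ℝ) {φ : A → ℝ} (hφ : ∀ b, φ b ^ 2 ≤ K) {n : ℕ} (hn : n ≠ 0)
    {η : ℝ} (hη : 0 < η) (x y : Fin n → A) :
    ∑ k ∈ Finset.Icc (-(⌈K / η⌉ : ℤ)) ⌈K / η⌉, binWeight P φ n η y k x = prodPrior P n x := by
  have hn' : (0 : ℝ) < n := by positivity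
  simp only [binWeight]
  rw [Finset.sum_ite_eq, if_pos]
  have h := abs_le.1 (abs_overlap_le hφ x y)
  have e : K / η = n * K / (n * η) := by field_simp
  rw [Finset.mem_Icc]
  constructor
  · rw [Int.le_floor]
    push_cast
    have := Int.le_ceil (K / η)
    have h2 : -(K / η) ≤ overlap φ x y / (n * η) := by
      rw [e, ← neg_div]
      gcongr
      exact h.1
    linarith
  · have h2 : overlap φ x y / (n * η) ≤ K / η := by
      rw [e]; gcongr; exact h.2
    exact_mod_cast (Int.floor_le _).trans (h2.trans (Int.le_ceil _))

/-- Overlaps in window `k` lie within `n η` of `k * n * η`, so `q = |k| η`, and the sign of `k` goes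
to the planted site values. At the decoupled end the full prior replaces the restricted one: this
only raises the free energy, and it factorizes. -/
theorem freeEnergy_binWeight_le (hP : IsPrior P) (hφ : ∀ b, φ b ^ 2 ≤ K) (hlam : 0 ≤ lam)
    {n : ℕ} (hn : n ≠ 0) {η : ℝ} (hη : 0 < η) (y : Fin n → A) (k : ℤ)
    (hk : IsWeight (binWeight P φ n η y k)) :
    freeEnergy (binWeight P φ n η y k) (pairSignal φ √(lam / n)) (pairSignal φ √(lam / n) y)
        (fun _ => 1)
      ≤ ∑ i, siteEnergy P φ √(lam * (|k| * η))
          ((if 0 ≤ k then 1 else -1) * √(lam * (|k| * η)) * φ (y i))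
        + (lam * n * (η ^ 2 / 2 - (|k| * η) ^ 2 / 4) + 3 / 4 * lam * K ^ 2) := by
  have hn' : (0 : ℝ) < n := by positivity
  have hk0 : (0 : ℝ) ≤ |k| * η := by positivity
  have hs : ((if 0 ≤ k then 1 else -1 : ℝ)) * |k| = k := by
    split_ifs with h
    · rw [one_mul]; exact_mod_cast abs_of_nonneg h
    · rw [abs_of_neg (not_le.1 h)]; push_cast; ring
  have h := interp_upper hk hφ (c := √(lam / n)) (r := √(lam * (|k| * η))) (lam := lam)
    (q := |k| * η) (sg := if 0 ≤ k then 1 else -1) (η := η) hn hlam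
    (Real.sq_sqrt (by positivity)) (Real.sq_sqrt (by positivity)) (by split_ifs <;> norm_num) y
    (fun x hx => by
      have hf : ⌊overlap φ x y / (n * η)⌋ = k := by
        by_contra hne
        simp [binWeight, hne] at hx
      obtain ⟨h1, h2⟩ := Int.floor_eq_iff.1 hf
      rw [le_div_iff₀ (by positivity)] at h1
      rw [div_lt_iff₀ (by positivity)] at h2
      have e : (if 0 ≤ k then 1 else -1 : ℝ) * (n * (|k| * η)) = k * (n * η) := by
        linear_combination (n * η) * hs
      rw [e, abs_le]
      have : 0 ≤ n * η := by positivity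
      constructor <;> linarith)
  rw [freeEnergy_amp_pi_div_two] at h
  refine h.trans (add_le_add_left ?_ _)
  refine (freeEnergy_mono hk (isPrior_prodPrior hP n).isWeight (fun x => ?_) _ _ _).trans
    (freeEnergy_amp_zero hP.isWeight φ _ _ _ _).le
  simp only [binWeight]
  split_ifs
  · exact le_rfl
  · exact ((isPrior_prodPrior hP n).pos x).le

omit [Nonempty A] in
-- Fewer than `n ^ 2 / 2` noise coordinates, each with Lipschitz constant `√(lam / n) * K`, give
-- fluctuations of order `√n`, uniformly over weights and planted signals.
theorem integral_abs_logPart_sub_le {n : ℕ} {w : (Fin n → A) → ℝ} (hw : IsWeight w)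
    (hφ : ∀ b, φ b ^ 2 ≤ K) (hlam : 0 ≤ lam) (s : Pairs n → ℝ) :
    ∫ z, |logPart w (ham (pairSignal φ √(lam / n)) s (fun _ => 1) z)
        - freeEnergy w (pairSignal φ √(lam / n)) s fun _ => 1| ∂(stdGauss (Pairs n))
      ≤ √(n * lam * K ^ 2) := by
  have hA : ∀ (x : Fin n → A) (e : Pairs n), |pairSignal φ √(lam / n) x e| ≤ √(lam / n) * K :=
    fun x e => by
      rw [pairSignal, mul_assoc, abs_mul, abs_of_nonneg (Real.sqrt_nonneg _)]
      refine mul_le_mul_of_nonneg_left ?_ (Real.sqrt_nonneg _)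
      rw [abs_le]
      constructor <;> nlinarith [hφ (x e.1.1), hφ (x e.1.2),
        sq_nonneg (φ (x e.1.1) + φ (x e.1.2)), sq_nonneg (φ (x e.1.1) - φ (x e.1.2))]
  refine (integral_abs_sub_le_of_lipschitz (c := fun _ => √(lam / n) * K) (fun z z' => ?_)
    (logPart_measurable w _ s _)).trans (Real.sqrt_le_sqrt ?_)
  · simpa using abs_logPart_ham_sub_le hw hA (fun _ => 1) z z'
  · rw [Finset.sum_const, Finset.card_univ, nsmul_eq_mul, card_pairs, mul_pow,
      Real.sq_sqrt (by positivity)]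
    rcases Nat.eq_zero_or_pos n with rfl | hn
    · simp
    · have hn' : (0 : ℝ) < n := by positivity
      have : ((n : ℝ) ^ 2 - n) / 2 * (lam / n * K ^ 2) = (n - 1) / 2 * (lam * K ^ 2) := by
        field_simp
      rw [this]
      have : 0 ≤ lam * K ^ 2 := by positivity
      nlinarith

/-- The replica-symmetric upper bound. -/
theorem plantedEnergy_le (hP : IsPrior P) (hφ : ∀ b, φ b ^ 2 ≤ K) (hlam : 0 ≤ lam) {Φ : ℝ}
    (hΦ : ∀ q, 0 ≤ q → rsValue P φ lam q ≤ Φ) {η : ℝ} (hη : 0 < η) :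
    ∃ B : ℝ, ∀ n : ℕ, n ≠ 0 →
      plantedEnergy P φ lam n ≤ n * (Φ + lam * η ^ 2 / 2) + B * (1 + √n) := by
  set T := Finset.Icc (-(⌈K / η⌉ : ℤ)) ⌈K / η⌉ with hT
  set g : ℤ → A → ℝ := fun k b => siteEnergy P φ √(lam * (|k| * η))
    ((if 0 ≤ k then 1 else -1) * √(lam * (|k| * η)) * φ b) with hg
  set m : ℤ → ℝ := fun k => ∑ b, P b * g k b with hm
  set v : ℤ → ℝ := fun k => ∑ b, P b * (g k b - m k) ^ 2 with hv
  -- For negative `k` the planted value has the wrong sign, which only lowers the average site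
  -- energy; hence the supremum over `q ≥ 0` covers every window.
  have hmk : ∀ k, m k ≤ Φ + lam * (|k| * η) ^ 2 / 4 := fun k => by
    have h := hΦ (|k| * η) (by positivity)
    rw [rsValue] at h
    have h2 : m k ≤ ∑ b, P b * siteEnergy P φ √(lam * (|k| * η)) (√(lam * (|k| * η)) * φ b) := by
      simp only [hm, hg]
      split_ifs
      · simp
      · have := sum_siteEnergy_neg_le hP φ √(lam * (|k| * η))
        simpa using this
    linarith
  have hv0 : ∀ k, 0 ≤ v k := fun k =>
    Finset.sum_nonneg fun b _ => mul_nonneg (hP.pos b).le (sq_nonneg _)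
  refine ⟨Real.log (T.card) + 3 / 4 * lam * K ^ 2 + ∑ k ∈ T, (√(lam * K ^ 2) + √(v k)) ,
    fun n hn => ?_⟩
  have hn' : (0 : ℝ) < n := by positivity
  have hQ := isPrior_prodPrior hP n
  classical
  set L : (Fin n → A) → (Pairs n → ℝ) → (Fin n → A) → ℝ := fun y z =>
    ham (pairSignal φ √(lam / n)) (pairSignal φ √(lam / n) y) (fun _ => 1) z with hL
  set w : (Fin n → A) → ℤ → (Fin n → A) → ℝ := fun y k => binWeight P φ n η y k with hw
  set f : (Fin n → A) → ℤ → ℝ := fun y k => freeEnergy (w y k) (pairSignal φ √(lam / n))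
    (pairSignal φ √(lam / n) y) fun _ => 1 with hf
  -- An empty window has zero partition function and no meaningful free energy, so its deviation is
  -- set to `0`.
  set dev : (Fin n → A) → ℤ → (Pairs n → ℝ) → ℝ := fun y k z =>
    if IsWeight (w y k) then |logPart (w y k) (L y z) - f y k| else 0 with hdev
  have hdev0 : ∀ y k z, 0 ≤ dev y k z := fun y k z => by
    simp only [hdev]; split_ifs
    · exact abs_nonneg _
    · exact le_rfl
  have hdevi : ∀ y k, Integrable (dev y k) (stdGauss _) := fun y k => by
    by_cases h : IsWeight (w y k)
    · simp only [hdev, if_pos h]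
      exact ((integrable_logPart_ham h _ _ _).sub' (integrable_const _)).abs
    · simp only [hdev, if_neg h]
      exact integrable_zero _ _ _
  have hdevle : ∀ y k, ∫ z, dev y k z ∂(stdGauss _) ≤ √n * √(lam * K ^ 2) := fun y k => by
    rw [← Real.sqrt_mul hn'.le, ← mul_assoc]
    by_cases h : IsWeight (w y k)
    · simp only [hdev, if_pos h]
      exact integral_abs_logPart_sub_le h hφ hlam _
    · simp only [hdev, if_neg h, integral_zero]
      positivity
  set B₀ : (Fin n → A) → ℝ := fun y => Real.log T.card
    + (n * (Φ + lam * η ^ 2 / 2) + 3 / 4 * lam * K ^ 2)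
    + ∑ k ∈ T, |∑ i, (g k (y i) - m k)| with hB₀
  have hfle : ∀ y k, k ∈ T → IsWeight (w y k) → Real.log T.card + f y k ≤ B₀ y := fun y k hk hwk => by
    have h := freeEnergy_binWeight_le hP hφ hlam hn hη y k hwk
    have h1 : ∑ i, g k (y i) = n * m k + ∑ i, (g k (y i) - m k) := by
      rw [Finset.sum_sub_distrib]; simp
    have h2 : ∑ i, (g k (y i) - m k) ≤ ∑ k ∈ T, |∑ i, (g k (y i) - m k)| :=
      (le_abs_self _).trans (Finset.single_le_sum (f := fun k => |∑ i, (g k (y i) - m k)|)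
        (fun _ _ => abs_nonneg _) hk)
    have h3 := mul_le_mul_of_nonneg_left (hmk k) hn'.le
    have h4 : f y k ≤ ∑ i, g k (y i)
      + (lam * n * (η ^ 2 / 2 - (|k| * η) ^ 2 / 4) + 3 / 4 * lam * K ^ 2) := h
    simp only [hB₀]
    linarith
  have hpt : ∀ y z, logPart (prodPrior P n) (L y z) ≤ B₀ y + ∑ k ∈ T, dev y k z := fun y z => by
    have hpart : part (prodPrior P n) (L y z) = ∑ k ∈ T, part (w y k) (L y z) := by
      simp only [part]
      rw [Finset.sum_comm]
      refine Finset.sum_congr rfl fun x _ => ?_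
      rw [← Finset.sum_mul, ← sum_binWeight P hφ hn hη x y]
    have hTne : T.Nonempty := by
      by_contra h
      rw [Finset.not_nonempty_iff_eq_empty] at h
      rw [h, Finset.sum_empty] at hpart
      exact (part_pos hQ.isWeight _).ne' hpart
    -- The heaviest window carries at least the fraction `1 / T.card` of the partition function. It
    -- depends on the noise, so the deviations of all windows are summed.
    obtain ⟨k, hk, hmax⟩ := T.exists_max_image (fun k => part (w y k) (L y z)) hTne
    have hle : part (prodPrior P n) (L y z) ≤ T.card * part (w y k) (L y z) := by
      rw [hpart, ← nsmul_eq_mul]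
      exact Finset.sum_le_card_nsmul _ _ _ hmax
    have hcard : (0 : ℝ) < T.card := by exact_mod_cast hTne.card_pos
    have hpos : 0 < part (w y k) (L y z) :=
      pos_of_mul_pos_right ((part_pos hQ.isWeight _).trans_le hle) hcard.le
    have hnn : ∀ x, 0 ≤ w y k x := fun x => by
      simp only [hw, binWeight]; split_ifs
      · exact (hQ.pos x).le
      · exact le_rfl
    have hwk : IsWeight (w y k) := by
      refine ⟨hnn, ?_⟩
      by_contra! h
      have h0 : ∀ x, w y k x = 0 := fun x => le_antisymm (h x) (hnn x)
      simp [part, h0] at hpos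
    have h1 : logPart (prodPrior P n) (L y z) ≤ Real.log T.card + logPart (w y k) (L y z) := by
      rw [logPart, logPart, ← Real.log_mul hcard.ne' hpos.ne']
      exact Real.log_le_log (part_pos hQ.isWeight _) hle
    have h2 : logPart (w y k) (L y z) - f y k ≤ ∑ k ∈ T, dev y k z := by
      refine le_trans ?_ (Finset.single_le_sum (f := fun k => dev y k z)
        (fun k _ => hdev0 y k z) hk)
      simp only [hdev, if_pos hwk]
      exact le_abs_self _
    linarith [hfle y k hk hwk]
  have hint : ∀ y, freeEnergy (prodPrior P n) (pairSignal φ √(lam / n))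
      (pairSignal φ √(lam / n) y) (fun _ => 1) ≤ B₀ y + ∑ _k ∈ T, √n * √(lam * K ^ 2) := fun y => by
    refine (integral_mono (integrable_logPart_ham hQ.isWeight _ _ _)
      ((integrable_const _).fun_add (integrable_finsetSum _ fun k _ => hdevi y k))
      fun z => hpt y z).trans ?_
    rw [integral_add (integrable_const _) (integrable_finsetSum _ fun k _ => hdevi y k),
      integral_finsetSum _ fun k _ => hdevi y k, integral_const, probReal_univ, one_smul]
    exact add_le_add_right (Finset.sum_le_sum fun k _ => hdevle y k) _
  have hdev2 : ∀ k, ∑ y, prodPrior P n y * |∑ i, (g k (y i) - m k)| ≤ √n * √(v k) := fun k => by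
    rw [← Real.sqrt_mul hn'.le]
    refine sum_prodPrior_abs_sum_le hP n (f := fun b => g k b - m k) ?_
    simp [mul_sub, Finset.sum_sub_distrib, ← Finset.sum_mul, hP.sum_eq_one, hm]
  have hB₀sum : ∑ y, prodPrior P n y * B₀ y ≤ Real.log T.card
      + (n * (Φ + lam * η ^ 2 / 2) + 3 / 4 * lam * K ^ 2) + ∑ k ∈ T, √n * √(v k) := by
    have h : ∀ y, prodPrior P n y * B₀ y = prodPrior P n y * (Real.log T.card
        + (n * (Φ + lam * η ^ 2 / 2) + 3 / 4 * lam * K ^ 2))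
        + ∑ k ∈ T, prodPrior P n y * |∑ i, (g k (y i) - m k)| := fun y => by
      rw [hB₀, mul_add, Finset.mul_sum]
    simp_rw [h]
    rw [Finset.sum_add_distrib, ← Finset.sum_mul, hQ.sum_eq_one, one_mul, Finset.sum_comm]
    exact add_le_add_right (Finset.sum_le_sum fun k _ => hdev2 k) _
  have hfin : plantedEnergy P φ lam n ≤ ∑ y, prodPrior P n y
      * (B₀ y + ∑ _k ∈ T, √n * √(lam * K ^ 2)) :=
    Finset.sum_le_sum fun y _ => mul_le_mul_of_nonneg_left (hint y) (hQ.pos y).le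
  simp only [mul_add (prodPrior P n _), Finset.sum_add_distrib, ← Finset.sum_mul,
    hQ.sum_eq_one, one_mul, Finset.sum_const, nsmul_eq_mul] at hfin
  simp only [Finset.sum_add_distrib, ← Finset.mul_sum, Finset.sum_const, nsmul_eq_mul] at hB₀sum ⊢
  have hlog : 0 ≤ Real.log (T.card : ℝ) := Real.log_natCast_nonneg _
  have hs1 : 0 ≤ ∑ k ∈ T, √(v k) := Finset.sum_nonneg fun _ _ => Real.sqrt_nonneg _
  have hs2 : 0 ≤ (T.card : ℝ) * √(lam * K ^ 2) := by positivity
  have hsn := Real.sqrt_nonneg (n : ℝ)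
  have h5 : 0 ≤ 3 / 4 * lam * K ^ 2 := by positivity
  have := mul_nonneg hlog hsn
  have := mul_nonneg h5 hsn
  linarith

end ReplicaSymmetric

end

end SBM

namespace SBM

noncomputable section

/-! ### The two models as mixtures with explicit likelihoods -/

section Laws

/-- The weights of the two labels. -/
def labelWeight (p : I) : Fin 2 → ℝ := ![p, 1 - p]

theorem isPrior_labelWeight {p : I} (hp0 : 0 < p) (hp1 : p < 1) : IsPrior (labelWeight p) := by
  have h0 : (0 : ℝ) < p := hp0
  have h1 : (p : ℝ) < 1 := hp1
  refine ⟨fun b => ?_, by simp [labelWeight]⟩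
  fin_cases b
  · simpa [labelWeight] using h0
  · simpa [labelWeight] using h1

theorem bernoulliMeasure_eq {X : Type*} [MeasurableSpace X] (x y : X) (p : I) :
    bernoulliMeasure x y p = ENNReal.ofReal p • Measure.dirac x
      + ENNReal.ofReal (1 - p) • Measure.dirac y := by
  have h1 : ENNReal.ofReal p = (unitInterval.toNNReal p : ℝ≥0∞) :=
    ENNReal.ofReal_eq_coe_nnreal p.2.1
  have h2 : ENNReal.ofReal (1 - p) = (unitInterval.toNNReal (unitInterval.symm p) : ℝ≥0∞) :=
    ENNReal.ofReal_eq_coe_nnreal (unitInterval.symm p).2.1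
  rw [bernoulliMeasure_def, h1, h2]
  rfl

instance (p : I) : IsProbabilityMeasure (labelLaw p) := by unfold labelLaw; infer_instance

theorem labelLaw_singleton (p : I) (b : Fin 2) :
    labelLaw p {b} = ENNReal.ofReal (labelWeight p b) := by
  rw [labelLaw, bernoulliMeasure_eq]
  fin_cases b <;> simp [labelWeight]

theorem labelsLaw_singleton {p : I} (hp0 : 0 < p) (hp1 : p < 1) {n : ℕ} (x : Fin n → Fin 2) :
    labelsLaw p n {x} = ENNReal.ofReal (prodPrior (labelWeight p) n x) := by
  rw [labelsLaw, Measure.pi_singleton, prodPrior, ENNReal.ofReal_prod_of_nonneg fun i _ =>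
    ((isPrior_labelWeight hp0 hp1).pos _).le]
  simp_rw [labelLaw_singleton]

theorem lintegral_labelsLaw {p : I} (hp0 : 0 < p) (hp1 : p < 1) {n : ℕ}
    (f : (Fin n → Fin 2) → ℝ≥0∞) :
    ∫⁻ x, f x ∂(labelsLaw p n)
      = ∑ x, ENNReal.ofReal (prodPrior (labelWeight p) n x) * f x := by
  rw [lintegral_fintype]
  exact Finset.sum_congr rfl fun x _ => by rw [labelsLaw_singleton hp0 hp1, mul_comm]

theorem mixture_apply_preimage {S Ω α : Type*} [Fintype S] [MeasurableSpace Ω]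
    [MeasurableSpace α] (P : S → ℝ) (g : S → α) (D : S → Ω → ℝ) (m : Measure Ω) [SFinite m]
    {A : Set (α × Ω)} (hA : MeasurableSet A) :
    mixture P g D m A = ∑ x, ENNReal.ofReal (P x)
      * (m.withDensity fun ω => ENNReal.ofReal (D x ω)) (Prod.mk (g x) ⁻¹' A) := by
  simp only [mixture, Measure.coe_finsetSum, Finset.sum_apply, Measure.smul_apply, smul_eq_mul]
  refine Finset.sum_congr rfl fun x _ => ?_
  rw [Measure.prod_apply hA, lintegral_dirac' _ (measurable_measure_prodMk_left hA)]

theorem bernoulliMeasure_eq_withDensity {S : Type*} (M : S → I) (x : S) :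
    bernoulliMeasure true false (M x)
      = fairCoin.withDensity fun b => ENNReal.ofReal (bernLik (fun x => (M x : ℝ)) x b) := by
  have h1 : (0 : ℝ) ≤ 2 * (M x : ℝ) := mul_nonneg two_pos.le (M x).2.1
  have h2 : (0 : ℝ) ≤ 2 * (1 - (M x : ℝ)) := mul_nonneg two_pos.le (sub_nonneg.2 (M x).2.2)
  have hcoin : ∀ b, fairCoin {b} = ENNReal.ofReal (1 / 2) := fun b => by
    rw [fairCoin, bernoulliMeasure_eq]
    cases b <;> simp
    rw [show (1 - 2⁻¹ : ℝ) = 2⁻¹ by norm_num, ENNReal.ofReal_inv_of_pos two_pos,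
      ENNReal.ofReal_ofNat]
  refine Measure.ext_of_singleton fun b => ?_
  rw [withDensity_apply _ (measurableSet_singleton b), lintegral_singleton, hcoin,
    bernoulliMeasure_eq]
  cases b
  · simp only [bernLik, Bool.false_eq_true, if_false]
    rw [← ENNReal.ofReal_mul h2]
    simp
    congr 1
    ring
  · simp only [bernLik, if_true]
    rw [← ENNReal.ofReal_mul h1]
    simp
    congr 1
    ring

/-- Independent fair coins serve as the reference law for the graph, whose conditional density given
the labels is a product over pairs. -/
theorem sbmLaw_eq_mixture {p : I} (hp0 : 0 < p) (hp1 : p < 1) (M : Matrix (Fin 2) (Fin 2) I)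
    (n : ℕ) :
    sbmLaw M n p = mixture (prodPrior (labelWeight p) n) id
      (prodLik Finset.univ fun e : Pairs n =>
        bernLik fun x : Fin n → Fin 2 => (M (x e.1.1) (x e.1.2) : ℝ))
      (Measure.pi fun _ => fairCoin) := by
  have : IsSFiniteKernel (edgeKernel M n) := by
    have : IsMarkovKernel (edgeKernel M n) := ⟨fun x => by
      change IsProbabilityMeasure (Measure.pi fun e : Pairs n =>
        bernoulliMeasure true false (M (x e.1.1) (x e.1.2)))
      infer_instance⟩
    infer_instance
  ext A hA
  rw [sbmLaw, Measure.compProd_apply hA, lintegral_labelsLaw hp0 hp1, mixture_apply_preimage _ _ _ _ hA]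
  refine Finset.sum_congr rfl fun x _ => ?_
  congr 2
  change Measure.pi (fun e : Pairs n => bernoulliMeasure true false (M (x e.1.1) (x e.1.2))) = _
  have hb := fun e : Pairs n => bernoulliMeasure_eq_withDensity
    (fun x : Fin n → Fin 2 => M (x e.1.1) (x e.1.2)) x
  have : ∀ e : Pairs n, SigmaFinite (fairCoin.withDensity fun b => ENNReal.ofReal
      (bernLik (fun x : Fin n → Fin 2 => (M (x e.1.1) (x e.1.2) : ℝ)) x b)) := fun e => by
    rw [← hb e]; infer_instance
  simp_rw [hb]
  rw [pi_withDensity _ fun e => measurable_of_finite _]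
  congr 1
  ext ω
  rw [prodLik, ENNReal.ofReal_prod_of_nonneg fun e _ =>
    (isLikelihood_bernLik (fun x => (M (x e.1.1) (x e.1.2)).2)).nonneg x _]

theorem prodLik_gaussLik {S ι : Type*} [Fintype ι] (a : S → ι → ℝ) (x : S) (z : ι → ℝ) :
    prodLik Finset.univ (fun e => gaussLik fun x => a x e) x z
      = Real.exp (∑ e, (a x e * z e - a x e ^ 2 / 2)) := by
  rw [prodLik, Real.exp_sum]
  rfl

/-- The reference law is pure noise; the Cameron–Martin shift gives the conditional density of `Y`.
-/
theorem channelLaw_eq_mixture {p : I} (hp0 : 0 < p) (hp1 : p < 1) (lam : ℝ) (n : ℕ) :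
    channelLaw p lam n = mixture (prodPrior (labelWeight p) n) (fun x i => phi p (x i))
      (prodLik Finset.univ fun e : Pairs n =>
        gaussLik fun x : Fin n → Fin 2 => pairSignal (phi p) √(lam / n) x e)
      (stdGauss (Pairs n)) := by
  have hF : Measurable fun xz : (Fin n → Fin 2) × (Pairs n → ℝ) =>
      ((fun i => phi p (xz.1 i) : Fin n → ℝ),
      (fun e => √(lam / n) * phi p (xz.1 e.1.1) * phi p (xz.1 e.1.2) + xz.2 e : Pairs n → ℝ)) := by
    have hphi : Measurable (phi p) := measurable_of_finite _
    fun_prop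
  ext A hA
  rw [channelLaw, Measure.map_apply hF hA, Measure.prod_apply (hF hA), lintegral_labelsLaw hp0 hp1,
    mixture_apply_preimage _ _ _ _ hA]
  refine Finset.sum_congr rfl fun x _ => ?_
  congr 1
  simp_rw [prodLik_gaussLik]
  rw [← stdGauss_map_add, Measure.map_apply (by fun_prop) (measurable_prodMk_left hA)]
  congr 1
  ext z
  simp only [Set.mem_preimage, pairSignal]
  simp_rw [add_comm (z _)]

theorem phi_injective {p : I} (hp0 : 0 < p) (hp1 : p < 1) : Function.Injective (phi p) := by
  have h0 : (0 : ℝ) < p := hp0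
  have h1 : (0 : ℝ) < 1 - p := sub_pos.2 hp1
  have h2 : 0 < √((1 - p) / p : ℝ) := Real.sqrt_pos.2 (div_pos h1 h0)
  have h3 : 0 ≤ √(p / (1 - p) : ℝ) := Real.sqrt_nonneg _
  intro a b hab
  fin_cases a <;> fin_cases b <;> simp [phi] at hab ⊢ <;> linarith

theorem mutualInfo_sbmLaw {p : I} (hp0 : 0 < p) (hp1 : p < 1) (M : Matrix (Fin 2) (Fin 2) I)
    (n : ℕ) :
    mutualInfo (sbmLaw M n p) ≠ ∞ ∧ (mutualInfo (sbmLaw M n p)).toReal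
      = info (prodPrior (labelWeight p) n) (prodLik Finset.univ fun e : Pairs n =>
        bernLik fun x : Fin n → Fin 2 => (M (x e.1.1) (x e.1.2) : ℝ))
        (Measure.pi fun _ => fairCoin) := by
  rw [sbmLaw_eq_mixture hp0 hp1]
  exact mutualInfo_mixture Function.injective_id
    (isPrior_prodPrior (isPrior_labelWeight hp0 hp1) n)
    (isLikelihood_prodLik (fun e => isLikelihood_bernLik fun x => (M _ _).2) _)

theorem mutualInfo_channelLaw {p : I} (hp0 : 0 < p) (hp1 : p < 1) (lam : ℝ) (n : ℕ) :
    mutualInfo (channelLaw p lam n) ≠ ∞ ∧ (mutualInfo (channelLaw p lam n)).toReal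
      = info (prodPrior (labelWeight p) n) (prodLik Finset.univ fun e : Pairs n =>
        gaussLik fun x : Fin n → Fin 2 => pairSignal (phi p) √(lam / n) x e)
        (stdGauss (Pairs n)) := by
  rw [channelLaw_eq_mixture hp0 hp1]
  refine mutualInfo_mixture (fun x y h => ?_)
    (isPrior_prodPrior (isPrior_labelWeight hp0 hp1) n)
    (isLikelihood_prodLik (fun e => isLikelihood_gaussLik _) _)
  ext1 i
  exact phi_injective hp0 hp1 (congrFun h i)

end Laws

/-! ### Identification of the potential -/

section Potential

theorem phi_sq {p : I} (hp0 : 0 < p) (hp1 : p < 1) :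
    phi p 0 ^ 2 = (1 - p) / p ∧ phi p 1 ^ 2 = p / (1 - p) ∧ phi p 0 * phi p 1 = -1 := by
  have h0 : (0 : ℝ) < p := hp0
  have h1 : (0 : ℝ) < 1 - p := sub_pos.2 hp1
  refine ⟨?_, ?_, ?_⟩
  · simp [phi, Real.sq_sqrt (div_pos h1 h0).le]
  · simp [phi, Real.sq_sqrt (div_pos h0 h1).le]
  · simp only [phi, Matrix.cons_val_zero, Matrix.cons_val_one]
    rw [mul_neg, ← Real.sqrt_mul (div_pos h1 h0).le,
      show ((1 - p) / p * (p / (1 - p)) : ℝ) = 1 by field_simp, Real.sqrt_one]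

/-- Substituting the squares `(1 - p) / p` and `p / (1 - p)` of the labels turns the exponents into
the energy of a scalar channel with signal-to-noise ratio `lam * q`. -/
theorem logPartition_eq {p : I} (hp0 : 0 < p) (hp1 : p < 1) {lam q : ℝ} (hq : 0 ≤ lam * q)
    (X Z : ℝ) :
    logPartition p lam q X Z = logPart (labelWeight p) fun b =>
      √(lam * q) * phi p b * Z + (√(lam * q) * phi p b * (√(lam * q) * X)
        - (√(lam * q) * phi p b) ^ 2 / 2) := by
  obtain ⟨h1, h2, -⟩ := phi_sq hp0 hp1
  have hr := Real.sq_sqrt hq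
  have h0' : (0 : ℝ) < p := hp0
  have h1' : (0 : ℝ) < 1 - p := sub_pos.2 hp1
  rw [logPartition, logPart, part, Fin.sum_univ_two]
  have e0 : phi p 0 = √((1 - p) / p) := by simp [phi]
  have e1 : phi p 1 = -√(p / (1 - p)) := by simp [phi]
  rw [← e0, ← e1]
  simp only [mul_pow, h1, h2, hr]
  congr 1
  simp only [labelWeight, Matrix.cons_val_zero, Matrix.cons_val_one]
  congr 3
  · field_simp
    linear_combination (-2 * X * phi p 0 * p) * hr
  · field_simp
    linear_combination (-2 * X * phi p 1 * (1 - p)) * hr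

theorem rsPotential_eq {p : I} (hp0 : 0 < p) (hp1 : p < 1) {lam q : ℝ} (hq : 0 ≤ lam * q) :
    rsPotential p lam q = rsValue (labelWeight p) (phi p) lam q := by
  have hP := isPrior_labelWeight hp0 hp1
  have h1' : (0 : ℝ) ≤ 1 - p := (sub_pos.2 (show (p : ℝ) < 1 from hp1)).le
  rw [rsPotential, rsValue]
  congr 1
  have hphi : Measurable (phi p) := measurable_of_finite _
  have hm : Measurable fun w : ℝ × ℝ => logPartition p lam q w.1 w.2 := by
    unfold logPartition; fun_prop
  have hi : ∀ b, Integrable (fun w : ℝ × ℝ => logPartition p lam q w.1 w.2)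
      ((Measure.dirac (phi p b)).prod (gaussianReal 0 1)) := fun b => by
    rw [Measure.dirac_prod, integrable_map_measure hm.aestronglyMeasurable (by fun_prop)]
    simp only [Function.comp_def, logPartition_eq hp0 hp1 hq]
    exact integrable_siteLog hP.isWeight _ _ _
  have he : ∀ b, ∫ w, logPartition p lam q w.1 w.2
      ∂((Measure.dirac (phi p b)).prod (gaussianReal 0 1))
      = siteEnergy (labelWeight p) (phi p) √(lam * q) (√(lam * q) * phi p b) := fun b => by
    rw [Measure.dirac_prod, integral_map (by fun_prop) hm.aestronglyMeasurable]
    simp only [logPartition_eq hp0 hp1 hq]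
    rfl
  have ht : tildePrior p = ENNReal.ofReal p • Measure.dirac (phi p 0)
      + ENNReal.ofReal (1 - p) • Measure.dirac (phi p 1) := by
    rw [tildePrior, labelLaw, bernoulliMeasure_eq, Measure.map_add _ _ hphi, Measure.map_smul,
      Measure.map_smul, Measure.map_dirac' hphi, Measure.map_dirac' hphi]
  rw [ht, Measure.add_prod, Measure.prod_smul_left, Measure.prod_smul_left,
    integral_add_measure ((hi 0).smul_measure ENNReal.ofReal_ne_top)
      ((hi 1).smul_measure ENNReal.ofReal_ne_top), integral_smul_measure, integral_smul_measure,
    he, he, Fin.sum_univ_two, ENNReal.toReal_ofReal p.2.1, ENNReal.toReal_ofReal h1']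
  simp [labelWeight]

end Potential

/-! ### Information and free energy of the Gaussian channel -/

section GaussianChannel

/-- The mutual information of the rank-one Gaussian channel in terms of its free energy. -/
theorem info_channel {A : Type*} [Fintype A] [Nonempty A] {P φ : A → ℝ} (hP : IsPrior P)
    (h2 : ∑ b, P b * φ b ^ 2 = 1) {lam : ℝ} (hlam : 0 ≤ lam) {n : ℕ} (hn : n ≠ 0) :
    info (prodPrior P n) (prodLik Finset.univ fun e : Pairs n =>
        gaussLik fun x : Fin n → A => pairSignal φ √(lam / n) x e) (stdGauss (Pairs n))
      = lam * (n - 1) / 4 - plantedEnergy P φ lam n := by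
  have hn' : (0 : ℝ) < n := by positivity
  have hQ := isPrior_prodPrior hP n
  set a : (Fin n → A) → Pairs n → ℝ := pairSignal φ √(lam / n) with ha
  set L : (Fin n → A) → (Pairs n → ℝ) → ℝ :=
    prodLik Finset.univ fun e : Pairs n => gaussLik fun x => a x e with hL
  have hLe : ∀ x z, L x z = Real.exp (∑ e, (a x e * z e - a x e ^ 2 / 2)) := fun x z =>
    prodLik_gaussLik a x z
  have hlik : IsLikelihood L (stdGauss (Pairs n)) :=
    isLikelihood_prodLik (fun e => isLikelihood_gaussLik _) _
  have hlin : ∀ x, Measurable fun z : Pairs n → ℝ => ∑ e, (a x e * z e - a x e ^ 2 / 2) :=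
    fun x => by fun_prop
  have hev : ∀ e : Pairs n, Integrable (fun z : Pairs n → ℝ => z e) (stdGauss _) := fun e =>
    (memLp_eval_stdGauss e).integrable (by norm_num)
  have hsi : ∀ x, Integrable (fun z : Pairs n → ℝ => ∑ e, (a x e * (z e + a x e) - a x e ^ 2 / 2))
      (stdGauss _) := fun x => integrable_finsetSum _ fun e _ =>
    (((hev e).fun_add (integrable_const _)).const_mul _).sub' (integrable_const _)
  have hev0 : ∀ e : Pairs n, ∫ z : Pairs n → ℝ, z e ∂(stdGauss _) = 0 := fun e => by
    have hmp := measurePreserving_eval (fun _ : Pairs n => gaussianReal 0 1) e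
    have := integral_map (μ := stdGauss (Pairs n)) (f := fun y : ℝ => y)
      hmp.measurable.aemeasurable (by fun_prop)
    rw [hmp.map_eq, integral_id_gaussianReal] at this
    exact this.symm
  have hint : ∀ x, Integrable (fun z => L x z * Real.log (L x z)) (stdGauss _) := fun x => by
    simp_rw [hLe, Real.log_exp]
    exact (integrable_stdGauss_add_iff (a x) (hlin x)).1 (hsi x)
  have hLL : ∀ x, ∫ z, L x z * Real.log (L x z) ∂(stdGauss _) = ∑ e, a x e ^ 2 / 2 := fun x => by
    simp_rw [hLe, Real.log_exp]
    rw [← integral_stdGauss_add (a x) (hlin x), integral_finsetSum _ fun e _ =>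
      (((hev e).fun_add (integrable_const _)).const_mul _).sub' (integrable_const _)]
    refine Finset.sum_congr rfl fun e _ => ?_
    rw [integral_sub (((hev e).fun_add (integrable_const _)).const_mul _) (integrable_const _),
      integral_const_mul, integral_add (hev e) (integrable_const _), hev0]
    simp
    ring
  have hpart : ∀ z, evidence (prodPrior P n) L z = part (prodPrior P n) (ham a 0 (fun _ => 1) z) :=
    fun z => by
      simp only [evidence, part, hLe, ham_eq, one_mul]
  -- The evidence weight is absorbed into the planted average by Cameron–Martin.
  have hEE : ∫ z, evidence (prodPrior P n) L z * Real.log (evidence (prodPrior P n) L z)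
      ∂(stdGauss _) = plantedEnergy P φ lam n := by
    have h := sum_integral_planted hQ.isWeight a (fun _ => 1)
      (F := fun _ z => logPart (prodPrior P n) (ham a 0 (fun _ => 1) z))
      (fun _ => logPart_measurable _ _ _ _) (fun x => by
        have := integrable_logPart_ham hQ.isWeight a (a x) fun _ => 1
        have he : ∀ z, ham a (a x) (fun _ => 1) z
            = ham a 0 (fun _ => 1) fun e => z e + 1 * a x e := fun z => by
          ext y; exact ham_planted a (fun _ => 1) y x z
        simpa only [he] using this)
    simp_rw [gmean_const hQ.isWeight] at h
    simp_rw [hpart]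
    rw [plantedEnergy]
    refine h.symm.trans (Finset.sum_congr rfl fun y _ => ?_)
    rw [freeEnergy]
    congr 2
    ext z
    congr 1
    ext x
    exact (ham_planted a (fun _ => 1) x y z).symm
  rw [(info_eq hQ hlik (fun x z => by rw [hLe]; exact Real.exp_pos _) hint).2, hEE]
  congr 1
  simp_rw [hLL, Finset.mul_sum]
  rw [Finset.sum_comm]
  -- The two ends of a pair are independent labels of second moment `1`, so each of the `n (n - 1) /
  -- 2` pairs contributes `lam / (2 n)`.
  have hone : ∀ e : Pairs n, ∑ x, prodPrior P n x * (a x e ^ 2 / 2) = lam / n / 2 := fun e => by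
    have : ∀ x, prodPrior P n x * (a x e ^ 2 / 2)
        = lam / n / 2 * (prodPrior P n x * (φ (x e.1.1) ^ 2 * φ (x e.1.2) ^ 2)) := fun x => by
      simp only [ha, pairSignal, mul_pow]
      rw [Real.sq_sqrt (by positivity)]
      ring
    simp_rw [this, ← Finset.mul_sum]
    rw [sum_prodPrior_mul_mul hP e.2.ne (fun b => φ b ^ 2) fun b => φ b ^ 2, h2]
    simp
  simp_rw [hone]
  rw [Finset.sum_const, Finset.card_univ, nsmul_eq_mul, card_pairs]
  field_simp
  ring

end GaussianChannel

end

end SBM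

namespace SBM

noncomputable section

/-! ### Bernoulli channels against Gaussian channels -/

section Comparison

theorem wvar_const_mul {S : Type*} [Fintype S] (q u : S → ℝ) (c : ℝ) :
    wvar q (fun x => c * u x) = c ^ 2 * wvar q u := by
  simp only [wvar, mul_pow, mul_left_comm _ c, mul_left_comm _ (c ^ 2), ← Finset.mul_sum]
  ring

/-- Comparison of the sparse Bernoulli channel with the Gaussian channel. -/
theorem abs_info_bernLik_sub_info_gaussLik_le {S E : Type*} [Fintype S] [Fintype E] [Nonempty S]
    {P : S → ℝ} (hP : IsPrior P) (u : E → S → ℝ) {δ ε κ K s : ℝ} (hδ : 0 < δ)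
    (hκ : κ ≤ 1 / 2) (hδκ : δ * (1 + κ) ≤ 1 / 2) (hs : 0 < s) (hδε : δ * ε ^ 2 = s) (hK : 0 < K)
    (hu : ∀ e x, |u e x| ≤ K) (hεκ : |ε| * K ≤ κ) (hsK : 6 * (s * K ^ 2) ≤ 1) :
    |info P (prodLik Finset.univ fun e => bernLik fun x => δ * (1 + ε * u e x))
        (Measure.pi fun _ => fairCoin)
      - info P (prodLik Finset.univ fun e => gaussLik fun x => √s * u e x) (stdGauss E)|
      ≤ (4 * κ + 4 * δ) * Real.log (Fintype.card S) + Fintype.card E * (41 * (√s * K) ^ 3) := by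
  classical
  have hκ0 : 0 ≤ κ := (by positivity : 0 ≤ |ε| * K).trans hεκ
  have huκ : ∀ e x, |ε * u e x| ≤ κ := fun e x => by
    rw [abs_mul]
    exact (mul_le_mul_of_nonneg_left (hu e x) (abs_nonneg _)).trans hεκ
  have hM : ∀ e x, δ * (1 + ε * u e x) ∈ Set.Ioo (0 : ℝ) 1 := fun e x => by
    have h := abs_le.1 (huκ e x)
    have h1 : δ * (1 + ε * u e x) ≤ δ * (1 + κ) := by gcongr; exact h.2
    exact ⟨mul_pos hδ (by linarith), by linarith⟩
  have hb : ∀ e, IsLikelihood (bernLik fun x => δ * (1 + ε * u e x)) fairCoin := fun e =>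
    isLikelihood_bernLik fun x => Set.Ioo_subset_Icc_self (hM e x)
  have hg : ∀ e, IsLikelihood (gaussLik fun x => √s * u e x) (gaussianReal 0 1) := fun e =>
    isLikelihood_gaussLik _
  -- Every edge receives both a coin and a Gaussian variable, and each channel reads only one of
  -- them; hybrid channels then live on one space.
  set ν : Measure (Bool × ℝ) := fairCoin.prod (gaussianReal 0 1) with hν
  have hfst : MeasurePreserving Prod.fst ν fairCoin := measurePreserving_fst
  have hsnd : MeasurePreserving Prod.snd ν (gaussianReal 0 1) := measurePreserving_snd
  set l : E → S → Bool × ℝ → ℝ := fun e x w => bernLik (fun x => δ * (1 + ε * u e x)) x w.1 with hl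
  set l' : E → S → Bool × ℝ → ℝ := fun e x w => gaussLik (fun x => √s * u e x) x w.2 with hl'
  have hpi1 : MeasurePreserving (fun (ω : E → Bool × ℝ) e => (ω e).1) (Measure.pi fun _ => ν)
      (Measure.pi fun _ => fairCoin) := measurePreserving_pi _ _ fun _ => hfst
  have hpi2 : MeasurePreserving (fun (ω : E → Bool × ℝ) e => (ω e).2) (Measure.pi fun _ => ν)
      (stdGauss E) := measurePreserving_pi _ _ fun _ => hsnd
  rw [← info_comp (P := P) hpi1 (isLikelihood_prodLik hb Finset.univ),
    ← info_comp (P := P) hpi2 (isLikelihood_prodLik hg Finset.univ)]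
  have comp_likelihood : ∀ {W : Type} [MeasurableSpace W] {μ : Measure W} {T : Bool × ℝ → W}
      {L : S → W → ℝ}, MeasurePreserving T ν μ → IsLikelihood L μ →
      IsLikelihood (fun x w => L x (T w)) ν := by
    intro W _ μ T L hT hL
    refine ⟨fun x => (hL.measurable x).comp hT.measurable, fun x w => hL.nonneg x _,
      fun x => hT.integrable_comp_of_integrable (hL.integrable x), fun x => ?_⟩
    rw [← hL.integral_eq_one x, ← hT.map_eq, integral_map hT.measurable.aemeasurable
      (hL.measurable x).aestronglyMeasurable]
  have i1 : ∀ e (q : S → ℝ), info q (l e) ν = info q (bernLik fun x => δ * (1 + ε * u e x)) fairCoin :=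
    fun e q => info_comp hfst (hb e)
  have i2 : ∀ e (q : S → ℝ), info q (l' e) ν
      = info q (gaussLik fun x => √s * u e x) (gaussianReal 0 1) :=
    fun e q => info_comp hsnd (hg e)
  have hwv : ∀ e q, IsPrior q → 0 ≤ wvar q (u e) := fun e q hq =>
    wvar_nonneg q _ (fun x => (hq.pos x).le) hq.sum_eq_one
  -- As `κ ≤ 1 / 2`, a Bernoulli edge carries at least `s / 4` times the variance. The discrepancy
  -- `s * (κ + δ)` of the variance coefficients is `4 * (κ + δ)` times that, whence `c`.
  have key := abs_info_sub_info_le (ν := ν) hP (l := l) (l' := l')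
    (fun e => comp_likelihood hfst (hb e)) (fun e => comp_likelihood hsnd (hg e))
    (fun e x w => bernLik_pos (hM e) x _) (fun e x w => Real.exp_pos _) u (s := s / 4)
    (c := 4 * κ + 4 * δ) (err := 41 * (√s * K) ^ 3) (by positivity) (by positivity)
    (fun e q hq => by
      rw [i1]
      refine le_trans ?_ (info_bernLik_bounds hq hδ hκ hδκ (huκ e)).1
      rw [hδε]
      refine mul_le_mul_of_nonneg_right ?_ (hwv e q hq)
      nlinarith)
    (fun e q hq => by
      rw [i1, i2]
      obtain ⟨h1, h2⟩ := info_bernLik_bounds hq hδ hκ hδκ (huκ e)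
      rw [hδε] at h1 h2
      have h3 := abs_le.1 (abs_info_gaussLik_sub_le (a := fun x => √s * u e x) hq
        (r := √s * K) (by positivity)
        (by rw [mul_pow, Real.sq_sqrt hs.le]; exact hsK)
        (fun x => by
          rw [abs_mul, abs_of_nonneg (Real.sqrt_nonneg _)]
          exact mul_le_mul_of_nonneg_left (hu e x) (Real.sqrt_nonneg _)))
      rw [wvar_const_mul, Real.sq_sqrt hs.le] at h3
      have hw := mul_nonneg hs.le (hwv e q hq)
      have hw1 := mul_nonneg hκ0 hw
      have hw2 := mul_nonneg hδ.le hw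
      rw [abs_le]
      constructor
      · linarith [h3.1, h3.2]
      · linarith [h3.1, h3.2])
  exact key

end Comparison

/-! ### Limit of the free energy per site -/

section Asymptotics

variable {A : Type*} [Fintype A] [Nonempty A] {P φ : A → ℝ} {K lam : ℝ}

/-- The replica-symmetric lower bound at `n = 1` already bounds the potential by a number
independent of `q`. -/
theorem bddAbove_rsValue (hP : IsPrior P) (hφ : ∀ b, φ b ^ 2 ≤ K) (hlam : 0 ≤ lam) :
    BddAbove (Set.range fun q : Set.Ici (0 : ℝ) => rsValue P φ lam q) := by
  refine ⟨plantedEnergy P φ lam 1 + 3 / 4 * lam * K ^ 2, ?_⟩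
  rintro _ ⟨q, rfl⟩
  have := rsValue_le_plantedEnergy hP hφ hlam q.2 one_ne_zero
  simp only [Nat.cast_one, one_mul] at this
  simp only
  linarith

theorem tendsto_plantedEnergy_div (hP : IsPrior P) (hφ : ∀ b, φ b ^ 2 ≤ K) (hlam : 0 < lam) :
    Tendsto (fun n : ℕ => plantedEnergy P φ lam n / n) atTop
      (nhds (⨆ q : Set.Ici (0 : ℝ), rsValue P φ lam q)) := by
  have hbdd := bddAbove_rsValue hP hφ hlam.le
  set Φ := ⨆ q : Set.Ici (0 : ℝ), rsValue P φ lam q with hΦ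
  have hle : ∀ q, 0 ≤ q → rsValue P φ lam q ≤ Φ := fun q hq => le_ciSup hbdd ⟨q, hq⟩
  have hinv : Tendsto (fun n : ℕ => (1 : ℝ) / n) atTop (nhds 0) :=
    tendsto_one_div_atTop_nhds_zero_nat
  have hsqrt : Tendsto (fun n : ℕ => (1 : ℝ) / √n) atTop (nhds 0) := by
    have := Real.tendsto_sqrt_atTop.comp (tendsto_natCast_atTop_atTop (R := ℝ))
    simpa only [one_div, Function.comp_def] using! this.inv_tendsto_atTop
  refine tendsto_order.2 ⟨fun x hx => ?_, fun x hx => ?_⟩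
  · obtain ⟨q, hq⟩ := exists_lt_of_lt_ciSup hx
    have hlim : Tendsto (fun n : ℕ => rsValue P φ lam q - 3 / 4 * lam * K ^ 2 * (1 / n)) atTop
        (nhds (rsValue P φ lam q)) := by
      simpa using (hinv.const_mul (3 / 4 * lam * K ^ 2)).const_sub (rsValue P φ lam q)
    filter_upwards [hlim.eventually_const_lt hq, eventually_ne_atTop 0] with n hn hn0
    have hn' : (0 : ℝ) < n := by positivity
    refine hn.trans_le ?_
    rw [le_div_iff₀ hn']
    have := rsValue_le_plantedEnergy hP hφ hlam.le q.2 hn0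
    refine le_trans (le_of_eq ?_) this
    field_simp
  · obtain ⟨η, hη, hηx⟩ : ∃ η : ℝ, 0 < η ∧ Φ + lam * η ^ 2 / 2 < x := by
      -- With this `η` the window cost `lam * η ^ 2 / 2` is half of the gap `x - Φ`.
      refine ⟨√((x - Φ) / lam), Real.sqrt_pos.2 (div_pos (sub_pos.2 hx) hlam), ?_⟩
      rw [Real.sq_sqrt (div_pos (sub_pos.2 hx) hlam).le, mul_div_cancel₀ _ hlam.ne']
      linarith
    obtain ⟨B, hB⟩ := plantedEnergy_le hP hφ hlam.le hle hη
    have hlim : Tendsto (fun n : ℕ => Φ + lam * η ^ 2 / 2 + B * (1 / n + 1 / √n)) atTop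
        (nhds (Φ + lam * η ^ 2 / 2)) := by
      simpa using ((hinv.add hsqrt).const_mul B).const_add (Φ + lam * η ^ 2 / 2)
    filter_upwards [hlim.eventually_lt_const hηx, eventually_ne_atTop 0] with n hn hn0
    have hn' : (0 : ℝ) < n := by positivity
    refine lt_of_le_of_lt ?_ hn
    rw [div_le_iff₀ hn']
    refine (hB n hn0).trans (le_of_eq ?_)
    have hs := Real.sq_sqrt hn'.le
    have hs0 := (Real.sqrt_pos.2 hn').ne'
    field_simp
    linear_combination (2 * B) * hs

end Asymptotics

end

end SBM

namespace SBM

noncomputable section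

/-! ### The stochastic block model -/

section BlockModel

variable {p : I}

/-- In `EReal` the limsup is monotone without boundedness conditions, and an unbounded sequence
cannot receive a spurious real value. -/
theorem limsup_coe_le {u v : ℕ → ℝ} {L : ℝ} (h : ∀ᶠ n in atTop, u n ≤ v n)
    (hv : Tendsto v atTop (nhds L)) : limsup (fun n => (u n : EReal)) atTop ≤ (L : EReal) := by
  have hv' : Tendsto (fun n => (v n : EReal)) atTop (nhds (L : EReal)) :=
    (continuous_coe_real_ereal.tendsto L).comp hv
  rw [← hv'.limsup_eq]
  exact limsup_le_limsup (h.mono fun n hn => EReal.coe_le_coe_iff.2 hn)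

/-- A bound for the squares of the labels. -/
def phiBound (p : I) : ℝ := (1 - p) / p + p / (1 - p)

theorem phiBound_pos (hp0 : 0 < p) (hp1 : p < 1) : 0 < phiBound p := by
  have h0 : (0 : ℝ) < p := hp0
  have h1 : (0 : ℝ) < 1 - p := sub_pos.2 hp1
  unfold phiBound
  positivity

theorem phi_sq_le (hp0 : 0 < p) (hp1 : p < 1) (b : Fin 2) : phi p b ^ 2 ≤ phiBound p := by
  have h0 : (0 : ℝ) < p := hp0
  have h1 : (0 : ℝ) < 1 - p := sub_pos.2 hp1
  obtain ⟨e0, e1, -⟩ := phi_sq hp0 hp1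
  have h2 := div_pos h1 h0
  have h3 := div_pos h0 h1
  unfold phiBound
  fin_cases b
  · simp only [Fin.zero_eta, e0]; linarith
  · simp only [Fin.mk_one, e1]; linarith

theorem abs_phi_mul_phi_le (hp0 : 0 < p) (hp1 : p < 1) (b b' : Fin 2) :
    |phi p b * phi p b'| ≤ phiBound p := by
  have h := phi_sq_le hp0 hp1 b
  have h' := phi_sq_le hp0 hp1 b'
  rw [abs_le]
  constructor <;> nlinarith [sq_nonneg (phi p b + phi p b'), sq_nonneg (phi p b - phi p b')]

theorem sum_labelWeight_phi_sq (hp0 : 0 < p) (hp1 : p < 1) :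
    ∑ b, labelWeight p b * phi p b ^ 2 = 1 := by
  have h0 : (0 : ℝ) < p := hp0
  have h1 : (0 : ℝ) < 1 - p := sub_pos.2 hp1
  obtain ⟨e0, e1, -⟩ := phi_sq hp0 hp1
  rw [Fin.sum_univ_two, e0, e1]
  simp only [labelWeight, Matrix.cons_val_zero, Matrix.cons_val_one]
  field_simp
  ring

/-- The connectivity matrix is a rank-one perturbation of a constant matrix. -/
theorem connectivity_eq (hp0 : 0 < p) (hp1 : p < 1) {a b c d : ℝ} (hab : p * a + (1 - p) * b = 1)
    (hbc : p * b + (1 - p) * c = 1) (n : ℕ) (x y : Fin 2)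
    (h : d / n * (1 + (1 - b) * (phi p x * phi p y)) ∈ Set.Icc (0 : ℝ) 1) :
    (connectivity a b c d n x y : ℝ) = d / n * (1 + (1 - b) * (phi p x * phi p y)) := by
  have h0 : (0 : ℝ) < p := hp0
  have h1 : (0 : ℝ) < 1 - p := sub_pos.2 hp1
  obtain ⟨e0, e1, e01⟩ := phi_sq hp0 hp1
  rw [sq] at e0 e1
  -- The two constraints are solved for `a` and `c`, which become values of the same rank-one
  -- formula; `b` itself comes from the product `-1` of the two labels.
  have ha : a = 1 + (1 - b) * ((1 - p) / p) := by field_simp; linarith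
  have hc : c = 1 + (1 - b) * (p / (1 - p)) := by field_simp; linarith
  have hval : (!![d / n * a, d / n * b; d / n * b, d / n * c] : Matrix (Fin 2) (Fin 2) ℝ) x y
      = d / n * (1 + (1 - b) * (phi p x * phi p y)) := by
    fin_cases x <;> fin_cases y
    · simp [e0, ← ha]
    · simp [e01]
    · simp [mul_comm (phi p 1), e01]
    · simp [e1, ← hc]
  rw [← hval] at h ⊢
  rw [connectivity, Matrix.map_apply, Set.projIcc_of_mem _ h]

/-- The channel comparison with `δ = d / n`, `ε = 1 - b` and `κ = √(lam / d) * phiBound p`. The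
entropy bound `n log 2` times `4 κ` is the only term of order `n`; the Gaussian errors sum to `n ^ 2
* n ^ (-3/2) = √n` up to constants. -/
theorem abs_mutualInfo_sub_le (hp0 : 0 < p) (hp1 : p < 1) {lam a b c d : ℝ} (hlam : 0 < lam)
    (hd : 0 < d) (hab : p * a + (1 - p) * b = 1) (hbc : p * b + (1 - p) * c = 1)
    (hdb : d * (1 - b) ^ 2 = lam) {n : ℕ} (hn : n ≠ 0) (hκ : √(lam / d) * phiBound p ≤ 1 / 2)
    (hdn : d / n * (1 + √(lam / d) * phiBound p) ≤ 1 / 2)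
    (hK : 6 * (lam / n * phiBound p ^ 2) ≤ 1) :
    |(mutualInfo (sbmLaw (connectivity a b c d n) n p)).toReal
        - (mutualInfo (channelLaw p lam n)).toReal|
      ≤ n * (4 * Real.log 2 * phiBound p * √(lam / d)
        + (4 * d * Real.log 2 * (1 / n) + 41 / 2 * (√lam * phiBound p) ^ 3 * (1 / √n))) := by
  have hn' : (0 : ℝ) < n := by positivity
  have hQ := isPrior_prodPrior (isPrior_labelWeight hp0 hp1) n
  have hε : |1 - b| = √(lam / d) := by
    rw [← hdb, mul_div_cancel_left₀ _ hd.ne', Real.sqrt_sq_eq_abs]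
  have hmem : ∀ x y : Fin 2, d / n * (1 + (1 - b) * (phi p x * phi p y)) ∈ Set.Icc (0 : ℝ) 1 := by
    intro x y
    have h1 : |(1 - b) * (phi p x * phi p y)| ≤ √(lam / d) * phiBound p := by
      rw [abs_mul, hε]
      exact mul_le_mul_of_nonneg_left (abs_phi_mul_phi_le hp0 hp1 x y) (Real.sqrt_nonneg _)
    have h2 := abs_le.1 h1
    have hδ : 0 < d / n := by positivity
    refine ⟨mul_nonneg hδ.le (by linarith), ?_⟩
    have : d / n * (1 + (1 - b) * (phi p x * phi p y)) ≤ d / n * (1 + √(lam / d) * phiBound p) := by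
      exact mul_le_mul_of_nonneg_left (by linarith) hδ.le
    linarith
  rw [(mutualInfo_sbmLaw hp0 hp1 _ n).2, (mutualInfo_channelLaw hp0 hp1 lam n).2]
  simp_rw [fun x y => connectivity_eq hp0 hp1 hab hbc n x y (hmem x y), pairSignal,
    mul_assoc √(lam / n)]
  refine (abs_info_bernLik_sub_info_gaussLik_le hQ
    (fun (e : Pairs n) x => phi p (x e.1.1) * phi p (x e.1.2)) (by positivity) hκ hdn
    (by positivity) (by rw [← hdb]; ring) (phiBound_pos hp0 hp1)
    (fun e x => abs_phi_mul_phi_le hp0 hp1 _ _) (by rw [hε]) hK).trans ?_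
  have hlog : Real.log (Fintype.card (Fin n → Fin 2)) = n * Real.log 2 := by
    simp
  have hs : √(lam / n) = √lam / √n := Real.sqrt_div hlam.le _
  have hsn : 0 < √(n : ℝ) := Real.sqrt_pos.2 hn'
  have hsq := Real.sq_sqrt hn'.le
  have hcard : (Fintype.card (Pairs n) : ℝ) ≤ n ^ 2 / 2 := by
    rw [card_pairs]; linarith
  have hK0 := (phiBound_pos hp0 hp1).le
  calc _ ≤ (4 * (√(lam / d) * phiBound p) + 4 * (d / n)) * (n * Real.log 2)
        + n ^ 2 / 2 * (41 * (√lam / √n * phiBound p) ^ 3) := by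
        rw [hlog, hs]
        gcongr
    _ = _ := by
        have h4 : (n : ℝ) ^ 2 / 2 * (41 * (√lam / √n * phiBound p) ^ 3)
            = n * (41 / 2 * (√lam * phiBound p) ^ 3 * (1 / √n)) := by
          field_simp
          linear_combination (-phiBound p ^ 3) * hsq
        rw [h4]
        field_simp
        ring

theorem tendsto_mutualInfo_channelLaw (hp0 : 0 < p) (hp1 : p < 1) {lam : ℝ} (hlam : 0 < lam) :
    Tendsto (fun n : ℕ => 1 / n * (mutualInfo (channelLaw p lam n)).toReal) atTop
      (nhds (lam / 4 - PhiG p lam)) := by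
  have hP := isPrior_labelWeight hp0 hp1
  have hΦ : PhiG p lam = ⨆ q : Set.Ici (0 : ℝ), rsValue (labelWeight p) (phi p) lam q :=
    iSup_congr fun q => rsPotential_eq hp0 hp1 (mul_nonneg hlam.le q.2)
  have hF := tendsto_plantedEnergy_div hP (phi_sq_le hp0 hp1) hlam
  rw [← hΦ] at hF
  have hinv : Tendsto (fun n : ℕ => (1 : ℝ) / n) atTop (nhds 0) :=
    tendsto_one_div_atTop_nhds_zero_nat
  have hlim : Tendsto (fun n : ℕ => lam / 4 * (1 - 1 / n)
      - plantedEnergy (labelWeight p) (phi p) lam n / n) atTop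
      (nhds (lam / 4 * (1 - 0) - PhiG p lam)) := ((hinv.const_sub 1).const_mul _).sub hF
  rw [sub_zero, mul_one] at hlim
  refine hlim.congr' ?_
  filter_upwards [eventually_ne_atTop 0] with n hn
  have hn' : (n : ℝ) ≠ 0 := by exact_mod_cast hn
  rw [(mutualInfo_channelLaw hp0 hp1 lam n).2,
    info_channel hP (sum_labelWeight_phi_sq hp0 hp1) hlam.le hn]
  field_simp

theorem eventually_abs_mutualInfo_sub_le (hp0 : 0 < p) (hp1 : p < 1) {lam a b c d : ℝ}
    (hlam : 0 < lam) (hd : 0 < d) (hab : p * a + (1 - p) * b = 1) (hbc : p * b + (1 - p) * c = 1)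
    (hdb : d * (1 - b) ^ 2 = lam) (hκ : √(lam / d) * phiBound p ≤ 1 / 2) :
    ∃ v : ℕ → ℝ, Tendsto v atTop (nhds (4 * Real.log 2 * phiBound p * √(lam / d))) ∧
      ∀ᶠ n : ℕ in atTop, 1 / n * |(mutualInfo (sbmLaw (connectivity a b c d n) n p)).toReal
        - (mutualInfo (channelLaw p lam n)).toReal| ≤ v n := by
  have hinv : Tendsto (fun n : ℕ => (1 : ℝ) / n) atTop (nhds 0) :=
    tendsto_one_div_atTop_nhds_zero_nat
  have hsqrt : Tendsto (fun n : ℕ => (1 : ℝ) / √n) atTop (nhds 0) := by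
    have := Real.tendsto_sqrt_atTop.comp (tendsto_natCast_atTop_atTop (R := ℝ))
    simpa only [one_div, Function.comp_def] using! this.inv_tendsto_atTop
  have hdiv : ∀ x : ℝ, Tendsto (fun n : ℕ => x / n) atTop (nhds 0) :=
    tendsto_const_div_atTop_nhds_zero_nat
  refine ⟨fun n => 4 * Real.log 2 * phiBound p * √(lam / d)
    + (4 * d * Real.log 2 * (1 / n) + 41 / 2 * (√lam * phiBound p) ^ 3 * (1 / √n)), ?_, ?_⟩
  · simpa using ((hinv.const_mul (4 * d * Real.log 2)).add
      (hsqrt.const_mul (41 / 2 * (√lam * phiBound p) ^ 3))).const_add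
      (4 * Real.log 2 * phiBound p * √(lam / d))
  · have h1 : Tendsto (fun n : ℕ => d / n * (1 + √(lam / d) * phiBound p)) atTop (nhds 0) := by
      simpa using (hdiv d).mul_const (1 + √(lam / d) * phiBound p)
    have h2 : Tendsto (fun n : ℕ => 6 * (lam / n * phiBound p ^ 2)) atTop (nhds 0) := by
      simpa using ((hdiv lam).mul_const (phiBound p ^ 2)).const_mul 6
    filter_upwards [h1.eventually_le_const (by norm_num : (0 : ℝ) < 1 / 2),
      h2.eventually_le_const one_pos, eventually_ne_atTop 0] with n hdn hK hn
    have hn' : (0 : ℝ) < n := by positivity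
    rw [one_div_mul_eq_div, div_le_iff₀' hn']
    exact abs_mutualInfo_sub_le hp0 hp1 hlam hd hab hbc hdb hn hκ hdn hK

end BlockModel

end

end SBM

/-! ### Assembly -/

theorem mainTheorem5 (p : unitInterval) (hp0 : 0 < p) (hp1 : p < 1) :
    ∃ C : ℝ, 0 < C ∧ ∀ lam : ℝ, 0 < lam →
      BddAbove (Set.range fun q : Set.Ici (0 : ℝ) => SBM.rsPotential p lam q) ∧
      (∀ n : ℕ, SBM.mutualInfo (SBM.channelLaw p lam n) ≠ ∞) ∧
      ∃ d₀ : ℝ, ∀ a b c d : ℝ, 0 < d → d₀ ≤ d →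
        p * a + (1 - p) * b = 1 → p * b + (1 - p) * c = 1 → d * (1 - b) ^ 2 = lam →
        (∀ n : ℕ, SBM.mutualInfo (SBM.sbmLaw (SBM.connectivity a b c d n) n p) ≠ ∞) ∧
        limsup (fun n : ℕ =>
            (((1 / n) * |(SBM.mutualInfo (SBM.sbmLaw (SBM.connectivity a b c d n) n p)).toReal
              - (SBM.mutualInfo (SBM.channelLaw p lam n)).toReal| : ℝ) : EReal)) atTop
          ≤ ((C * √(lam / d) : ℝ) : EReal) ∧
        limsup (fun n : ℕ =>
            ((|(1 / n) * (SBM.mutualInfo (SBM.sbmLaw (SBM.connectivity a b c d n) n p)).toReal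
              - (lam / 4 - SBM.PhiG p lam)| : ℝ) : EReal)) atTop
          ≤ ((C * √(lam / d) : ℝ) : EReal) := by
  have hK := SBM.phiBound_pos hp0 hp1
  -- The constant is the coefficient left by the entropy bound. The threshold on `d` is what `√(lam
  -- / d) * phiBound p ≤ 1 / 2` requires.
  refine ⟨4 * Real.log 2 * SBM.phiBound p, by positivity, fun lam hlam => ⟨?_,
    fun n => (SBM.mutualInfo_channelLaw hp0 hp1 lam n).1, lam * (2 * SBM.phiBound p) ^ 2,
    fun a b c d hd hd₀ hab hbc hdb => ⟨fun n => (SBM.mutualInfo_sbmLaw hp0 hp1 _ n).1, ?_⟩⟩⟩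
  · have h := SBM.bddAbove_rsValue (SBM.isPrior_labelWeight hp0 hp1) (SBM.phi_sq_le hp0 hp1)
      hlam.le
    convert h using 3 with q
    exact SBM.rsPotential_eq hp0 hp1 (mul_nonneg hlam.le q.2)
  · have hκ : √(lam / d) * SBM.phiBound p ≤ 1 / 2 := by
      have h : √(lam / d) ≤ 1 / (2 * SBM.phiBound p) := by
        refine Real.sqrt_le_iff.2 ⟨by positivity, ?_⟩
        rw [div_pow, one_pow, div_le_div_iff₀ hd (by positivity), one_mul]
        exact hd₀
      calc _ ≤ 1 / (2 * SBM.phiBound p) * SBM.phiBound p := by gcongr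
        _ = 1 / 2 := by field_simp
    obtain ⟨v, hv, hle⟩ :=
      SBM.eventually_abs_mutualInfo_sub_le hp0 hp1 hlam hd hab hbc hdb hκ
    refine ⟨SBM.limsup_coe_le hle hv, ?_⟩
    -- The second bound follows from the first by the triangle inequality, the Gaussian information
    -- per site converging to the limit.
    have hY := (SBM.tendsto_mutualInfo_channelLaw hp0 hp1 hlam).sub_const
      (lam / 4 - SBM.PhiG p lam)
    rw [sub_self] at hY
    have hY' := hY.abs
    rw [abs_zero] at hY'
    have hsum := hv.add hY'
    rw [add_zero] at hsum
    refine SBM.limsup_coe_le ?_ hsum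
    filter_upwards [hle] with n hn
    have hn0 : (0 : ℝ) ≤ 1 / n := by positivity
    rw [← abs_of_nonneg hn0, ← abs_mul] at hn
    refine le_trans (le_of_eq ?_) ((abs_add_le _ _).trans (add_le_add_left hn _))
    congr 1
    ring
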